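/- Let $n,p\ge 0$, let $\mathcal D_{x,t}=\mathbb C\{x_1,\dots,x_n,t_1,\dots,t_p\}[\partial_x,\partial_t]$ and let $\mathcal D=\mathbb C\{x\}[\partial_x]\subset\mathcal D_{x,t}$. Let $F_d(\mathcal D_{x,t})$ be the operators of order $\le d$, let $V_k(\mathcal D_{x,t})$ be the operators whose development contains only monomials $x^\alpha t^\mu\partial_x^\beta\partial_t^\nu$ with $|\nu|-|\mu|\le k$, and put $F_{d,k}(\mathcal D_{x,t})=F_d(\mathcal D_{x,t})\cap V_k(\mathcal D_{x,t})$; write $F_d(\mathcal D)$ for the operators of order $\le d$ in $\mathcal D$. Let $M$ be a left $\mathcal D_{x,t}$-module with a good bifiltration $(F_{d,k}(M))_{d,k\in\mathbb Z}$, that is, there are $f_1,\dots,f_r\in M$ and integers $n_i,m_i$ with $F_{d,k}(M)=\sum_i F_{d-n_i,k-m_i}(\mathcal D_{x,t})f_i$ for all $d,k$, and $\bigcup_{d,k}F_{d,k}(M)=M$. Put $V_k(M)=\bigcup_d F_{d,k}(M)$. Assume $M=\mathcal D_{x,t}V_0(M)$ and let $b(s)\in\mathbb C[s]$ be a non-zero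 polynomial with $b(\theta)V_0(M)\subset V_{-1}(M)$, where $\theta=\sum_j t_j\partial_{t_j}$. Let $k_1$ be an integer such that $b(k)\ne 0$ for every integer $k>k_1$. Let $\cdots\to\mathcal L_1\to\mathcal L_0\to M\to 0$ be any bifiltered free resolution of $M$: the $\mathcal L_i$ are free of finite rank with bifiltration $F_{d,k}(\mathcal L_i)=\sum_j F_{d-n^{(i)}_j,k-m^{(i)}_j}(\mathcal D_{x,t})e_j$ for a basis $(e_j)$ and integers $n^{(i)}_j,m^{(i)}_j$, and the sequence is exact and induces exact sequences of the $F_{d,k}$ for all $d,k$. Consider the filtered complexes of $\mathcal D$-modules $$K_\bullet:\quad 0\to V_{k_1+p}(M)\otimes\Lambda^p\mathbb C^p\to\cdots\to V_{k_1+1}(M)\otimes\Lambda^1\mathbb C^p\to V_{k_1}(M)\otimes\Lambda^0\mathbb C^p\to 0$$ (Koszul differential of $t_1,\dots,t_p$, filtered by the $F_{d,k_1+j}(M)\otimes\Lambda^j\mathbb C^p$) and $$Q_\bullet:\quad \cdots\to \frac{V_{k_1}(\mathcal L_1)}{\sum_j t_jV_{k_1+1}(\mathcal L_1)}\to\frac{V_{k_1}(\mathcal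 L_0)}{\sum_j t_jV_{k_1+1}(\mathcal L_0)}\to 0$$ (filtered by the images of the $F_{d,k_1}(\mathcal L_i)$). Let $DF(\mathcal D)$ be the localization of the homotopy category of bounded complexes of $\mathcal D$-modules with exhaustive $F$-filtration (maps modulo $F$-adapted homotopies) with respect to the maps $\alpha$ for which $\mathrm{gr}^F(\alpha)$ is a quasi-isomorphism, and let $DF^-(\mathcal D)$ be the same with complexes bounded only on the right. Then: 1. $K_\bullet$ and $Q_\bullet$ are isomorphic in $DF^-(\mathcal D)$, and they are isomorphic in $DF(\mathcal D)$ if $\mathcal L_i=0$ for $i\gg 0$. 2. Each $Q_i$ is a filtered free module of finite rank: it has a finite $\mathcal D$-basis $e_1,\dots,e_r$ and integers $n_1,\dots,n_r$ with $F_d(Q_i)=\sum_j F_{d-n_j}(\mathcal D)e_j$ for all $d$. 3. Assume in addition, in case $k_1<-1$, that $b(\theta+k)V_k(M)\subset V_{k-1}(M)$ for all integers $k$ with $k_1<k<0$ (for $k_1\ge -1$ nothing more is assumed). Then $K_\bullet$ and $Q_\bullet$ are both isomorphic in the derived category $D(\mathcal D)$ to the restriction $i^*M=(\mathcal D_{x,t}/\sum_j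 t_j\mathcal D_{x,t})\otimes^L_{\mathcal D_{x,t}}M$. Thus $Q_\bullet$ is an $F$-filtered free resolution of $i^*M$. -/

import Mathlib

open CategoryTheory CategoryTheory.Limits TensorProduct

universe u w

noncomputable section

namespace DMod

/-! ### Convergent power series -/

/-- A formal power series over `ℂ` converges near the origin if it converges absolutely at some
point `(r, …, r)` with `r > 0`. -/
def IsConv {σ : Type} (f : MvPowerSeries σ ℂ) : Prop :=
  ∃ r : ℝ, 0 < r ∧ Summable fun e : σ →₀ ℕ => ‖MvPowerSeries.coeff e f‖ * r ^ e.degree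

theorem isConv_mono {σ : Type} {f : MvPowerSeries σ ℂ} {r s : ℝ} (hs : 0 < s) (hsr : s ≤ r)
    (h : Summable fun e : σ →₀ ℕ => ‖MvPowerSeries.coeff e f‖ * r ^ e.degree) :
    Summable fun e : σ →₀ ℕ => ‖MvPowerSeries.coeff e f‖ * s ^ e.degree :=
  Summable.of_nonneg_of_le (fun _ => by positivity)
    (fun _ => by gcongr) h

theorem isConv_monomial {σ : Type} (m : σ →₀ ℕ) (c : ℂ) :
    IsConv (MvPowerSeries.monomial m c) := by
  classical
  refine ⟨1, one_pos, summable_of_hasFiniteSupport ((Set.finite_singleton m).subset ?_)⟩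
  intro e he
  by_contra hne
  apply he
  have : e ≠ m := hne
  simp [MvPowerSeries.coeff_monomial, this]

theorem IsConv.add {σ : Type} {f g : MvPowerSeries σ ℂ} (hf : IsConv f) (hg : IsConv g) :
    IsConv (f + g) := by
  obtain ⟨r, hr, hf⟩ := hf
  obtain ⟨s, hs, hg⟩ := hg
  have hf' := isConv_mono (lt_min hr hs) (min_le_left r s) hf
  have hg' := isConv_mono (lt_min hr hs) (min_le_right r s) hg
  refine ⟨min r s, lt_min hr hs,
    Summable.of_nonneg_of_le (fun e => ?_) (fun e => ?_) (hf'.add hg')⟩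
  · have := lt_min hr hs
    positivity
  · have := lt_min hr hs
    rw [← add_mul, map_add]
    gcongr
    exact norm_add_le _ _

theorem summable_antidiagonal {A : Type*} [AddCommMonoid A] [Finset.HasAntidiagonal A]
    {u v : A → ℝ} (hu : Summable u) (hv : Summable v) (hu0 : 0 ≤ u) (hv0 : 0 ≤ v) :
    Summable fun e : A => ∑ x ∈ Finset.HasAntidiagonal.antidiagonal e, u x.1 * v x.2 :=
  summable_sum_mul_antidiagonal_of_summable_mul (Summable.mul_of_nonneg hu hv hu0 hv0)

theorem IsConv.mul {σ : Type} {f g : MvPowerSeries σ ℂ} (hf : IsConv f) (hg : IsConv g) :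
    IsConv (f * g) := by
  classical
  obtain ⟨r, hr, hf⟩ := hf
  obtain ⟨s, hs, hg⟩ := hg
  have hq := lt_min hr hs
  have hf' := isConv_mono hq (min_le_left r s) hf
  have hg' := isConv_mono hq (min_le_right r s) hg
  generalize min r s = q at hq hf' hg'
  refine ⟨q, hq, Summable.of_nonneg_of_le
    (fun e => mul_nonneg (norm_nonneg _) (pow_nonneg hq.le _)) (fun e => ?_)
    (summable_antidiagonal hf' hg'
      (fun e => mul_nonneg (norm_nonneg _) (pow_nonneg hq.le _))
      (fun e => mul_nonneg (norm_nonneg _) (pow_nonneg hq.le _)))⟩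
  have h1 : ‖MvPowerSeries.coeff e (f * g)‖ ≤ ∑ x ∈ Finset.HasAntidiagonal.antidiagonal e,
      ‖MvPowerSeries.coeff x.1 f * MvPowerSeries.coeff x.2 g‖ := by
    rw [MvPowerSeries.coeff_mul]
    exact norm_sum_le _ _
  refine (mul_le_mul_of_nonneg_right h1 (pow_nonneg hq.le _)).trans (le_of_eq ?_)
  rw [Finset.sum_mul]
  refine Finset.sum_congr rfl fun x hx => ?_
  have he : e.degree = x.1.degree + x.2.degree := by
    rw [← map_add, Finset.HasAntidiagonal.mem_antidiagonal.1 hx]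
  rw [he, pow_add, norm_mul]
  exact mul_mul_mul_comm _ _ _ _

theorem isConv_X {σ : Type} (i : σ) : IsConv (MvPowerSeries.X i : MvPowerSeries σ ℂ) :=
  isConv_monomial _ _

theorem IsConv.pderiv {σ : Type} {f : MvPowerSeries σ ℂ} (hf : IsConv f) (i : σ) :
    IsConv (MvPowerSeries.pderiv ℂ i f) := by
  obtain ⟨r, hr, hf⟩ := hf
  have hinj : Function.Injective fun e : σ →₀ ℕ => e + Finsupp.single i 1 :=
    add_left_injective _
  refine ⟨r / 2, by positivity, Summable.of_nonneg_of_le (fun e => by positivity) (fun e => ?_)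
    ((hf.comp_injective hinj).mul_left r⁻¹)⟩
  have h1 : ((e i : ℝ) + 1) ≤ 2 ^ e.degree := by
    have h2 : e i + 1 ≤ 2 ^ e i := Nat.lt_two_pow_self
    have h3 : 2 ^ e i ≤ 2 ^ e.degree := Nat.pow_le_pow_right (by norm_num) (Finsupp.le_degree i e)
    exact_mod_cast h2.trans h3
  have h4 : ‖((e i : ℂ) + 1)‖ = (e i : ℝ) + 1 := by
    have : ((e i : ℂ) + 1) = ((e i + 1 : ℕ) : ℂ) := by push_cast; rfl
    rw [this, Complex.norm_natCast]
    push_cast; rfl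
  simp only [Function.comp, MvPowerSeries.coeff_pderiv, norm_mul, h4, map_add,
    Finsupp.degree_single, pow_succ, div_pow]
  calc ‖MvPowerSeries.coeff (e + Finsupp.single i 1) f‖ * ((e i : ℝ) + 1)
          * (r ^ e.degree / 2 ^ e.degree)
      ≤ ‖MvPowerSeries.coeff (e + Finsupp.single i 1) f‖ * 2 ^ e.degree
          * (r ^ e.degree / 2 ^ e.degree) := by gcongr
    _ = _ := by field_simp

/-- The algebra of convergent power series in the variables indexed by `σ`. -/
def convSubalgebra (σ : Type) : Subalgebra ℂ (MvPowerSeries σ ℂ) where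
  carrier := {f | IsConv f}
  mul_mem' := fun hf hg => IsConv.mul hf hg
  add_mem' := fun hf hg => IsConv.add hf hg
  algebraMap_mem' c := by
    have := isConv_monomial (σ := σ) 0 c
    simpa [MvPowerSeries.algebraMap_apply, MvPowerSeries.monomial_zero_eq_C_apply] using this

/-- The ring `ℂ{σ}` of convergent power series in the variables indexed by `σ`. -/
def ConvSeries (σ : Type) : Type := convSubalgebra σ

instance (σ : Type) : CommRing (ConvSeries σ) := inferInstanceAs (CommRing (convSubalgebra σ))

instance (σ : Type) : Algebra ℂ (ConvSeries σ) := inferInstanceAs (Algebra ℂ (convSubalgebra σ))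

/-- The formal power series of an element of `ℂ{σ}`. -/
def ser {σ : Type} (a : ConvSeries σ) : MvPowerSeries σ ℂ := (show convSubalgebra σ from a).1

/-- The partial derivative `∂_i` on `ℂ{σ}`. -/
def pd {σ : Type} (i : σ) : Module.End ℂ (ConvSeries σ) where
  toFun f := (⟨MvPowerSeries.pderiv ℂ i (ser f), IsConv.pderiv f.2 i⟩ : convSubalgebra σ)
  map_add' _ _ := Subtype.ext (map_add _ _ _)
  map_smul' c f := Subtype.ext (Derivation.map_smul _ c (ser f))

/-! ### Rings of differential operators and their filtrations -/

/-- The ring of differential operators `ℂ{σ}[∂]`: the algebra of operators on `ℂ{σ}` generated by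
the multiplication operators and the partial derivatives. -/
def diffOps (σ : Type) : Subalgebra ℂ (Module.End ℂ (ConvSeries σ)) :=
  Algebra.adjoin ℂ (Set.range (Algebra.lmul ℂ (ConvSeries σ)) ∪ Set.range (pd (σ := σ)))

variable (n p : ℕ)

/-- The convergent power series in `x_1, …, x_n` (indices `Sum.inl`) and `t_1, …, t_p`
(indices `Sum.inr`). -/
abbrev Oxt : Type := ConvSeries (Fin n ⊕ Fin p)

/-- The ring `D_{x,t}`. -/
def Dxt : Type := diffOps (Fin n ⊕ Fin p)

instance : Ring (Dxt n p) := inferInstanceAs (Ring (diffOps (Fin n ⊕ Fin p)))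

instance : Algebra ℂ (Dxt n p) := inferInstanceAs (Algebra ℂ (diffOps (Fin n ⊕ Fin p)))

variable {n p}

/-- Multiplication by `a`, as an element of `D_{x,t}`. -/
def fn (a : Oxt n p) : Dxt n p :=
  (⟨Algebra.lmul ℂ _ a, Algebra.subset_adjoin (Or.inl ⟨a, rfl⟩)⟩ : diffOps _)

/-- The derivation with respect to a variable, as an element of `D_{x,t}`. -/
def dd (i : Fin n ⊕ Fin p) : Dxt n p :=
  (⟨pd i, Algebra.subset_adjoin (Or.inr ⟨i, rfl⟩)⟩ : diffOps _)

/-- The variable `t_j` as an element of `ℂ{x,t}`. -/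
def tvar (j : Fin p) : Oxt n p :=
  (⟨MvPowerSeries.X (Sum.inr j), isConv_X _⟩ : convSubalgebra _)

/-- The variable `t_j` as an element of `D_{x,t}`. -/
def tt (j : Fin p) : Dxt n p := fn (tvar j)

variable (n p) in
/-- The Euler operator `t_1 ∂_{t_1} + ⋯ + t_p ∂_{t_p}`. -/
def theta : Dxt n p := ∑ j, tt j * dd (Sum.inr j)

/-- The operator `∂_x^β`. -/
def dxPow (β : Fin n → ℕ) : Dxt n p := (List.ofFn fun i => dd (Sum.inl i) ^ β i).prod

/-- The operator `∂_t^ν`. -/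
def dtPow (ν : Fin p → ℕ) : Dxt n p := (List.ofFn fun j => dd (Sum.inr j) ^ ν j).prod

variable (n p) in
/-- `F_d(D_{x,t})`: the operators of order at most `d`. -/
def FD (d : ℤ) : Submodule ℂ (Dxt n p) :=
  Submodule.span ℂ {P | ∃ (a : Oxt n p) (β : Fin n → ℕ) (ν : Fin p → ℕ),
    ((∑ i, β i + ∑ j, ν j : ℕ) : ℤ) ≤ d ∧ P = fn a * dxPow β * dtPow ν}

variable (n p) in
/-- `V_k(D_{x,t})`: the operators whose development contains only monomials
`x^α t^μ ∂_x^β ∂_t^ν` with `|ν| - |μ| ≤ k`. -/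
def VD (k : ℤ) : Submodule ℂ (Dxt n p) :=
  Submodule.span ℂ {P | ∃ (a : Oxt n p) (β : Fin n → ℕ) (ν : Fin p → ℕ),
    (∀ e : (Fin n ⊕ Fin p) →₀ ℕ, MvPowerSeries.coeff e (ser a) ≠ 0 →
      ((∑ j, ν j : ℕ) : ℤ) - ((∑ j, e (Sum.inr j) : ℕ) : ℤ) ≤ k) ∧
    P = fn a * dxPow β * dtPow ν}

variable (n p) in
/-- The bifiltration `F_{d,k}(D_{x,t}) = F_d(D_{x,t}) ∩ V_k(D_{x,t})`. -/
def FVD (d k : ℤ) : Submodule ℂ (Dxt n p) := FD n p d ⊓ VD n p k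

/-- The series `a` does not involve the variables `t`, i.e. it lies in `ℂ{x}`. -/
def NoT (a : Oxt n p) : Prop :=
  ∀ e : (Fin n ⊕ Fin p) →₀ ℕ, MvPowerSeries.coeff e (ser a) ≠ 0 →
    ∀ j, e (Sum.inr j) = 0

variable (n p) in
/-- The ring `D = ℂ{x}[∂_x]`, as the subring of `D_{x,t}` of the operators that involve neither
`t` nor `∂_t`; every `D_{x,t}`-module is a `D`-module through this inclusion. -/
def Dx : Subalgebra ℂ (Dxt n p) :=
  Algebra.adjoin ℂ (fn '' {a | NoT a} ∪ Set.range fun i : Fin n => dd (Sum.inl i))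

variable (n p) in
/-- `F_d(D)`: the operators `∑ a_β(x) ∂_x^β` of order at most `d`. -/
def FDx (d : ℤ) : Submodule ℂ (Dx n p) :=
  (Submodule.span ℂ {P : Dxt n p | ∃ (a : Oxt n p) (β : Fin n → ℕ), NoT a ∧
    ((∑ i, β i : ℕ) : ℤ) ≤ d ∧ P = fn a * dxPow β}).comap (Dx n p).val.toLinearMap

theorem dxPow_zero : dxPow (n := n) (p := p) 0 = 1 := by
  simp [dxPow]

theorem dtPow_zero : dtPow (n := n) (p := p) 0 = 1 := by
  simp [dtPow]

theorem prod_ofFn_single {A : Type*} [Monoid A] : ∀ {m : ℕ} (f : Fin m → A) (i : Fin m),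
    (List.ofFn fun j => f j ^ (Pi.single i 1 : Fin m → ℕ) j).prod = f i
  | 0, _, i => i.elim0
  | m + 1, f, i => by
    rw [List.ofFn_succ, List.prod_cons]
    refine Fin.cases ?_ (fun i => ?_) i
    · simp
    · have := prod_ofFn_single (fun j => f j.succ) i
      simpa [Pi.single_apply, Fin.succ_inj] using this

theorem dxPow_single (i : Fin n) : dxPow (p := p) (Pi.single i 1) = dd (Sum.inl i) :=
  prod_ofFn_single (fun i => dd (Sum.inl i)) i

theorem coeff_one_ne {e : (Fin n ⊕ Fin p) →₀ ℕ}
    (h : MvPowerSeries.coeff e (ser (1 : Oxt n p)) ≠ 0) : e = 0 := by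
  classical
  by_contra hne
  refine h (?_ : MvPowerSeries.coeff e (1 : MvPowerSeries (Fin n ⊕ Fin p) ℂ) = 0)
  rw [MvPowerSeries.coeff_one, if_neg hne]

theorem fn_one : fn (1 : Oxt n p) = 1 := Subtype.ext (map_one _)

theorem noT_one : NoT (1 : Oxt n p) := fun e he j => by simp [coeff_one_ne he]

theorem one_mem_FDx : (1 : Dx n p) ∈ FDx n p 0 :=
  Submodule.subset_span ⟨1, 0, noT_one, by simp, by simp [fn_one, dxPow_zero]⟩

theorem FDx_mono {d e : ℤ} (h : d ≤ e) : FDx n p d ≤ FDx n p e :=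
  Submodule.comap_mono (Submodule.span_mono
    fun _ ⟨a, β, ha, hd, hP⟩ => ⟨a, β, ha, hd.trans h, hP⟩)

theorem FDx_le {d : ℤ} {P : Dx n p} (hP : P ∈ FDx n p d) : (P : Dxt n p) ∈ FVD n p d 0 := by
  refine (Submodule.span_le.2 ?_ : _ ≤ FVD n p d 0) hP
  rintro _ ⟨a, β, ha, hd, rfl⟩
  refine ⟨Submodule.subset_span ⟨a, β, 0, by simpa using hd, by simp [dtPow_zero]⟩,
    Submodule.subset_span ⟨a, β, 0, fun e _ => ?_, by simp [dtPow_zero]⟩⟩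
  have : (0 : ℤ) ≤ ((∑ j, e (Sum.inr j) : ℕ) : ℤ) := Int.natCast_nonneg _
  simp only [Pi.zero_apply, Finset.sum_const_zero]
  push_cast at this ⊢
  linarith

theorem fn_mem_FVD {a : Oxt n p} (ha : NoT a) : fn a ∈ FVD n p 0 0 := by
  have h : fn a ∈ Dx n p := Algebra.subset_adjoin (Or.inl ⟨a, ha, rfl⟩)
  exact FDx_le (P := ⟨fn a, h⟩)
    (Submodule.subset_span ⟨a, 0, ha, by simp, by simp [dxPow_zero]⟩)

theorem dd_mem_FVD (i : Fin n) : (dd (Sum.inl i) : Dxt n p) ∈ FVD n p 1 0 := by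
  have h : (dd (Sum.inl i) : Dxt n p) ∈ Dx n p := Algebra.subset_adjoin (Or.inr ⟨i, rfl⟩)
  refine FDx_le (P := ⟨_, h⟩) (Submodule.subset_span ⟨1, Pi.single i 1, noT_one, ?_, ?_⟩)
  · simp [Finset.sum_pi_single']
  · simp [fn_one, dxPow_single]

theorem tt_mem_FVD (j : Fin p) : (tt j : Dxt n p) ∈ FVD n p 0 (-1) := by
  classical
  refine ⟨Submodule.subset_span ⟨tvar j, 0, 0, by simp, by simp [tt, dxPow_zero, dtPow_zero]⟩,
    Submodule.subset_span ⟨tvar j, 0, 0, fun e he => ?_, by simp [tt, dxPow_zero, dtPow_zero]⟩⟩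
  have h1 : e = Finsupp.single (Sum.inr j) 1 := by
    by_contra hne
    refine he (?_ : MvPowerSeries.coeff e
      (MvPowerSeries.X (Sum.inr j) : MvPowerSeries (Fin n ⊕ Fin p) ℂ) = 0)
    rw [MvPowerSeries.coeff_X, if_neg hne]
  subst h1
  have h2 : (∑ k, (Finsupp.single (Sum.inr j : Fin n ⊕ Fin p) 1) (Sum.inr k)) = 1 := by
    rw [Finset.sum_eq_single j]
    · simp
    · intro k _ hk
      rw [Finsupp.single_apply, if_neg]
      exact fun h => hk (Sum.inr_injective h).symm
    · simp
  rw [h2]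
  simp

theorem fn_comm (a b : Oxt n p) : fn a * fn b = fn b * fn a :=
  Subtype.ext (by
    change Algebra.lmul ℂ _ a * Algebra.lmul ℂ _ b = Algebra.lmul ℂ _ b * Algebra.lmul ℂ _ a
    rw [← map_mul, ← map_mul, mul_comm])

theorem tt_dd (j : Fin p) (i : Fin n) :
    (tt j : Dxt n p) * dd (Sum.inl i) = dd (Sum.inl i) * tt j := by
  apply Subtype.ext
  apply LinearMap.ext
  intro f
  apply Subtype.ext
  change MvPowerSeries.X (Sum.inr j) * MvPowerSeries.pderiv ℂ (Sum.inl i) (ser f) =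
    MvPowerSeries.pderiv ℂ (Sum.inl i) (MvPowerSeries.X (Sum.inr j) * ser f)
  rw [Derivation.leibniz, MvPowerSeries.pderiv_X_of_ne (by simp)]
  simp

theorem tt_comm (j : Fin p) {P : Dxt n p} (hP : P ∈ Dx n p) : tt j * P = P * tt j := by
  have h : Dx n p ≤ Subalgebra.centralizer ℂ {tt j} := by
    refine Algebra.adjoin_le ?_
    rintro _ (⟨a, _, rfl⟩ | ⟨i, rfl⟩)
    · exact fun g hg => by rw [Set.mem_singleton_iff.1 hg]; exact fn_comm _ _
    · exact fun g hg => by rw [Set.mem_singleton_iff.1 hg]; exact tt_dd _ _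
  exact h hP _ rfl

/-! ### Bifiltered `D_{x,t}`-modules -/

section Modules

variable {M : Type u} [AddCommGroup M] [Module (Dxt n p) M]
variable {N : Type u} [AddCommGroup N] [Module (Dxt n p) N]

/-- Multiplication by `t_j` on a `D_{x,t}`-module; it is `D`-linear. -/
def tlin (M : Type u) [AddCommGroup M] [Module (Dxt n p) M] (j : Fin p) : M →ₗ[Dx n p] M where
  toFun m := (tt j : Dxt n p) • m
  map_add' := smul_add _
  map_smul' P m := by
    change (tt j : Dxt n p) • (P : Dxt n p) • m = (P : Dxt n p) • (tt j : Dxt n p) • m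
    rw [← mul_smul, ← mul_smul, tt_comm j P.2]

/-- A `D_{x,t}`-linear map, seen as a `D`-linear map. -/
def resD (f : M →ₗ[Dxt n p] N) : M →ₗ[Dx n p] N where
  toFun := f
  map_add' := f.map_add
  map_smul' P m := f.map_smul (P : Dxt n p) m

variable (n p M) in
/-- A bifiltration of a `D_{x,t}`-module. (Each `F d k` is automatically stable under
multiplication by `ℂ{x}`, in particular it is a vector space.) -/
structure Bifiltration where
  /-- the subspaces `F_{d,k}(M)` -/
  F : ℤ → ℤ → AddSubgroup M
  exhaustive : ∀ m, ∃ d k, m ∈ F d k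
  mono_left : ∀ d k, F d k ≤ F (d + 1) k
  mono_right : ∀ d k, F d k ≤ F d (k + 1)
  smul_mem : ∀ {d k d' k' : ℤ} {P : Dxt n p} {m : M},
    P ∈ FVD n p d k → m ∈ F d' k' → P • m ∈ F (d + d') (k + k')

namespace Bifiltration

/-- `F_{d,k}(M) = ∑ F_{d - n_i, k - m_i}(D_{x,t}) f_i` for all `d, k`. -/
def GeneratedBy (B : Bifiltration n p M) {r : ℕ} (f : Fin r → M) (a b : Fin r → ℤ) : Prop :=
  ∀ (d k : ℤ) (x : M), x ∈ B.F d k ↔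
    ∃ P : Fin r → Dxt n p, (∀ i, P i ∈ FVD n p (d - a i) (k - b i)) ∧ x = ∑ i, P i • f i

/-- A good bifiltration. -/
def IsGood (B : Bifiltration n p M) : Prop :=
  ∃ (r : ℕ) (f : Fin r → M) (a b : Fin r → ℤ), B.GeneratedBy f a b

/-- The bifiltered module is (isomorphic to) a bifiltered free module
`D_{x,t}^r[𝐧][𝐦]` of finite rank. -/
def IsFree (B : Bifiltration n p M) : Prop :=
  ∃ (r : ℕ) (e : Module.Basis (Fin r) (Dxt n p) M) (a b : Fin r → ℤ), B.GeneratedBy e a b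

variable (B : Bifiltration n p M)

theorem mono_d {d e : ℤ} (h : d ≤ e) (k : ℤ) : B.F d k ≤ B.F e k := by
  obtain ⟨l, rfl⟩ := Int.le.dest h
  induction l with
  | zero => simp
  | succ l ih =>
    refine (ih (by lia)).trans ?_
    have := B.mono_left (d + l) k
    rwa [add_assoc] at this

/-- The `V`-filtration `V_k(M) = ⋃_d F_{d,k}(M)`; each `V_k(M)` is a `D`-submodule of `M`. -/
def V (k : ℤ) : Submodule (Dx n p) M where
  carrier := {m | ∃ d, m ∈ B.F d k}
  zero_mem' := ⟨0, zero_mem _⟩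
  add_mem' := by
    rintro x y ⟨d, hx⟩ ⟨e, hy⟩
    exact ⟨max d e, add_mem (B.mono_d (le_max_left d e) k hx) (B.mono_d (le_max_right d e) k hy)⟩
  smul_mem' := by
    rintro ⟨P, hP⟩ x hx
    suffices h : ∀ x : M, (∃ d, x ∈ B.F d k) → ∃ d, P • x ∈ B.F d k from h x hx
    refine Algebra.adjoin_induction (p := fun P _ => ∀ x : M, (∃ d, x ∈ B.F d k) →
      ∃ d, P • x ∈ B.F d k) ?_ ?_ ?_ ?_ hP
    · rintro _ (⟨a, ha, rfl⟩ | ⟨i, rfl⟩) x ⟨d, hx⟩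
      · exact ⟨_, by simpa using B.smul_mem (fn_mem_FVD ha) hx⟩
      · exact ⟨1 + d, by simpa using B.smul_mem (dd_mem_FVD i) hx⟩
    · rintro c x ⟨d, hx⟩
      refine ⟨0 + d, ?_⟩
      have h : algebraMap ℂ (Dxt n p) c ∈ FVD n p 0 0 := by
        rw [Algebra.algebraMap_eq_smul_one]
        exact Submodule.smul_mem _ _ (FDx_le one_mem_FDx)
      simpa using B.smul_mem h hx
    · intro P Q _ _ hP hQ x hx
      obtain ⟨d, h1⟩ := hP x hx
      obtain ⟨e, h2⟩ := hQ x hx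
      exact ⟨max d e, by
        rw [add_smul]
        exact add_mem (B.mono_d (le_max_left d e) k h1) (B.mono_d (le_max_right d e) k h2)⟩
    · intro P Q _ _ hP hQ x hx
      rw [mul_smul]
      exact hP _ (hQ x hx)

theorem tt_smul_mem (j : Fin p) {d k l : ℤ} (h : l = k + 1) {m : M} (hm : m ∈ B.F d l) :
    (tt j : Dxt n p) • m ∈ B.F d k := by
  have := B.smul_mem (tt_mem_FVD j) hm
  rwa [zero_add, show -1 + l = k by lia] at this

end Bifiltration

/-- The sign `(-1)^{#{l ∈ s | l < i}}` of `e_i ∧ e_s`. -/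
def ksign (i : Fin p) (s : Finset (Fin p)) : ℤ := (-1) ^ (s.filter (· < i)).card

variable (n M) in
/-- The Koszul differential on `M ⊗ Λ^• ℂ^p`. An element `∑_s c_s ⊗ e_s` of `M ⊗ Λ^• ℂ^p`
(with `e_s = e_{i_1} ∧ ⋯ ∧ e_{i_j}` for `s = {i_1 < ⋯ < i_j}`) is written as the family `(c_s)`,
and `δ (m ⊗ e_{i_1} ∧ ⋯ ∧ e_{i_j}) = ∑_l (-1)^{l-1} t_{i_l} m ⊗ (e_{i_1} ∧ ⋯ omit i_l ⋯ )`. -/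
def koszulD : (Finset (Fin p) → M) →ₗ[Dx n p] (Finset (Fin p) → M) :=
  LinearMap.pi fun s => ∑ i ∈ sᶜ, ksign i s • (tlin M i ∘ₗ LinearMap.proj (insert i s))

theorem koszulD_apply (c : Finset (Fin p) → M) (s : Finset (Fin p)) :
    koszulD n M c s = ∑ i ∈ sᶜ, ksign i s • ((tt i : Dxt n p) • c (insert i s)) := by
  simp [koszulD, LinearMap.sum_apply, tlin]

theorem ksign_swap {i j : Fin p} {s : Finset (Fin p)} (hi : i ∉ s) (hj : j ∉ s) (hij : i ≠ j) :
    ksign i s * ksign j (insert i s) = -(ksign j s * ksign i (insert j s)) := by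
  have key : ∀ {i j : Fin p}, i ∉ s → j ∉ s → i < j →
      ksign i s * ksign j (insert i s) = -(ksign j s * ksign i (insert j s)) := by
    intro i j hi hj h
    unfold ksign
    rw [Finset.filter_insert, Finset.filter_insert, if_pos h, if_neg h.asymm,
      Finset.card_insert_of_notMem (by simp [hi]), pow_succ]
    ring
  rcases lt_or_gt_of_ne hij with h | h
  · exact key hi hj h
  · rw [key hj hi h, neg_neg]

theorem koszulD_comp (c : Finset (Fin p) → M) : koszulD n M (koszulD n M c) = 0 := by
  funext s
  rw [koszulD_apply]
  simp only [koszulD_apply, Finset.smul_sum]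
  rw [Finset.sum_sigma', Pi.zero_apply]
  refine Finset.sum_involution (fun x _ => ⟨x.2, x.1⟩) ?_ ?_ ?_ ?_
  · rintro ⟨i, j⟩ h
    simp only [Finset.mem_sigma, Finset.mem_compl, Finset.mem_insert, not_or] at h
    obtain ⟨hi, hji, hj⟩ := h
    have h1 : ∀ (a b : ℤ) (P Q : Dxt n p) (m : M),
        a • P • b • Q • m = (a * b) • (P * Q) • m := fun a b P Q m => by
      rw [mul_smul, mul_smul, smul_comm P b]
    simp only [h1]
    rw [ksign_swap hi hj (Ne.symm hji), Finset.insert_comm i j s,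
      show (tt i : Dxt n p) * tt j = tt j * tt i from fn_comm _ _, neg_smul, neg_add_cancel]
  · rintro ⟨i, j⟩ h _ heq
    simp only [Finset.mem_sigma, Finset.mem_compl, Finset.mem_insert, not_or] at h
    exact h.2.1 (congrArg Sigma.fst heq)
  · rintro ⟨i, j⟩ h
    simp only [Finset.mem_sigma, Finset.mem_compl, Finset.mem_insert, not_or] at h ⊢
    exact ⟨h.2.2, Ne.symm h.2.1, h.1⟩
  · rintro ⟨i, j⟩ _
    rfl

end Modules

/-! ### `F`-filtered `D`-modules and their derived category -/

variable (n p) in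
/-- A filtered `D`-module: a `D`-module with an exhaustive `F`-filtration. -/
structure FiltMod where
  carrier : Type u
  [grp : AddCommGroup carrier]
  [mod : Module (Dx n p) carrier]
  /-- the subspaces `F_d` -/
  F : ℤ → AddSubgroup carrier
  exhaustive : ∀ m, ∃ d, m ∈ F d
  smul_mem : ∀ {d e : ℤ} {P : Dx n p} {m : carrier}, P ∈ FDx n p d → m ∈ F e → P • m ∈ F (d + e)

attribute [instance] FiltMod.grp FiltMod.mod

namespace FiltMod

theorem mono (X : FiltMod.{u} n p) {d e : ℤ} (h : d ≤ e) : X.F d ≤ X.F e := fun m hm => by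
  have h1 : (1 : Dx n p) ∈ FDx n p (e - d) := FDx_mono (by lia) one_mem_FDx
  have := X.smul_mem h1 hm
  rwa [one_smul, sub_add_cancel] at this

/-- The filtered module is (isomorphic to) a filtered free module `D^r[𝐧]` of finite rank:
it has a basis `e_1, …, e_r` such that `F_d = ∑ F_{d - n_i}(D) e_i`. -/
def IsFree (X : FiltMod.{u} n p) : Prop :=
  ∃ (r : ℕ) (e : Module.Basis (Fin r) (Dx n p) X.carrier) (a : Fin r → ℤ),
    ∀ (d : ℤ) (x : X.carrier), x ∈ X.F d ↔
      ∃ P : Fin r → Dx n p, (∀ i, P i ∈ FDx n p (d - a i)) ∧ x = ∑ i, P i • e i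

/-- The group of `F`-adapted `D`-linear maps. -/
def homs (X Y : FiltMod.{u} n p) : AddSubgroup (X.carrier →ₗ[Dx n p] Y.carrier) where
  carrier := {f | ∀ d, ∀ m ∈ X.F d, f m ∈ Y.F d}
  zero_mem' d _ _ := zero_mem (Y.F d)
  add_mem' hf hg d m hm := add_mem (hf d m hm) (hg d m hm)
  neg_mem' hf d m hm := neg_mem (hf d m hm)

instance : Category (FiltMod.{u} n p) where
  Hom X Y := homs X Y
  id X := ⟨LinearMap.id, fun _ _ hm => hm⟩
  comp f g := ⟨g.1 ∘ₗ f.1, fun d m hm => g.2 d _ (f.2 d m hm)⟩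

/-- The morphism of filtered modules given by an `F`-adapted linear map. -/
def ofHom {X Y : FiltMod.{u} n p} (f : X.carrier →ₗ[Dx n p] Y.carrier)
    (hf : ∀ d, ∀ m ∈ X.F d, f m ∈ Y.F d) : X ⟶ Y := (⟨f, hf⟩ : homs X Y)

/-- The linear map underlying a morphism of filtered modules. -/
def lin {X Y : FiltMod.{u} n p} (f : X ⟶ Y) : X.carrier →ₗ[Dx n p] Y.carrier :=
  (show homs X Y from f).1

theorem lin_mem {X Y : FiltMod.{u} n p} (f : X ⟶ Y) {d : ℤ} {m : X.carrier} (hm : m ∈ X.F d) :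
    lin f m ∈ Y.F d := (show homs X Y from f).2 d m hm

theorem hom_ext {X Y : FiltMod.{u} n p} {f g : X ⟶ Y} (h : ∀ m, lin f m = lin g m) : f = g :=
  Subtype.ext (LinearMap.ext h)

instance : Preadditive (FiltMod.{u} n p) where
  homGroup X Y := inferInstanceAs (AddCommGroup (homs X Y))
  add_comp _ _ _ f f' g := hom_ext fun m => (lin g).map_add (lin f m) (lin f' m)
  comp_add _ _ _ _ _ _ := rfl

instance : HasZeroObject (FiltMod.{u} n p) where
  zero := ⟨{ carrier := PUnit.{u + 1}
             F := fun _ => ⊤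
             exhaustive := fun _ => ⟨0, trivial⟩
             smul_mem := fun _ _ => trivial },
    { unique_to := fun Y => ⟨⟨⟨0⟩, fun f => hom_ext fun m => by
        rw [Subsingleton.elim m 0, map_zero, map_zero]⟩⟩
      unique_from := fun Y => ⟨⟨⟨0⟩, fun f => hom_ext fun m => Subsingleton.elim _ _⟩⟩ }⟩

variable (n p) in
/-- The functor that forgets the filtration. -/
def forget : FiltMod.{u} n p ⥤ ModuleCat.{u} (Dx n p) where
  obj X := ModuleCat.of _ X.carrier
  map f := ModuleCat.ofHom (lin f)

instance : (forget.{u} n p).Additive where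
  map_add := rfl

variable (n p) in
/-- The functor `gr_d : X ↦ F_d(X) / F_{d-1}(X)`. -/
def gr (d : ℤ) : FiltMod.{u} n p ⥤ AddCommGrpCat.{u} where
  obj X := AddCommGrpCat.of (X.F d ⧸ (X.F (d - 1)).addSubgroupOf (X.F d))
  map {X Y} f := AddCommGrpCat.ofHom (QuotientAddGroup.map _ _
    (((lin f).toAddMonoidHom.comp (X.F d).subtype).codRestrict (Y.F d)
      fun m => lin_mem f m.2)
    fun _ hm => lin_mem f hm)
  map_id X := by
    ext x
    rfl
  map_comp f g := by
    ext x
    rfl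

instance (d : ℤ) : (gr.{u} n p d).Additive where
  map_add {X Y f g} := by
    ext x
    obtain ⟨x, rfl⟩ := QuotientAddGroup.mk_surjective x
    rfl

end FiltMod

variable (n p) in
/-- The homotopy category of complexes of filtered `D`-modules, with maps taken modulo
`F`-adapted homotopies. A complex `⋯ → X_i → X_{i-1} → ⋯` is written cohomologically, with `X_i`
in degree `-i`. -/
abbrev KF : Type (u + 1) := HomotopyCategory (FiltMod.{u} n p) (ComplexShape.up ℤ)

variable (n p) in
/-- The filtered quasi-isomorphisms: the maps `α` such that `gr^F(α)` is a quasi-isomorphism. -/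
def filtQuasiIso : MorphismProperty (KF.{u} n p) := fun _ _ α =>
  ∀ d : ℤ, HomotopyCategory.quasiIso AddCommGrpCat.{u} (ComplexShape.up ℤ)
    (((FiltMod.gr.{u} n p d).mapHomotopyCategory (ComplexShape.up ℤ)).map α)

variable (n p) in
/-- The bounded complexes of filtered `D`-modules. -/
def bounded : ObjectProperty (CochainComplex (FiltMod.{u} n p) ℤ) := fun K =>
  ∃ a b : ℤ, K.IsStrictlyGE a ∧ K.IsStrictlyLE b

variable (n p) in
/-- The complexes of filtered `D`-modules `⋯ → X_i → X_{i-1} → ⋯` with `X_i = 0` for `i ≪ 0`. -/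
def boundedRight : ObjectProperty (CochainComplex (FiltMod.{u} n p) ℤ) := fun K =>
  ∃ b : ℤ, K.IsStrictlyLE b

/-- The homotopy category of the complexes of filtered `D`-modules with the property `S`. -/
abbrev KFOf (S : ObjectProperty (CochainComplex (FiltMod.{u} n p) ℤ)) : Type (u + 1) :=
  (S.strictMap (HomotopyCategory.quotient (FiltMod.{u} n p) (ComplexShape.up ℤ))).FullSubcategory

/-- The filtered derived category of the complexes with the property `S`: the localization of the
homotopy category with respect to the filtered quasi-isomorphisms. For `S = bounded n p` this is
`DF(D)`; for `S = boundedRight n p` this is its version `DF⁻(D)` for complexes that are bounded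
only on the right. -/
abbrev DFOf (S : ObjectProperty (CochainComplex (FiltMod.{u} n p) ℤ)) : Type (u + 1) :=
  ((filtQuasiIso.{u} n p).inverseImage
    (S.strictMap (HomotopyCategory.quotient _ (ComplexShape.up ℤ))).ι).Localization

/-- A complex with the property `S`, as an object of the filtered derived category. -/
def toDF (S : ObjectProperty (CochainComplex (FiltMod.{u} n p) ℤ))
    (K : CochainComplex (FiltMod.{u} n p) ℤ) (hK : S K) : DFOf S :=
  ((filtQuasiIso.{u} n p).inverseImage
    (S.strictMap (HomotopyCategory.quotient _ (ComplexShape.up ℤ))).ι).Q.obj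
    ⟨(HomotopyCategory.quotient _ (ComplexShape.up ℤ)).obj K, ⟨K, hK⟩⟩

/-- The complexes `K` and `L` have the property `S` and are isomorphic in the filtered derived
category of the complexes with this property. -/
def IsoDF (S : ObjectProperty (CochainComplex (FiltMod.{u} n p) ℤ))
    (K L : CochainComplex (FiltMod.{u} n p) ℤ) : Prop :=
  ∃ (hK : S K) (hL : S L), Nonempty (toDF S K hK ≅ toDF S L hL)

/-- A complex `⋯ → X_1 → X_0 → 0`, as a cochain complex with `X_i` in degree `-i`. -/
abbrev toCochain {C : Type*} [Category* C] [HasZeroMorphisms C] [HasZeroObject C]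
    (K : ChainComplex C ℕ) : CochainComplex C ℤ :=
  K.extend ComplexShape.embeddingDownNat

/-! ### The truncated Koszul complex -/

section Koszul

variable {M : Type u} [AddCommGroup M] [Module (Dxt n p) M] (B : Bifiltration n p M) (k : ℤ)

/-- The `D`-module `V_{k+j}(M) ⊗ Λ^j ℂ^p`: the families `(c_s)` with `c_s ∈ V_{k+j}(M)` that are
supported on the `j`-element subsets `s` of `{1, …, p}`. -/
def koszulV (j : ℕ) : Submodule (Dx n p) (Finset (Fin p) → M) where
  carrier := {c | ∀ s, c s ∈ B.V (k + j) ∧ (s.card ≠ j → c s = 0)}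
  zero_mem' s := ⟨zero_mem _, fun _ => rfl⟩
  add_mem' hx hy s := ⟨add_mem (hx s).1 (hy s).1, fun h => by
    rw [Pi.add_apply, (hx s).2 h, (hy s).2 h, add_zero]⟩
  smul_mem' P x hx s := ⟨Submodule.smul_mem _ P (hx s).1, fun h => by
    rw [Pi.smul_apply, (hx s).2 h, smul_zero]⟩

/-- `V_{k+j}(M) ⊗ Λ^j ℂ^p` with the filtration `F_{d,k+j}(M) ⊗ Λ^j ℂ^p`. -/
def koszulX (j : ℕ) : FiltMod.{u} n p where
  carrier := koszulV B k j
  F d :=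
    { carrier := {c | ∀ s, c.1 s ∈ B.F d (k + j)}
      zero_mem' := fun _ => zero_mem _
      add_mem' := fun hx hy s => add_mem (hx s) (hy s)
      neg_mem' := fun hx s => neg_mem (hx s) }
  exhaustive c := by
    choose d hd using fun s => (c.2 s).1
    exact ⟨Finset.univ.sup' Finset.univ_nonempty d,
      fun s => B.mono_d (Finset.le_sup' d (Finset.mem_univ s)) _ (hd s)⟩
  smul_mem hP hm s := by
    have := B.smul_mem (FDx_le hP) (hm s)
    rwa [zero_add] at this

theorem koszulD_mem {d : ℤ} {j : ℕ} {c : Finset (Fin p) → M}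
    (hc : ∀ s, c s ∈ B.F d (k + ((j + 1 : ℕ) : ℤ))) (s : Finset (Fin p)) :
    koszulD n M c s ∈ B.F d (k + j) := by
  rw [koszulD_apply]
  refine sum_mem fun i _ => zsmul_mem (B.tt_smul_mem i ?_ (hc _)) _
  push_cast
  ring

theorem koszulD_memV {j : ℕ} {c : Finset (Fin p) → M} (hc : c ∈ koszulV B k (j + 1)) :
    koszulD n M c ∈ koszulV B k j := by
  obtain ⟨d, hd⟩ := (koszulX B k (j + 1)).exhaustive ⟨c, hc⟩
  refine fun s => ⟨⟨d, koszulD_mem B k hd s⟩, fun hs => ?_⟩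
  rw [koszulD_apply]
  refine Finset.sum_eq_zero fun i hi => ?_
  rw [(hc (insert i s)).2, smul_zero, smul_zero]
  rw [Finset.card_insert_of_notMem (Finset.mem_compl.1 hi)]
  exact fun h => hs (Nat.succ_injective h)

/-- The filtered complex `V_{k+•}(M) ⊗ Λ^•`:
`0 → V_{k+p}(M) ⊗ Λ^p → ⋯ → V_{k+1}(M) ⊗ Λ^1 → V_k(M) ⊗ Λ^0 → 0`. -/
def koszulComplex : ChainComplex (FiltMod.{u} n p) ℕ :=
  ChainComplex.of (koszulX B k)
    (fun j => FiltMod.ofHom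
      ((koszulD n M).restrict fun _ hc => koszulD_memV B k hc)
      (fun _ _ hc s => koszulD_mem B k hc s))
    (fun _ => FiltMod.hom_ext fun c => Subtype.ext (koszulD_comp c.1))

/-! ### The complex `V_k(L_•) / ∑ t_i V_{k+1}(L_•)` -/

/-- The `D`-submodule `∑_j t_j V_{k+1}(M)` of `M`. -/
def tV : Submodule (Dx n p) M := ⨆ j : Fin p, (B.V (k + 1)).map (tlin M j)

/-- `V_k(M) / ∑_j t_j V_{k+1}(M)`, filtered by the images of the `F_{d,k}(M)`. -/
def quotX : FiltMod.{u} n p where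
  carrier := B.V k ⧸ (tV B k).submoduleOf (B.V k)
  F d := ((B.F d k).addSubgroupOf (B.V k).toAddSubgroup).map
    ((tV B k).submoduleOf (B.V k)).mkQ.toAddMonoidHom
  exhaustive m := by
    obtain ⟨x, rfl⟩ := Submodule.mkQ_surjective _ m
    obtain ⟨d, hd⟩ := x.2
    exact ⟨d, x, hd, rfl⟩
  smul_mem {d e P m} hP hm := by
    obtain ⟨x, hx, rfl⟩ := hm
    refine ⟨P • x, ?_, rfl⟩
    have := B.smul_mem (FDx_le hP) hx
    rwa [zero_add] at this

end Koszul

section Quot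

variable {M : Type u} [AddCommGroup M] [Module (Dxt n p) M] {B : Bifiltration n p M}
variable {N : Type u} [AddCommGroup N] [Module (Dxt n p) N] {B' : Bifiltration n p N}

theorem resD_memV {f : M →ₗ[Dxt n p] N} (hf : ∀ d k, ∀ m ∈ B.F d k, f m ∈ B'.F d k) {k : ℤ}
    {m : M} (hm : m ∈ B.V k) : resD f m ∈ B'.V k :=
  hm.imp fun d hd => hf d k m hd

theorem resD_memtV {f : M →ₗ[Dxt n p] N} (hf : ∀ d k, ∀ m ∈ B.F d k, f m ∈ B'.F d k) {k : ℤ}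
    {m : M} (hm : m ∈ tV B k) : resD f m ∈ tV B' k := by
  suffices h : tV B k ≤ (tV B' k).comap (resD f) from h hm
  refine iSup_le fun j => ?_
  rintro _ ⟨x, hx, rfl⟩
  refine Submodule.mem_iSup_of_mem j ⟨resD f x, resD_memV hf hx, ?_⟩
  exact (f.map_smul (tt j : Dxt n p) x).symm

/-- The map induced by a bifiltered map on the quotients `V_k / ∑_j t_j V_{k+1}`. -/
def quotMap (f : M →ₗ[Dxt n p] N) (hf : ∀ d k, ∀ m ∈ B.F d k, f m ∈ B'.F d k) (k : ℤ) :
    quotX B k ⟶ quotX B' k :=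
  FiltMod.ofHom
    (Submodule.mapQ ((tV B k).submoduleOf (B.V k)) ((tV B' k).submoduleOf (B'.V k))
      ((resD f).restrict fun _ hm => resD_memV hf hm) fun _ hm => resD_memtV hf hm)
    (by
      rintro d _ ⟨x, hx, rfl⟩
      exact ⟨⟨f x.1, resD_memV hf x.2⟩, hf d k _ hx, rfl⟩)

/-- A bifiltered free resolution `⋯ → L_1 → L_0 → M → 0`, with `L_i` a bifiltered free module
`D_{x,t}^{r_i}[𝐧^{(i)}][𝐦^{(i)}]`. -/
structure BifilteredFreeResolution (B : Bifiltration n p M) where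
  L : ℕ → Type u
  [grp : ∀ i, AddCommGroup (L i)]
  [mod : ∀ i, Module (Dxt n p) (L i)]
  /-- the bifiltration of `L_i` -/
  filt : ∀ i, Bifiltration n p (L i)
  free : ∀ i, (filt i).IsFree
  /-- the differentials -/
  ψ : ∀ i, L (i + 1) →ₗ[Dxt n p] L i
  /-- the augmentation -/
  ε : L 0 →ₗ[Dxt n p] M
  ψ_mem : ∀ i d k, ∀ m ∈ (filt (i + 1)).F d k, ψ i m ∈ (filt i).F d k
  ε_mem : ∀ d k, ∀ m ∈ (filt 0).F d k, ε m ∈ B.F d k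
  ψ_exact : ∀ i, Function.Exact (ψ (i + 1)) (ψ i)
  ε_exact : Function.Exact (ψ 0) ε
  ε_surj : Function.Surjective ε
  ψ_exact_F : ∀ i d k, ∀ m ∈ (filt (i + 1)).F d k, ψ i m = 0 →
    ∃ m' ∈ (filt (i + 2)).F d k, ψ (i + 1) m' = m
  ε_exact_F : ∀ d k, ∀ m ∈ (filt 0).F d k, ε m = 0 → ∃ m' ∈ (filt 1).F d k, ψ 0 m' = m
  ε_surj_F : ∀ d k, ∀ m ∈ B.F d k, ∃ m' ∈ (filt 0).F d k, ε m' = m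

attribute [instance] BifilteredFreeResolution.grp BifilteredFreeResolution.mod

/-- The filtered complex `V_k(L_•) / ∑_j t_j V_{k+1}(L_•)`. -/
def quotComplex (R : BifilteredFreeResolution B) (k : ℤ) : ChainComplex (FiltMod.{u} n p) ℕ :=
  ChainComplex.of (fun i => quotX (R.filt i) k)
    (fun i => quotMap (R.ψ i) (R.ψ_mem i) k)
    (fun i => FiltMod.hom_ext fun m => by
      obtain ⟨x, rfl⟩ := Submodule.mkQ_surjective _ m
      refine (congrArg (Submodule.mkQ ((tV (R.filt i) k).submoduleOf ((R.filt i).V k)))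
        (Subtype.ext ?_)).trans (map_zero _)
      exact (R.ψ_exact i).apply_apply_eq_zero x.1)

end Quot

/-! ### The restriction `i^* M` -/

section Restriction

variable (n p) in
/-- The right ideal `∑_j t_j D_{x,t}`, as a left `D`-submodule of `D_{x,t}`. -/
def tIdeal : Submodule (Dx n p) (Dxt n p) := ⨆ j, LinearMap.range (tlin (Dxt n p) j)

variable (n p) in
/-- The bimodule `D_{x,t} / ∑ t_j D_{x,t}`, as a left `D`-module. -/
def Transfer : Type := Dxt n p ⧸ tIdeal n p

instance : AddCommGroup (Transfer n p) := inferInstanceAs (AddCommGroup (Dxt n p ⧸ tIdeal n p))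

instance : Module (Dx n p) (Transfer n p) :=
  inferInstanceAs (Module (Dx n p) (Dxt n p ⧸ tIdeal n p))

/-- The class of an operator in `D_{x,t} / ∑ t_j D_{x,t}`. -/
def Transfer.mk : Dxt n p →ₗ[Dx n p] Transfer n p := (tIdeal n p).mkQ

/-- The `D`-submodule spanned by the elements `(a r) ⊗ m - a ⊗ (r m)`: the kernel of
`(D_{x,t} / ∑ t_j D_{x,t}) ⊗_ℤ M → (D_{x,t} / ∑ t_j D_{x,t}) ⊗_{D_{x,t}} M`. -/
def balance (M : Type u) [AddCommGroup M] [Module (Dxt n p) M] :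
    Submodule (Dx n p) (Transfer n p ⊗[ℤ] M) :=
  Submodule.span (Dx n p) {z | ∃ (a r : Dxt n p) (m : M),
    z = Transfer.mk (a * r) ⊗ₜ[ℤ] m - Transfer.mk a ⊗ₜ[ℤ] (r • m)}

/-- The left `D`-module `(D_{x,t} / ∑ t_j D_{x,t}) ⊗_{D_{x,t}} M`. -/
def Restr (n p : ℕ) (M : Type u) [AddCommGroup M] [Module (Dxt n p) M] : Type u :=
  (Transfer n p ⊗[ℤ] M) ⧸ balance (n := n) (p := p) M

section

variable (M : Type u) [AddCommGroup M] [Module (Dxt n p) M]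

instance : AddCommGroup (Restr n p M) :=
  inferInstanceAs (AddCommGroup ((Transfer n p ⊗[ℤ] M) ⧸ balance (n := n) (p := p) M))

instance : Module (Dx n p) (Restr n p M) :=
  inferInstanceAs (Module (Dx n p) ((Transfer n p ⊗[ℤ] M) ⧸ balance (n := n) (p := p) M))

/-- The class of `a ⊗ m`. -/
def Restr.mk (a : Transfer n p) (m : M) : Restr n p M := (balance (n := n) (p := p) M).mkQ (a ⊗ₜ[ℤ] m)

variable {M} {N : Type u} [AddCommGroup N] [Module (Dxt n p) N]

/-- The map induced by a `D_{x,t}`-linear map. -/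
def Restr.map (f : M →ₗ[Dxt n p] N) : Restr n p M →ₗ[Dx n p] Restr n p N :=
  Submodule.mapQ (balance (n := n) (p := p) M) (balance (n := n) (p := p) N)
    (TensorProduct.AlgebraTensorModule.map LinearMap.id f.toAddMonoidHom.toIntLinearMap)
    (by
      refine Submodule.span_le.2 ?_
      rintro _ ⟨a, r, m, rfl⟩
      exact Submodule.subset_span ⟨a, r, f m, by simp⟩)

theorem Restr.ext {Z : Type*} [AddCommGroup Z] [Module (Dx n p) Z] {f g : Restr n p M →ₗ[Dx n p] Z}
    (h : ∀ a m, f (Restr.mk M a m) = g (Restr.mk M a m)) : f = g := by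
  refine LinearMap.ext fun z => ?_
  obtain ⟨z, rfl⟩ := Submodule.mkQ_surjective (balance (n := n) (p := p) M) z
  induction z using TensorProduct.induction_on with
  | zero => exact (map_zero f).trans (map_zero g).symm
  | tmul a m => exact h a m
  | add x y hx hy =>
    exact (map_add f ((balance (n := n) (p := p) M).mkQ x) ((balance (n := n) (p := p) M).mkQ y)).trans
      ((congrArg₂ _ hx hy).trans (map_add g ((balance (n := n) (p := p) M).mkQ x) ((balance (n := n) (p := p) M).mkQ y)).symm)

end

variable (n p) in
/-- The right exact functor `M ↦ (D_{x,t} / ∑ t_j D_{x,t}) ⊗_{D_{x,t}} M`. -/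
def restrFunctor : ModuleCat.{u} (Dxt n p) ⥤ ModuleCat.{u} (Dx n p) where
  obj M := ModuleCat.of _ (Restr n p M)
  map f := ModuleCat.ofHom (Restr.map f.hom)
  map_id M := ModuleCat.hom_ext (Restr.ext fun _ _ => rfl)
  map_comp f g := ModuleCat.hom_ext (Restr.ext fun _ _ => rfl)

instance : (restrFunctor.{u} n p).Additive where
  map_add {M N f g} := ModuleCat.hom_ext (Restr.ext fun a m =>
    congrArg (balance (n := n) (p := p) N).mkQ (TensorProduct.tmul_add a (f.hom m) (g.hom m)))

/-- The restriction `i^* M = (D_{x,t} / ∑ t_j D_{x,t}) ⊗^L_{D_{x,t}} M`, computed by a projective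
resolution of `M`. -/
def restriction {M : ModuleCat.{u} (Dxt n p)} (P : ProjectiveResolution M) :
    ChainComplex (ModuleCat.{u} (Dx n p)) ℕ :=
  ((restrFunctor n p).mapHomologicalComplex (ComplexShape.down ℕ)).obj P.complex

end Restriction

/-- The complex of `D`-modules underlying a filtered complex. -/
def unfilt (K : ChainComplex (FiltMod.{u} n p) ℕ) : ChainComplex (ModuleCat.{u} (Dx n p)) ℕ :=
  ((FiltMod.forget n p).mapHomologicalComplex (ComplexShape.down ℕ)).obj K

end DMod

end

/-! Everything rests on the Koszul complex of `t_1, …, t_p` and on Cartan's formula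
`koszul_homotopy`: contraction with the `∂_{t_j}` is a homotopy from `θ + j` to zero in Koszul
degree `j`. The formula is used twice, in different ways.

Free modules. An operator has a unique normal form `∑ a_γ ∂^γ`, both filtrations are read off its
monomials, and left multiplication by `t_j` acts on the coefficients `a_γ` alone. On `ℂ{x,t}` the
operator `θ + j` multiplies a monomial by its `t`-degree plus `j`, so it is invertible except on
`t`-free series when `j = 0`, and Cartan's formula yields an explicit primitive of a Koszul cycle.
Applied to coefficients, this primitive keeps the order and raises the `V`-index by one. Hence for a
bifiltered free module `L` the complexes `F_{d,k+•}(L) ⊗ Λ^•` are exact in positive degrees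
(`Bifiltration.IsFree.koszulExact`), and the cokernel `V_k(L) / ∑ t_j V_{k+1}(L)` is filtered free
on the classes of suitable `∂_t^ν e_i` (`quotX_isFree`).

The roof. For a resolution `L_•`, let `T` be the total complex of the double complex `V_{k+j}(L_i) ⊗
Λ^j`. It maps to the Koszul complex of `M` through the augmentation, and to the quotient complex by
passing to cokernels in the Koszul direction. One direction of the double complex is exact because
the resolution is bifiltered, the other by the previous paragraph. So both maps are onto in every
`F_d`, with kernels acyclic in every `F_d` (`toKoszul_strictQuasiIso`, `toQuot_strictQuasiIso`);
such maps are quasi-isomorphisms on `gr^F` and on the underlying complexes. This holds for every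
`k`. The same argument with trivial bifiltrations shows that the full complex `M ⊗ Λ^•` represents
`i^*M`, since the cokernels are then `L_i / ∑ t_j L_i`.

Truncation. The choice of `k₁` matters only for the inclusion of the truncated Koszul complex in the
full one (`quasiIso_koszulIncl`). If `q(θ + k + j)` maps `V_{k+j}` to `V_{k+j-1}`, write `q(θ + k +
j) = q(k) + (θ + j) r(θ + k + j)`. By Cartan's formula the second summand is homotopic to zero, so
modulo `V_{k+j-1}` a cycle multiplied by `q(k)` is a boundary; if `q(k) ≠ 0`, cycles move down the
`V`-filtration as long as `k > k₁`.

Such a `q` without integer roots above `k₁` is needed for every `V_k` with `k > k₁`, while `b` is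
only given up to `k = 0`. Beyond that, `V_{k+1}` need not equal `V_k + ∑ ∂_{t_j} V_k`, but `θ + p =
∑ ∂_{t_j} t_j` maps it into this sum. The defect costs at most the factor `X - (k + 1 - p)`, and
`exists_bernstein_succ` shows that the factor is superfluous when its root exceeds `k₁`. -/

noncomputable section

namespace DMod

section

/-! ### Coefficients of convergent power series -/

section Coefficients

variable {σ : Type}

/-- The coefficient of a convergent power series at an exponent. -/
def cof (e : σ →₀ ℕ) : ConvSeries σ →ₗ[ℂ] ℂ :=
  (MvPowerSeries.coeff e).comp (convSubalgebra σ).val.toLinearMap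

theorem cof_apply (e : σ →₀ ℕ) (a : ConvSeries σ) : cof e a = MvPowerSeries.coeff e (ser a) := rfl

theorem cof_ext {a b : ConvSeries σ} (h : ∀ e, cof e a = cof e b) : a = b :=
  Subtype.ext (MvPowerSeries.ext h)

theorem cof_pd (i : σ) (e : σ →₀ ℕ) (a : ConvSeries σ) :
    cof e (pd i a) = cof (e + Finsupp.single i 1) a * (e i + 1) :=
  MvPowerSeries.coeff_pderiv _ _

/-- The monomial `X^e`. -/
def xpow (e : σ →₀ ℕ) : ConvSeries σ :=
  (⟨MvPowerSeries.monomial e 1, isConv_monomial _ _⟩ : convSubalgebra σ)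

theorem cof_xpow [DecidableEq σ] (e m : σ →₀ ℕ) : cof m (xpow e) = if m = e then 1 else 0 :=
  MvPowerSeries.coeff_monomial _ _ _

theorem cof_mul [DecidableEq σ] (e : σ →₀ ℕ) (a b : ConvSeries σ) :
    cof e (a * b) = ∑ x ∈ Finset.HasAntidiagonal.antidiagonal e, cof x.1 a * cof x.2 b :=
  MvPowerSeries.coeff_mul _ _ _

/-- The operator that multiplies the coefficient at `e` by the number `w e`, where `w` is
bounded by `1`. -/
def scale (w : (σ →₀ ℕ) → ℂ) (hw : ∀ e, ‖w e‖ ≤ 1) : Module.End ℂ (ConvSeries σ) where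
  toFun f := (⟨fun e => w e * MvPowerSeries.coeff e (ser f), by
    obtain ⟨r, hr, hf⟩ := f.2
    refine ⟨r, hr, Summable.of_nonneg_of_le (fun e => by positivity) (fun e => ?_) hf⟩
    change ‖w e * MvPowerSeries.coeff e (ser f)‖ * _ ≤ _
    rw [norm_mul]
    have := mul_le_mul_of_nonneg_right (hw e) (norm_nonneg (MvPowerSeries.coeff e (ser f)))
    rw [one_mul] at this
    exact mul_le_mul_of_nonneg_right this (by positivity)⟩ : convSubalgebra σ)
  map_add' f g := cof_ext fun e => by
    change w e * cof e (f + g) = w e * cof e f + w e * cof e g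
    rw [map_add, mul_add]
  map_smul' c f := cof_ext fun e => by
    change w e * cof e (c • f) = c • (w e * cof e f)
    rw [map_smul, smul_eq_mul, smul_eq_mul, mul_left_comm]

end Coefficients

variable {n p : ℕ}

theorem cof_tvar_mul (j : Fin p) (e : (Fin n ⊕ Fin p) →₀ ℕ) (a : Oxt n p) :
    cof e (tvar j * a) =
      if 1 ≤ e (Sum.inr j) then cof (e - Finsupp.single (Sum.inr j) 1) a else 0 := by
  classical
  have h := MvPowerSeries.coeff_monomial_mul (R := ℂ) (m := e)
    (n := Finsupp.single (Sum.inr j : Fin n ⊕ Fin p) 1) (φ := ser a) (a := 1)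
  rw [one_mul] at h
  refine Eq.trans h ?_
  simp only [Finsupp.single_le_iff]
  rfl

/-- The degree in the variables `t` of an exponent. -/
def tdeg (e : (Fin n ⊕ Fin p) →₀ ℕ) : ℕ := ∑ j, e (Sum.inr j)

theorem tdeg_add_single_inr (e : (Fin n ⊕ Fin p) →₀ ℕ) (j : Fin p) :
    tdeg (e + Finsupp.single (Sum.inr j) 1) = tdeg e + 1 := by
  classical
  simp [tdeg, Finset.sum_add_distrib, Finsupp.single_apply]

theorem tdeg_add_single_inl (e : (Fin n ⊕ Fin p) →₀ ℕ) (i : Fin n) :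
    tdeg (e + Finsupp.single (Sum.inl i) 1) = tdeg e := by
  classical
  simp [tdeg]

theorem tdeg_sub_single (e : (Fin n ⊕ Fin p) →₀ ℕ) (j : Fin p) (h : 1 ≤ e (Sum.inr j)) :
    tdeg e = tdeg (e - Finsupp.single (Sum.inr j) 1) + 1 := by
  rw [← tdeg_add_single_inr]
  congr 1
  refine (tsub_add_cancel_of_le ?_).symm
  rwa [Finsupp.single_le_iff]

theorem tdeg_eq_zero {e : (Fin n ⊕ Fin p) →₀ ℕ} : tdeg e = 0 ↔ ∀ j, e (Sum.inr j) = 0 := by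
  simp [tdeg]

theorem noT_iff {a : Oxt n p} : NoT a ↔ ∀ e, tdeg e ≠ 0 → cof e a = 0 := by
  constructor
  · intro h e he
    by_contra hne
    exact he (tdeg_eq_zero.2 (h e hne))
  · intro h e he
    by_contra hne
    exact he (h e fun h => hne (tdeg_eq_zero.1 h))

/-! ### The action of `D_{x,t}` on `ℂ{x,t}` -/

instance : Module (Dxt n p) (Oxt n p) :=
  inferInstanceAs (Module (diffOps (Fin n ⊕ Fin p)) (ConvSeries (Fin n ⊕ Fin p)))

theorem fn_smul (a f : Oxt n p) : (fn a : Dxt n p) • f = a * f := rfl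

theorem dd_smul (i : Fin n ⊕ Fin p) (f : Oxt n p) : (dd i : Dxt n p) • f = pd i f := rfl

/-- Operators are by definition endomorphisms of `ℂ{x,t}`, so this action is faithful and identities
between them can be tested on series. -/
theorem ext_smul {P Q : Dxt n p} (h : ∀ f : Oxt n p, P • f = Q • f) : P = Q :=
  Subtype.ext (LinearMap.ext h)

theorem csmul_smul (c : ℂ) (P : Dxt n p) (f : Oxt n p) : (c • P) • f = c • (P • f) := rfl

theorem fn_add (a b : Oxt n p) : (fn (a + b) : Dxt n p) = fn a + fn b :=
  ext_smul fun f => by rw [add_smul, fn_smul, fn_smul, fn_smul, add_mul]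

theorem fn_mul (a b : Oxt n p) : (fn (a * b) : Dxt n p) = fn a * fn b :=
  ext_smul fun f => by rw [mul_smul, fn_smul, fn_smul, fn_smul, mul_assoc]

theorem fn_csmul (c : ℂ) (a : Oxt n p) : (fn (c • a) : Dxt n p) = c • fn a :=
  ext_smul fun f => by rw [csmul_smul, fn_smul, fn_smul, smul_mul_assoc]

variable (n p) in
/-- The embedding of `ℂ{x,t}` into `D_{x,t}` as a linear map. -/
def fnL : Oxt n p →ₗ[ℂ] Dxt n p where
  toFun := fn
  map_add' := fn_add
  map_smul' := fn_csmul

theorem pd_mul (i : Fin n ⊕ Fin p) (a f : Oxt n p) : pd i (a * f) = a * pd i f + pd i a * f := by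
  refine Subtype.ext ((Derivation.leibniz (MvPowerSeries.pderiv ℂ i) (ser a) (ser f)).trans ?_)
  rw [smul_eq_mul, smul_eq_mul, mul_comm (ser f)]
  rfl

theorem dd_fn (i : Fin n ⊕ Fin p) (a : Oxt n p) :
    (dd i : Dxt n p) * fn a = fn a * dd i + fn (pd i a) :=
  ext_smul fun f => by
    rw [mul_smul, add_smul, mul_smul, fn_smul, fn_smul, fn_smul, dd_smul, dd_smul, pd_mul]

/-- The product of the factorials of the entries of an exponent. -/
def efac (m : (Fin n ⊕ Fin p) →₀ ℕ) : ℂ := ∏ i, ((m i).factorial : ℂ)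

theorem efac_ne_zero (m : (Fin n ⊕ Fin p) →₀ ℕ) : efac m ≠ 0 :=
  Finset.prod_ne_zero_iff.2 fun _ _ => Nat.cast_ne_zero.2 (Nat.factorial_ne_zero _)

theorem efac_add_single (m : (Fin n ⊕ Fin p) →₀ ℕ) (i : Fin n ⊕ Fin p) :
    efac (m + Finsupp.single i 1) = efac m * (m i + 1) := by
  classical
  unfold efac
  rw [← Finset.mul_prod_erase _ _ (Finset.mem_univ i),
    ← Finset.mul_prod_erase (a := i) _ (fun i => ((m i).factorial : ℂ)) (Finset.mem_univ i)]
  have h : ∀ j ∈ Finset.univ.erase i,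
      (((m + Finsupp.single i 1 : (Fin n ⊕ Fin p) →₀ ℕ) j).factorial : ℂ)
      = ((m j).factorial : ℂ) := fun j hj => by
    simp [(Finset.ne_of_mem_erase hj).symm]
  rw [Finset.prod_congr rfl h]
  simp [Nat.factorial_succ]
  ring

/-- The operator `P` acts on power series as the iterated derivative with exponent `γ`. -/
def ActsAs (P : Dxt n p) (γ : (Fin n ⊕ Fin p) →₀ ℕ) : Prop :=
  ∀ (f : Oxt n p) m, cof m (P • f) = efac (m + γ) / efac m * cof (m + γ) f

/-- Reduces identities between products of derivations, such as `dPow_add`, to additions of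
exponents, with no reordering of the ordered products behind `dxPow` and `dtPow`. -/
theorem ActsAs.eq {P Q : Dxt n p} {γ : (Fin n ⊕ Fin p) →₀ ℕ} (hP : ActsAs P γ)
    (hQ : ActsAs Q γ) : P = Q :=
  ext_smul fun f => cof_ext fun m => by rw [hP, hQ]

theorem actsAs_one : ActsAs (1 : Dxt n p) 0 := fun f m => by
  rw [one_smul, add_zero, div_self (efac_ne_zero m), one_mul]

theorem ActsAs.mul {P Q : Dxt n p} {γ δ : (Fin n ⊕ Fin p) →₀ ℕ} (hP : ActsAs P γ)
    (hQ : ActsAs Q δ) : ActsAs (P * Q) (γ + δ) := fun f m => by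
  rw [mul_smul, hP, hQ, ← mul_assoc, ← add_assoc, div_mul_div_comm, mul_comm (efac (m + γ)),
    mul_div_mul_right _ _ (efac_ne_zero _)]

theorem actsAs_dd (i : Fin n ⊕ Fin p) : ActsAs (dd i : Dxt n p) (Finsupp.single i 1) :=
  fun f m => by
    rw [dd_smul, cof_pd, efac_add_single, mul_div_cancel_left₀ _ (efac_ne_zero m), mul_comm]

theorem ActsAs.pow {P : Dxt n p} {γ : (Fin n ⊕ Fin p) →₀ ℕ} (hP : ActsAs P γ) :
    ∀ k : ℕ, ActsAs (P ^ k) (k • γ)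
  | 0 => by simpa using actsAs_one
  | k + 1 => by simpa [pow_succ, succ_nsmul] using (hP.pow k).mul hP

theorem actsAs_prod_ofFn : ∀ {m : ℕ} {P : Fin m → Dxt n p} {γ : Fin m → (Fin n ⊕ Fin p) →₀ ℕ},
    (∀ i, ActsAs (P i) (γ i)) → ActsAs (List.ofFn P).prod (∑ i, γ i)
  | 0, _, _, _ => by simpa using actsAs_one
  | m + 1, P, γ, h => by
    rw [List.ofFn_succ, List.prod_cons, Fin.sum_univ_succ]
    exact (h 0).mul (actsAs_prod_ofFn fun i => h i.succ)

/-- The exponents of the monomials in `∂_x`, `∂_t`. -/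
abbrev DExp (n p : ℕ) : Type := (Fin n → ℕ) × (Fin p → ℕ)

/-- A pair of exponents as an exponent in all the variables. -/
def DExp.toFinsupp (γ : DExp n p) : (Fin n ⊕ Fin p) →₀ ℕ :=
  Finsupp.equivFunOnFinite.symm (Sum.elim γ.1 γ.2)

theorem DExp.toFinsupp_injective : Function.Injective (DExp.toFinsupp (n := n) (p := p)) := by
  intro γ δ h
  have h1 := Finsupp.equivFunOnFinite.symm.injective h
  exact Prod.ext (funext fun i => congrFun h1 (Sum.inl i)) (funext fun i => congrFun h1 (Sum.inr i))

theorem DExp.toFinsupp_add (γ δ : DExp n p) : (γ + δ).toFinsupp = γ.toFinsupp + δ.toFinsupp := by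
  ext (i | i) <;> simp [DExp.toFinsupp]

/-- The order of a monomial in `∂_x`, `∂_t`. -/
def DExp.ord (γ : DExp n p) : ℕ := ∑ i, γ.1 i + ∑ j, γ.2 j

theorem DExp.degree_toFinsupp (γ : DExp n p) : γ.toFinsupp.degree = γ.ord := by
  simp [Finsupp.degree_eq_sum, DExp.toFinsupp, DExp.ord]

/-- The monomial `∂_x^β ∂_t^ν`. -/
def dPow (γ : DExp n p) : Dxt n p := dxPow γ.1 * dtPow γ.2

theorem actsAs_dPow (γ : DExp n p) : ActsAs (dPow γ) γ.toFinsupp := by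
  have h1 := actsAs_prod_ofFn (fun i => (actsAs_dd (p := p) (Sum.inl i : Fin n ⊕ Fin p)).pow (γ.1 i))
  have h2 := actsAs_prod_ofFn (fun i => (actsAs_dd (n := n) (Sum.inr i : Fin n ⊕ Fin p)).pow (γ.2 i))
  have h3 := h1.mul h2
  convert (show ActsAs (dPow γ) _ from h3) using 1
  classical
  ext (i | i) <;> simp [DExp.toFinsupp, Finsupp.single_apply]

/-- The exponent of a single derivation. -/
def DExp.single : Fin n ⊕ Fin p → DExp n p
  | Sum.inl i => (Pi.single i 1, 0)
  | Sum.inr j => (0, Pi.single j 1)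

theorem DExp.toFinsupp_single (i : Fin n ⊕ Fin p) :
    (DExp.single i).toFinsupp = Finsupp.single i 1 := by
  classical
  rcases i with i | i <;> ext (j | j) <;>
    simp [DExp.toFinsupp, DExp.single, Finsupp.single_apply, eq_comm]

theorem dPow_add (γ δ : DExp n p) : (dPow (γ + δ) : Dxt n p) = dPow γ * dPow δ :=
  (actsAs_dPow _).eq (by rw [DExp.toFinsupp_add]; exact (actsAs_dPow γ).mul (actsAs_dPow δ))

theorem dPow_single (i : Fin n ⊕ Fin p) : (dPow (DExp.single i) : Dxt n p) = dd i :=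
  (actsAs_dPow _).eq (by rw [DExp.toFinsupp_single]; exact actsAs_dd i)

theorem dPow_zero : (dPow 0 : Dxt n p) = 1 := by
  simp [dPow, dxPow_zero, dtPow_zero]

/-! ### The normal form of a differential operator -/

variable (n p) in
/-- The operator `∑ a_γ ∂^γ` with given coefficients. -/
def ofCoeffs : (DExp n p →₀ Oxt n p) →ₗ[ℂ] Dxt n p :=
  Finsupp.lsum ℂ fun γ => (LinearMap.mulRight ℂ (dPow γ)).comp (fnL n p)

theorem ofCoeffs_single (γ : DExp n p) (a : Oxt n p) :
    ofCoeffs n p (Finsupp.single γ a) = fn a * dPow γ := by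
  rw [ofCoeffs, Finsupp.lsum_single]
  rfl

theorem ofCoeffs_apply (c : DExp n p →₀ Oxt n p) :
    ofCoeffs n p c = ∑ γ ∈ c.support, fn (c γ) * dPow γ := by
  rw [ofCoeffs, Finsupp.lsum_apply]
  rfl

theorem fn_mul_mem_range (a : Oxt n p) {P : Dxt n p} (hP : P ∈ LinearMap.range (ofCoeffs n p)) :
    fn a * P ∈ LinearMap.range (ofCoeffs n p) := by
  obtain ⟨c, rfl⟩ := hP
  induction c using Finsupp.induction_linear with
  | zero => simp
  | add c d hc hd => rw [map_add, mul_add]; exact add_mem hc hd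
  | single γ b =>
    rw [ofCoeffs_single, ← mul_assoc, ← fn_mul, ← ofCoeffs_single]
    exact LinearMap.mem_range_self _ _

theorem dd_mul_mem_range (i : Fin n ⊕ Fin p) {P : Dxt n p}
    (hP : P ∈ LinearMap.range (ofCoeffs n p)) :
    dd i * P ∈ LinearMap.range (ofCoeffs n p) := by
  obtain ⟨c, rfl⟩ := hP
  induction c using Finsupp.induction_linear with
  | zero => simp
  | add c d hc hd => rw [map_add, mul_add]; exact add_mem hc hd
  | single γ b =>
    rw [ofCoeffs_single, ← mul_assoc, dd_fn, add_mul, mul_assoc, ← dPow_single, ← dPow_add,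
      ← ofCoeffs_single, ← ofCoeffs_single]
    exact add_mem (LinearMap.mem_range_self _ _) (LinearMap.mem_range_self _ _)

/-- Induction on differential operators. -/
theorem Dxt.induction {C : Dxt n p → Prop} (h1 : C 1) (hadd : ∀ P Q, C P → C Q → C (P + Q))
    (hfn : ∀ a P, C P → C (fn a * P)) (hdd : ∀ i P, C P → C (dd i * P)) (P : Dxt n p) : C P := by
  -- The claim is strengthened to left multiplication preserving `C`, so that the product case of
  -- the adjoin induction becomes composition.
  suffices h : ∀ (x : Module.End ℂ (ConvSeries (Fin n ⊕ Fin p))) (hx : x ∈ diffOps (Fin n ⊕ Fin p)),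
      ∀ Q : Dxt n p, C Q → C ((show Dxt n p from (⟨x, hx⟩ : diffOps _)) * Q) by
    have h2 := h P.1 P.2 1 h1
    rwa [mul_one] at h2
  intro x hx
  refine Algebra.adjoin_induction (p := fun x hx => ∀ Q : Dxt n p, C Q →
    C ((show Dxt n p from (⟨x, hx⟩ : diffOps _)) * Q)) ?_ ?_ ?_ ?_ hx
  · rintro x (⟨a, rfl⟩ | ⟨i, rfl⟩) Q hQ
    · exact hfn a Q hQ
    · exact hdd i Q hQ
  · intro c Q hQ
    have := hfn (algebraMap ℂ _ c) Q hQ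
    convert this using 2
    exact Subtype.ext ((Algebra.lmul ℂ (ConvSeries (Fin n ⊕ Fin p))).commutes c).symm
  · intro x y hx hy h1 h2 Q hQ
    have := hadd _ _ (h1 Q hQ) (h2 Q hQ)
    rwa [← add_mul] at this
  · intro x y hx hy h1 h2 Q hQ
    have := h1 _ (h2 Q hQ)
    rwa [← mul_assoc] at this

theorem ofCoeffs_surjective : Function.Surjective (ofCoeffs n p) := by
  intro P
  refine Dxt.induction (C := fun P => P ∈ LinearMap.range (ofCoeffs n p)) ?_ ?_ ?_ ?_ P
  · exact ⟨Finsupp.single 0 1, by rw [ofCoeffs_single, fn_one, dPow_zero, one_mul]⟩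
  · exact fun P Q hP hQ => add_mem hP hQ
  · exact fun a P hP => fn_mul_mem_range a hP
  · exact fun i P hP => dd_mul_mem_range i hP

/-- A non-zero coefficient at `m` requires `m + γ = δ`; comparing degrees forces `m = 0`, hence `γ =
δ`. -/
theorem dPow_smul_xpow (γ δ : DExp n p) (hne : γ ≠ δ) (hδ : δ.ord ≤ γ.ord) :
    (dPow γ : Dxt n p) • xpow δ.toFinsupp = 0 := by
  classical
  refine cof_ext fun m => ?_
  rw [actsAs_dPow, cof_xpow, if_neg, mul_zero, map_zero]
  intro h
  have h1 := congrArg Finsupp.degree h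
  rw [map_add, DExp.degree_toFinsupp, DExp.degree_toFinsupp] at h1
  have h2 : m.degree = 0 := by lia
  rw [Finsupp.degree_eq_zero_iff] at h2
  rw [h2, zero_add] at h
  exact hne (DExp.toFinsupp_injective h)

theorem dPow_smul_xpow_self (γ : DExp n p) :
    (dPow γ : Dxt n p) • xpow γ.toFinsupp = efac γ.toFinsupp • (1 : Oxt n p) := by
  classical
  refine cof_ext fun m => ?_
  rw [actsAs_dPow, cof_xpow, map_smul, cof_apply]
  have h1 : MvPowerSeries.coeff m (ser (1 : Oxt n p)) = if m = 0 then 1 else 0 :=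
    MvPowerSeries.coeff_one m
  rw [h1, smul_eq_mul]
  by_cases hm : m = 0
  · subst hm
    simp [efac]
  · simp [hm]

/-- A relation `∑ a_γ ∂^γ = 0` is applied to the monomial whose exponent `δ` has least order in the
support. Every other term kills it, and `δ! · a_δ = 0` remains. -/
theorem ofCoeffs_injective : Function.Injective (ofCoeffs n p) := by
  rw [← LinearMap.ker_eq_bot, LinearMap.ker_eq_bot']
  intro c hc
  by_contra hne
  obtain ⟨δ, hδ, hmin⟩ := Finset.exists_min_image c.support DExp.ord
    (Finsupp.support_nonempty_iff.2 hne)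
  have h1 : ofCoeffs n p c • xpow δ.toFinsupp = 0 := by rw [hc, zero_smul]
  rw [ofCoeffs_apply, Finset.sum_smul, Finset.sum_eq_single δ] at h1
  · rw [mul_smul, dPow_smul_xpow_self, fn_smul, mul_smul_comm, mul_one,
      smul_eq_zero_iff_right (efac_ne_zero _)] at h1
    exact Finsupp.mem_support_iff.1 hδ h1
  · intro γ hγ hγδ
    rw [mul_smul, dPow_smul_xpow γ δ hγδ (hmin γ hγ), smul_zero]
  · exact fun h => absurd hδ h

variable (n p) in
/-- The coefficients `a_γ` of a differential operator `∑ a_γ ∂^γ`. -/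
def coeffs : Dxt n p ≃ₗ[ℂ] (DExp n p →₀ Oxt n p) :=
  (LinearEquiv.ofBijective (ofCoeffs n p) ⟨ofCoeffs_injective, ofCoeffs_surjective⟩).symm

theorem coeffs_ofCoeffs (c : DExp n p →₀ Oxt n p) : coeffs n p (ofCoeffs n p c) = c :=
  LinearEquiv.symm_apply_apply _ _

theorem ofCoeffs_coeffs (P : Dxt n p) : ofCoeffs n p (coeffs n p P) = P :=
  (LinearEquiv.ofBijective (ofCoeffs n p) _).apply_symm_apply P

theorem coeffs_fn_dPow (a : Oxt n p) (γ : DExp n p) :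
    coeffs n p (fn a * dPow γ) = Finsupp.single γ a := by
  rw [← ofCoeffs_single, coeffs_ofCoeffs]

theorem coeffs_fn_mul (a : Oxt n p) (P : Dxt n p) (γ : DExp n p) :
    coeffs n p (fn a * P) γ = a * coeffs n p P γ := by
  obtain ⟨c, rfl⟩ := ofCoeffs_surjective P
  induction c using Finsupp.induction_linear with
  | zero => simp
  | add c d hc hd => simp only [map_add, mul_add, Finsupp.add_apply, hc, hd]
  | single δ b =>
    classical
    rw [ofCoeffs_single, ← mul_assoc, ← fn_mul, coeffs_fn_dPow, coeffs_fn_dPow,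
      Finsupp.single_apply, Finsupp.single_apply]
    split <;> simp

theorem coeffs_tt_mul (j : Fin p) (P : Dxt n p) (γ : DExp n p) :
    coeffs n p (tt j * P) γ = tvar j * coeffs n p P γ := coeffs_fn_mul _ _ _

/-! ### The filtrations in terms of coefficients -/

/-- `|ν|` for the monomial `∂_x^β ∂_t^ν`. -/
def DExp.tord (γ : DExp n p) : ℕ := ∑ j, γ.2 j

theorem mem_FD_iff {d : ℤ} {P : Dxt n p} :
    P ∈ FD n p d ↔ ∀ γ, coeffs n p P γ ≠ 0 → (γ.ord : ℤ) ≤ d := by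
  constructor
  · intro h
    induction h using Submodule.span_induction with
    | mem P hP =>
      obtain ⟨a, β, ν, hd, rfl⟩ := hP
      intro γ hγ
      rw [mul_assoc, show dxPow β * dtPow ν = dPow (β, ν) from rfl, coeffs_fn_dPow] at hγ
      classical
      rw [Finsupp.single_apply] at hγ
      have : (β, ν) = γ := by
        by_contra hne
        exact hγ (if_neg hne)
      subst this
      exact hd
    | zero => simp
    | add P Q _ _ hP hQ =>
      intro γ hγ
      by_cases h : coeffs n p P γ = 0
      · refine hQ γ fun h' => hγ ?_
        rw [map_add, Finsupp.add_apply, h, h', add_zero]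
      · exact hP γ h
    | smul c P _ hP =>
      intro γ hγ
      refine hP γ fun h => hγ ?_
      rw [map_smul, Finsupp.smul_apply, h, smul_zero]
  · intro h
    rw [← ofCoeffs_coeffs P, ofCoeffs_apply]
    refine sum_mem fun γ hγ => Submodule.subset_span
      ⟨_, γ.1, γ.2, h γ (Finsupp.mem_support_iff.1 hγ), (mul_assoc _ _ _).symm⟩

theorem mem_VD_iff {k : ℤ} {P : Dxt n p} :
    P ∈ VD n p k ↔
      ∀ γ e, cof e (coeffs n p P γ) ≠ 0 → (γ.tord : ℤ) - (tdeg e : ℤ) ≤ k := by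
  constructor
  · intro h
    induction h using Submodule.span_induction with
    | mem P hP =>
      obtain ⟨a, β, ν, hd, rfl⟩ := hP
      intro γ e hγ
      rw [mul_assoc, show dxPow β * dtPow ν = dPow (β, ν) from rfl, coeffs_fn_dPow] at hγ
      classical
      rw [Finsupp.single_apply] at hγ
      have : (β, ν) = γ := by
        by_contra hne
        rw [if_neg hne] at hγ
        exact hγ (map_zero _)
      subst this
      rw [if_pos rfl] at hγ
      exact hd e hγ
    | zero => simp
    | add P Q _ _ hP hQ =>
      intro γ e hγ
      by_cases h : cof e (coeffs n p P γ) = 0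
      · refine hQ γ e fun h' => hγ ?_
        rw [map_add, Finsupp.add_apply, map_add, h, h', add_zero]
      · exact hP γ e h
    | smul c P _ hP =>
      intro γ e hγ
      refine hP γ e fun h => hγ ?_
      rw [map_smul, Finsupp.smul_apply, map_smul, h, smul_zero]
  · intro h
    rw [← ofCoeffs_coeffs P, ofCoeffs_apply]
    refine sum_mem fun γ hγ => Submodule.subset_span
      ⟨_, γ.1, γ.2, fun e he => h γ e he, (mul_assoc _ _ _).symm⟩

theorem noT_mul {a b : Oxt n p} (ha : NoT a) (hb : NoT b) : NoT (a * b) := by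
  classical
  rw [noT_iff] at *
  intro e he
  rw [cof_mul]
  refine Finset.sum_eq_zero fun x hx => ?_
  have h : tdeg e = tdeg x.1 + tdeg x.2 := by
    rw [← Finset.HasAntidiagonal.mem_antidiagonal.1 hx]
    simp [tdeg, Finset.sum_add_distrib]
  by_cases h1 : tdeg x.1 = 0
  · rw [hb x.2 (by lia), mul_zero]
  · rw [ha x.1 h1, zero_mul]

theorem noT_pd {a : Oxt n p} (ha : NoT a) (i : Fin n) : NoT (pd (Sum.inl i) a) := by
  rw [noT_iff] at *
  intro e he
  rw [cof_pd, ha _ (by rwa [tdeg_add_single_inl]), zero_mul]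

variable (n p) in
/-- The operators `∑ a_β(x) ∂_x^β`, as a subspace of `D_{x,t}`. -/
def noTOps : Submodule ℂ (Dxt n p) where
  carrier := {P | ∀ γ, (γ.2 ≠ 0 → coeffs n p P γ = 0) ∧ NoT (coeffs n p P γ)}
  zero_mem' γ := ⟨fun _ => by simp, noT_iff.2 fun e _ => by simp⟩
  add_mem' {P Q} hP hQ γ := by
    rw [map_add, Finsupp.add_apply]
    refine ⟨fun h => by rw [(hP γ).1 h, (hQ γ).1 h, add_zero], noT_iff.2 fun e he => ?_⟩
    rw [map_add, noT_iff.1 (hP γ).2 e he, noT_iff.1 (hQ γ).2 e he, add_zero]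
  smul_mem' c P hP γ := by
    rw [map_smul, Finsupp.smul_apply]
    refine ⟨fun h => by rw [(hP γ).1 h, smul_zero], noT_iff.2 fun e he => ?_⟩
    rw [map_smul, noT_iff.1 (hP γ).2 e he, smul_zero]

theorem fn_dPow_mem_noTOps {a : Oxt n p} (ha : NoT a) {γ : DExp n p} (hγ : γ.2 = 0) :
    fn a * dPow γ ∈ noTOps n p := by
  classical
  intro δ
  rw [coeffs_fn_dPow, Finsupp.single_apply]
  split_ifs with h
  · exact ⟨fun h' => absurd (h ▸ hγ) h', ha⟩
  · exact ⟨fun _ => rfl, noT_iff.2 fun e _ => map_zero _⟩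

/-- `D = ℂ{x}[∂_x]` consists of the operators `∑ a_β(x) ∂_x^β`. -/
theorem mem_Dx_iff {P : Dxt n p} : P ∈ Dx n p ↔ P ∈ noTOps n p := by
  constructor
  · intro hP
    -- It is enough that the generators of `D` preserve `noTOps` under left multiplication, because
    -- `P = P * 1`.
    suffices h : ∀ Q ∈ noTOps n p, P * Q ∈ noTOps n p by
      have h1 : (1 : Dxt n p) ∈ noTOps n p := by
        have := fn_dPow_mem_noTOps (n := n) (p := p) noT_one (γ := 0) rfl
        rwa [fn_one, dPow_zero, one_mul] at this
      simpa using h 1 h1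
    refine Algebra.adjoin_induction (p := fun P _ => ∀ Q ∈ noTOps n p, P * Q ∈ noTOps n p)
      ?_ ?_ ?_ ?_ hP
    · rintro _ (⟨a, ha, rfl⟩ | ⟨i, rfl⟩) Q hQ
      · intro γ
        rw [coeffs_fn_mul]
        exact ⟨fun h => by rw [(hQ γ).1 h, mul_zero], noT_mul ha (hQ γ).2⟩
      · rw [← ofCoeffs_coeffs Q, ofCoeffs_apply, Finset.mul_sum]
        refine sum_mem fun γ hγ => ?_
        have hγ2 : γ.2 = 0 := by
          by_contra h
          exact Finsupp.mem_support_iff.1 hγ ((hQ γ).1 h)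
        rw [← mul_assoc, dd_fn, add_mul, mul_assoc, ← dPow_single, ← dPow_add]
        exact add_mem (fn_dPow_mem_noTOps (hQ γ).2 (by simp [DExp.single, hγ2]))
          (fn_dPow_mem_noTOps (noT_pd (hQ γ).2 i) hγ2)
    · intro c Q hQ
      rw [← Algebra.smul_def]
      exact Submodule.smul_mem _ _ hQ
    · intro P P' _ _ h h' Q hQ
      rw [add_mul]
      exact add_mem (h Q hQ) (h' Q hQ)
    · intro P P' _ _ h h' Q hQ
      rw [mul_assoc]
      exact h _ (h' Q hQ)
  · intro hP
    rw [← ofCoeffs_coeffs P, ofCoeffs_apply]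
    refine sum_mem fun γ hγ => mul_mem (Algebra.subset_adjoin (Or.inl ⟨_, (hP γ).2, rfl⟩)) ?_
    have hγ2 : γ.2 = 0 := by
      by_contra h
      exact Finsupp.mem_support_iff.1 hγ ((hP γ).1 h)
    rw [dPow, hγ2, dtPow_zero, mul_one]
    have h : ∀ x ∈ List.ofFn fun i => (dd (Sum.inl i) : Dxt n p) ^ γ.1 i, x ∈ Dx n p := by
      intro x hx
      obtain ⟨i, rfl⟩ := List.mem_ofFn.1 hx
      exact (Dx n p).pow_mem (Algebra.subset_adjoin (Or.inr ⟨i, rfl⟩)) _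
    exact (Dx n p).list_prod_mem h

theorem mem_FDx_iff {d : ℤ} {P : Dx n p} :
    P ∈ FDx n p d ↔ ∀ γ, coeffs n p P γ ≠ 0 → (γ.ord : ℤ) ≤ d := by
  constructor
  · exact fun h => mem_FD_iff.1 (FDx_le h).1
  · intro h
    have hP := mem_Dx_iff.1 P.2
    change (P : Dxt n p) ∈ Submodule.span ℂ _
    rw [← ofCoeffs_coeffs (P : Dxt n p), ofCoeffs_apply]
    refine sum_mem fun γ hγ => Submodule.subset_span ⟨_, γ.1, (hP γ).2, ?_, ?_⟩
    all_goals
      have hγ2 : γ.2 = 0 := by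
        by_contra h
        exact Finsupp.mem_support_iff.1 hγ ((hP γ).1 h)
    · simpa [DExp.ord, hγ2] using h γ (Finsupp.mem_support_iff.1 hγ)
    · rw [dPow, hγ2, dtPow_zero, mul_one]

/-- Membership in `F_{d,k}(D_{x,t})`, coefficient by coefficient. -/
theorem mem_FVD_iff {d k : ℤ} {P : Dxt n p} :
    P ∈ FVD n p d k ↔ ∀ γ e, cof e (coeffs n p P γ) ≠ 0 →
      (γ.ord : ℤ) ≤ d ∧ (γ.tord : ℤ) - (tdeg e : ℤ) ≤ k := by
  rw [FVD, Submodule.mem_inf, mem_FD_iff, mem_VD_iff]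
  constructor
  · exact fun h γ e he => ⟨h.1 γ fun h0 => he (by rw [h0, map_zero]), h.2 γ e he⟩
  · refine fun h => ⟨fun γ hγ => ?_, fun γ e he => (h γ e he).2⟩
    by_contra hd
    exact hγ (cof_ext fun e => by
      rw [map_zero]
      by_contra he
      exact hd (h γ e he).1)

end

section

variable {n p : ℕ}

/-! ### The Koszul homotopy -/

theorem pd_tvar (i : Fin n ⊕ Fin p) (j : Fin p) :
    pd i (tvar j : Oxt n p) = if i = Sum.inr j then 1 else 0 := by
  refine Subtype.ext ?_
  change MvPowerSeries.pderiv ℂ i (MvPowerSeries.X (Sum.inr j)) = _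
  split_ifs with h
  · subst h
    exact MvPowerSeries.pderiv_X_self
  · exact MvPowerSeries.pderiv_X_of_ne (Ne.symm h)

theorem fn_zero : (fn (0 : Oxt n p)) = 0 := map_zero (fnL n p)

theorem dd_tt_self (j : Fin p) : (dd (Sum.inr j) : Dxt n p) * tt j = tt j * dd (Sum.inr j) + 1 := by
  rw [tt, dd_fn, pd_tvar, if_pos rfl, fn_one]

theorem dd_tt_of_ne {i j : Fin p} (h : i ≠ j) :
    (dd (Sum.inr i) : Dxt n p) * tt j = tt j * dd (Sum.inr i) := by
  rw [tt, dd_fn, pd_tvar, if_neg (by simpa using h), fn_zero, add_zero]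

theorem dd_comm (i j : Fin n ⊕ Fin p) : (dd i : Dxt n p) * dd j = dd j * dd i := by
  rw [← dPow_single, ← dPow_single, ← dPow_add, ← dPow_add, add_comm]

theorem theta_tt (j : Fin p) : theta n p * tt j = tt j * (theta n p + 1) := by
  have h : ∀ i : Fin p, (tt i * dd (Sum.inr i) : Dxt n p) * tt j =
      tt j * (tt i * dd (Sum.inr i)) + if i = j then tt j else 0 := fun i => by
    split_ifs with h
    · subst h
      rw [mul_assoc, dd_tt_self, mul_add, mul_one]
    · rw [mul_assoc, dd_tt_of_ne h, ← mul_assoc, ← mul_assoc,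
        show (tt i : Dxt n p) * tt j = tt j * tt i from fn_comm _ _, add_zero]
  rw [theta, Finset.sum_mul, Finset.sum_congr rfl fun i _ => h i, Finset.sum_add_distrib,
    ← Finset.mul_sum, Finset.sum_ite_eq' Finset.univ j, if_pos (Finset.mem_univ j), mul_add, mul_one]

theorem theta_dd_inr (j : Fin p) :
    theta n p * dd (Sum.inr j) = dd (Sum.inr j) * (theta n p - 1) := by
  have h : ∀ i : Fin p, dd (Sum.inr j) * (tt i * dd (Sum.inr i) : Dxt n p) =
      (tt i * dd (Sum.inr i)) * dd (Sum.inr j) + if i = j then dd (Sum.inr j) else 0 := fun i => by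
    split_ifs with h
    · subst h
      rw [← mul_assoc, dd_tt_self, add_mul, one_mul]
    · rw [← mul_assoc, dd_tt_of_ne (Ne.symm h), mul_assoc, mul_assoc, dd_comm, add_zero]
  rw [mul_sub, mul_one, theta, Finset.mul_sum, Finset.sum_congr rfl fun i _ => h i,
    Finset.sum_add_distrib, ← Finset.sum_mul, Finset.sum_ite_eq' Finset.univ j,
    if_pos (Finset.mem_univ j), add_sub_cancel_right]

section Homotopy

variable {N : Type u} [AddCommGroup N] [Module (Dxt n p) N]

theorem dxt_zsmul_comm (P : Dxt n p) (a : ℤ) (m : N) : P • a • m = a • P • m :=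
  (map_zsmul (DistribSMul.toAddMonoidHom N P) a m)

variable (n) in
/-- The contraction with the derivations `∂_t`, a homotopy for the Koszul differential. -/
def hop (c : Finset (Fin p) → N) : Finset (Fin p) → N := fun s =>
  ∑ i ∈ s, ksign i (s.erase i) • ((dd (Sum.inr i) : Dxt n p) • c (s.erase i))

theorem ksign_mul_self (i : Fin p) (s : Finset (Fin p)) : ksign i s * ksign i s = 1 := by
  rw [ksign, ← mul_pow]
  simp

/-- Makes the mixed terms `t_i ∂_l` with `i ≠ l` cancel in Cartan's formula. It is `ksign_swap`
multiplied by signs whose squares are `1`. -/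
theorem ksign_cross {i l : Fin p} {u : Finset (Fin p)} (hi : i ∉ u) (hl : l ∉ u) (hil : i ≠ l) :
    ksign i (insert l u) * ksign l (insert i u) + ksign l u * ksign i u = 0 := by
  have h := ksign_swap hi hl hil
  have h1 := ksign_mul_self i u
  have h2 := ksign_mul_self i (insert l u)
  have h3 := ksign_mul_self l u
  generalize ksign i u = a at *
  generalize ksign l u = b at *
  generalize ksign i (insert l u) = x at *
  generalize ksign l (insert i u) = y at *
  linear_combination (a * x) * h - x * y * h1 - a * b * h2

/-- Cartan's formula. The diagonal terms are `t_i ∂_i` for `i ∉ s` and `∂_l t_l = t_l ∂_l + 1` for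
`l ∈ s`, which add up to `θ + |s|`. The mixed terms of the two composites have opposite signs. -/
theorem koszul_homotopy (c : Finset (Fin p) → N) (s : Finset (Fin p)) :
    koszulD n N (hop n c) s + hop n (koszulD n N c) s = (theta n p + (s.card : Dxt n p)) • c s := by
  have hA : koszulD n N (hop n c) s = (∑ i ∈ sᶜ, (tt i * dd (Sum.inr i) : Dxt n p) • c s) +
      ∑ i ∈ sᶜ, ∑ l ∈ s, (ksign i s * ksign l ((insert i s).erase l)) •
        ((tt i * dd (Sum.inr l) : Dxt n p) • c ((insert i s).erase l)) := by
    rw [koszulD_apply, ← Finset.sum_add_distrib]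
    refine Finset.sum_congr rfl fun i hi => ?_
    have hi' : i ∉ s := Finset.mem_compl.1 hi
    rw [hop, Finset.sum_insert hi', Finset.erase_insert hi', smul_add, smul_add,
      dxt_zsmul_comm, smul_smul, ksign_mul_self, one_smul, ← mul_smul, Finset.smul_sum,
      Finset.smul_sum]
    congr 1
    refine Finset.sum_congr rfl fun l _ => ?_
    rw [dxt_zsmul_comm, smul_smul, ← mul_smul (tt i)]
  have hB : hop n (koszulD n N c) s = (∑ l ∈ s, (dd (Sum.inr l) * tt l : Dxt n p) • c s) +
      ∑ l ∈ s, ∑ i ∈ sᶜ, (ksign l (s.erase l) * ksign i (s.erase l)) •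
        ((dd (Sum.inr l) * tt i : Dxt n p) • c (insert i (s.erase l))) := by
    rw [hop, ← Finset.sum_add_distrib]
    refine Finset.sum_congr rfl fun l hl => ?_
    have hl' : l ∉ s.erase l := Finset.notMem_erase l s
    have hl'' : l ∉ sᶜ := by simpa using hl
    rw [koszulD_apply, Finset.compl_erase, Finset.sum_insert hl'', Finset.insert_erase hl,
      smul_add, smul_add, dxt_zsmul_comm, smul_smul, ksign_mul_self, one_smul, ← mul_smul,
      Finset.smul_sum, Finset.smul_sum]
    congr 1
    refine Finset.sum_congr rfl fun i _ => ?_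
    rw [dxt_zsmul_comm, smul_smul, ← mul_smul (dd _)]
  have hC : (∑ i ∈ sᶜ, ∑ l ∈ s, (ksign i s * ksign l ((insert i s).erase l)) •
        ((tt i * dd (Sum.inr l) : Dxt n p) • c ((insert i s).erase l))) +
      ∑ l ∈ s, ∑ i ∈ sᶜ, (ksign l (s.erase l) * ksign i (s.erase l)) •
        ((dd (Sum.inr l) * tt i : Dxt n p) • c (insert i (s.erase l))) = 0 := by
    rw [Finset.sum_comm, ← Finset.sum_add_distrib]
    refine Finset.sum_eq_zero fun l hl => ?_
    rw [← Finset.sum_add_distrib]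
    refine Finset.sum_eq_zero fun i hi => ?_
    have hi' : i ∉ s := Finset.mem_compl.1 hi
    have hil : i ≠ l := fun h => hi' (h ▸ hl)
    have h1 : (insert i s).erase l = insert i (s.erase l) := Finset.erase_insert_of_ne hil
    rw [h1, dd_tt_of_ne hil.symm, ← add_smul]
    have h2 := ksign_cross (u := s.erase l) (i := i) (l := l) (by simp [hi']) (by simp) hil
    rw [Finset.insert_erase hl] at h2
    rw [h2, zero_smul]
  have hD : (∑ i ∈ sᶜ, (tt i * dd (Sum.inr i) : Dxt n p) • c s) +
      (∑ l ∈ s, (dd (Sum.inr l) * tt l : Dxt n p) • c s) =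
      (theta n p + (s.card : Dxt n p)) • c s := by
    rw [← Finset.sum_smul, ← Finset.sum_smul, ← add_smul]
    congr 1
    rw [Finset.sum_congr rfl fun l _ => dd_tt_self l, Finset.sum_add_distrib, ← add_assoc,
      Finset.sum_compl_add_sum, Finset.sum_const, nsmul_one, theta]
  rw [hA, hB, ← hD, add_add_add_comm, hC, add_zero]

end Homotopy

/-! ### The Koszul complex of `ℂ{x,t}` -/

theorem cof_tt_dd (j : Fin p) (e : (Fin n ⊕ Fin p) →₀ ℕ) (a : Oxt n p) :
    cof e ((tt j * dd (Sum.inr j) : Dxt n p) • a) = e (Sum.inr j) * cof e a := by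
  rw [mul_smul, tt, fn_smul, dd_smul, cof_tvar_mul]
  split_ifs with h
  · have h1 : e - Finsupp.single (Sum.inr j) 1 + Finsupp.single (Sum.inr j) 1 = e :=
      tsub_add_cancel_of_le (Finsupp.single_le_iff.2 h)
    rw [cof_pd, h1, mul_comm]
    congr 1
    conv_rhs => rw [← h1]
    simp
  · rw [show e (Sum.inr j) = 0 by lia]
    simp

theorem cof_theta (e : (Fin n ⊕ Fin p) →₀ ℕ) (a : Oxt n p) :
    cof e (theta n p • a) = tdeg e * cof e a := by
  rw [theta, Finset.sum_smul, map_sum, Finset.sum_congr rfl fun j _ => cof_tt_dd j e a,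
    ← Finset.sum_mul, tdeg]
  push_cast
  rfl

theorem norm_inv_natCast_le_one (m : ℕ) : ‖((m : ℂ))⁻¹‖ ≤ 1 := by
  rw [norm_inv, Complex.norm_natCast]
  exact Nat.cast_inv_le_one m

variable (n p) in
/-- The inverse of `θ + j` on `ℂ{x,t}`, up to the part that is free of `t` for `j = 0`. -/
def eulerInv (j : ℕ) : Module.End ℂ (Oxt n p) :=
  -- At `tdeg e + j = 0` the convention `0⁻¹ = 0` discards the `t`-free part, the only place where
  -- `θ + j` is not invertible.
  scale (fun e => ((tdeg e + j : ℕ) : ℂ)⁻¹) fun _ => norm_inv_natCast_le_one _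

theorem cof_eulerInv (j : ℕ) (e : (Fin n ⊕ Fin p) →₀ ℕ) (a : Oxt n p) :
    cof e (eulerInv n p j a) = ((tdeg e + j : ℕ) : ℂ)⁻¹ * cof e a := rfl

/-- Multiplication by `t_i` raises the `t`-degree by one while the Koszul degree drops by one, so
the scaling factor is unchanged: dividing by `θ + j` commutes with the Koszul differential. -/
theorem tvar_mul_eulerInv (i : Fin p) (j : ℕ) (a : Oxt n p) :
    tvar i * eulerInv n p (j + 1) a = eulerInv n p j (tvar i * a) := by
  refine cof_ext fun e => ?_
  rw [cof_eulerInv, cof_tvar_mul, cof_tvar_mul]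
  split_ifs with h
  · rw [cof_eulerInv, tdeg_sub_single e i h, add_right_comm _ 1 j, add_assoc]
  · rw [mul_zero]

theorem koszulD_of_card_zero {N : Type u} [AddCommGroup N] [Module (Dxt n p) N]
    {c : Finset (Fin p) → N} (hc : ∀ s, s.card ≠ 0 → c s = 0) : koszulD n N c = 0 := by
  funext s
  rw [koszulD_apply]
  refine Finset.sum_eq_zero fun i _ => ?_
  rw [hc _ (by simp), smul_zero, smul_zero]

theorem koszulD_eulerInv (j : ℕ) (c : Finset (Fin p) → Oxt n p) (hc : koszulD n _ c = 0) :
    koszulD n (Oxt n p) (fun s => eulerInv n p (j + 1) (c s)) = 0 := by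
  funext s
  have h := congrFun hc s
  rw [koszulD_apply] at h ⊢
  have h1 : ∀ i : Fin p, (tt i : Dxt n p) • eulerInv n p (j + 1) (c (insert i s)) =
      eulerInv n p j ((tt i : Dxt n p) • c (insert i s)) := fun i => tvar_mul_eulerInv i j _
  simp only [h1, ← map_zsmul, ← map_sum]
  rw [h]
  exact map_zero _

/-- The Koszul complex of `t_1, …, t_p` on `ℂ{x,t}` is exact, with an explicit primitive. -/
theorem koszulD_hop_eulerInv (j : ℕ) (c : Finset (Fin p) → Oxt n p)
    (hc : koszulD n _ c = 0) (hsupp : ∀ s, s.card ≠ j → c s = 0)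
    (h0 : j = 0 → ∀ e, tdeg e = 0 → cof e (c ∅) = 0) :
    koszulD n (Oxt n p) (hop n fun s => eulerInv n p j (c s)) = c := by
  -- The rescaled chain is still a cycle, so only the boundary of its contraction survives in
  -- Cartan's formula, and `θ + j` undoes the rescaling.
  have h1 : koszulD n (Oxt n p) (fun s => eulerInv n p j (c s)) = 0 := by
    rcases j with _ | j
    · exact koszulD_of_card_zero fun s hs => by rw [hsupp s hs, map_zero]
    · exact koszulD_eulerInv j c hc
  funext s
  have h2 := koszul_homotopy (n := n) (fun s => eulerInv n p j (c s)) s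
  have h3 : hop n (0 : Finset (Fin p) → Oxt n p) s = 0 := by simp [hop]
  rw [h1, h3, add_zero] at h2
  rw [h2]
  by_cases hs : s.card = j
  · refine cof_ext fun e => ?_
    rw [add_smul, map_add, cof_theta, Nat.cast_smul_eq_nsmul, map_nsmul, cof_eulerInv, nsmul_eq_mul,
      ← add_mul, hs, ← mul_assoc]
    -- The rescaling cannot be undone where the factor is zero; there the coefficient of `c`
    -- vanishes by `h0`.
    by_cases hz : tdeg e + j = 0
    · have hj : j = 0 := by lia
      rw [hj, Finset.card_eq_zero] at hs
      rw [hs, h0 hj e (by lia), mul_zero]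
    · rw [← Nat.cast_add, mul_inv_cancel₀ (Nat.cast_ne_zero.2 hz), one_mul]
  · rw [hsupp s hs, map_zero, smul_zero]

/-! ### The Koszul complex of `D_{x,t}` -/

/-- A linear operator on `ℂ{x,t}`, applied to the coefficients of the differential operators. -/
def onCoeffs (G : Module.End ℂ (Oxt n p)) : Module.End ℂ (Dxt n p) :=
  (ofCoeffs n p).comp ((Finsupp.mapRange.linearMap G).comp (coeffs n p).toLinearMap)

theorem coeffs_onCoeffs (G : Module.End ℂ (Oxt n p)) (P : Dxt n p) (γ : DExp n p) :
    coeffs n p (onCoeffs G P) γ = G (coeffs n p P γ) := by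
  rw [onCoeffs, LinearMap.comp_apply, coeffs_ofCoeffs]
  rfl

theorem coeffs_koszulD (P : Finset (Fin p) → Dxt n p) (s : Finset (Fin p)) (γ : DExp n p) :
    coeffs n p (koszulD n _ P s) γ = koszulD n _ (fun s => coeffs n p (P s) γ) s := by
  rw [koszulD_apply, koszulD_apply, map_sum, Finsupp.finsetSum_apply]
  refine Finset.sum_congr rfl fun i _ => ?_
  rw [map_zsmul, Finsupp.smul_apply, smul_eq_mul, coeffs_tt_mul]
  rfl

/-- Left multiplication by `t_i` only touches coefficients, so the primitive on `ℂ{x,t}` may be used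
for each `γ` separately. Here `∂_t` differentiates the coefficients instead of being multiplied into
the operator. Thus the order does not grow, and each `t`-degree drops by one, which costs one step
of `V`. -/
theorem exists_koszulD_eq (j : ℕ) (P : Finset (Fin p) → Dxt n p) (hP : koszulD n _ P = 0)
    (hsupp : ∀ s, s.card ≠ j → P s = 0)
    (h0 : j = 0 → ∀ γ e, tdeg e = 0 → cof e (coeffs n p (P ∅) γ) = 0) :
    ∃ Q : Finset (Fin p) → Dxt n p, koszulD n _ Q = P ∧ (∀ s, s.card ≠ j + 1 → Q s = 0) ∧
      ∀ d k, (∀ s, P s ∈ FVD n p d k) → ∀ s, Q s ∈ FVD n p d (k + 1) := by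
  let G : Fin p → Module.End ℂ (Oxt n p) := fun i => (pd (Sum.inr i)).comp (eulerInv n p j)
  refine ⟨fun s => ∑ i ∈ s, ksign i (s.erase i) • onCoeffs (G i) (P (s.erase i)), ?_, ?_, ?_⟩
  · have h1 : ∀ γ s, coeffs n p (∑ i ∈ s, ksign i (s.erase i) • onCoeffs (G i) (P (s.erase i))) γ =
        hop n (fun s => eulerInv n p j (coeffs n p (P s) γ)) s := fun γ s => by
      rw [map_sum, Finsupp.finsetSum_apply, hop]
      refine Finset.sum_congr rfl fun i _ => ?_
      rw [map_zsmul, Finsupp.smul_apply, coeffs_onCoeffs]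
      rfl
    funext s
    refine (coeffs n p).injective (Finsupp.ext fun γ => ?_)
    rw [coeffs_koszulD]
    simp only [h1]
    refine congrFun (koszulD_hop_eulerInv j (fun s => coeffs n p (P s) γ) ?_ ?_ ?_) s
    · funext s
      rw [← coeffs_koszulD, hP]
      simp
    · exact fun s hs => by rw [hsupp s hs]; simp
    · exact fun hj e he => h0 hj γ e he
  · refine fun s hs => Finset.sum_eq_zero fun i hi => ?_
    rw [hsupp, map_zero, smul_zero]
    rw [Finset.card_erase_of_mem hi]
    have := Finset.card_pos.2 ⟨i, hi⟩
    lia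
  · refine fun d k h s => sum_mem fun i _ => zsmul_mem ?_ _
    rw [mem_FVD_iff]
    intro γ e he
    rw [coeffs_onCoeffs] at he
    have h2 : cof (e + Finsupp.single (Sum.inr i) 1) (coeffs n p (P (s.erase i)) γ) ≠ 0 := by
      intro h3
      refine he ?_
      change cof e (pd _ (eulerInv n p j _)) = 0
      rw [cof_pd, cof_eulerInv, h3, mul_zero, zero_mul]
    have h4 := mem_FVD_iff.1 (h (s.erase i)) γ _ h2
    rw [tdeg_add_single_inr] at h4
    push_cast at h4
    exact ⟨h4.1, by lia⟩

/-! ### The Koszul complex of a bifiltered free module -/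

section Free

variable {M : Type u} [AddCommGroup M] [Module (Dxt n p) M]

variable (n p M) in
/-- The submodule `∑_j t_j M`. -/
def tIm : Submodule (Dx n p) M := ⨆ j : Fin p, LinearMap.range (tlin M j)

theorem tV_le_tIm (B : Bifiltration n p M) (k : ℤ) : tV B k ≤ tIm n p M :=
  iSup_mono fun _ => LinearMap.map_le_range

/-- The Koszul complexes `F_{d,k+•}(M) ⊗ Λ^•` are exact in positive degrees, and the image of the
last differential is the intersection of `F_{d,k}(M)` with `∑_j t_j M`. -/
def Bifiltration.KoszulExact (B : Bifiltration n p M) : Prop :=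
  ∀ (d k : ℤ) (j : ℕ) (c : Finset (Fin p) → M), (∀ s, c s ∈ B.F d k) →
    (∀ s, s.card ≠ j → c s = 0) → koszulD n M c = 0 → (j = 0 → c ∅ ∈ tIm n p M) →
    ∃ y : Finset (Fin p) → M, (∀ s, y s ∈ B.F d (k + 1)) ∧
      (∀ s, s.card ≠ j + 1 → y s = 0) ∧ koszulD n M y = c

theorem repr_mem_of_generatedBy {B : Bifiltration n p M} {r : ℕ}
    {e : Module.Basis (Fin r) (Dxt n p) M} {a b : Fin r → ℤ} (h : B.GeneratedBy e a b)
    {d k : ℤ} {x : M} : x ∈ B.F d k ↔ ∀ i, e.repr x i ∈ FVD n p (d - a i) (k - b i) := by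
  rw [h d k x]
  constructor
  · rintro ⟨P, hP, rfl⟩ i
    rw [e.repr_sum_self]
    exact hP i
  · exact fun hx => ⟨fun i => e.repr x i, hx, (e.sum_repr x).symm⟩

theorem cof_repr_of_mem_tIm {r : ℕ} (e : Module.Basis (Fin r) (Dxt n p) M) {x : M}
    (hx : x ∈ tIm n p M) (i : Fin r) (γ : DExp n p) (m : (Fin n ⊕ Fin p) →₀ ℕ) (hm : tdeg m = 0) :
    cof m (coeffs n p (e.repr x i) γ) = 0 := by
  refine Submodule.iSup_induction _ (motive := fun x => cof m (coeffs n p (e.repr x i) γ) = 0)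
    hx ?_ ?_ ?_
  · rintro j _ ⟨y, rfl⟩
    change cof m (coeffs n p (e.repr ((tt j : Dxt n p) • y) i) γ) = 0
    rw [map_smul, Finsupp.smul_apply, smul_eq_mul, coeffs_tt_mul, cof_tvar_mul, if_neg]
    rw [tdeg_eq_zero.1 hm j]
    simp
  · simp
  · intro x y hx hy
    rw [map_add, Finsupp.add_apply, map_add, Finsupp.add_apply, map_add, hx, hy, add_zero]

theorem repr_koszulD {r : ℕ} (e : Module.Basis (Fin r) (Dxt n p) M) (c : Finset (Fin p) → M)
    (s : Finset (Fin p)) (i : Fin r) :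
    e.repr (koszulD n M c s) i = koszulD n _ (fun s => e.repr (c s) i) s := by
  rw [koszulD_apply, koszulD_apply, map_sum, Finsupp.finsetSum_apply]
  refine Finset.sum_congr rfl fun j _ => ?_
  rw [map_zsmul, map_smul, Finsupp.smul_apply, Finsupp.smul_apply]

theorem exists_koszulD_eq_of_basis {r : ℕ} (e : Module.Basis (Fin r) (Dxt n p) M) (j : ℕ)
    (c : Finset (Fin p) → M) (hsupp : ∀ s, s.card ≠ j → c s = 0) (hc : koszulD n M c = 0)
    (h0 : j = 0 → ∀ i γ m, tdeg m = 0 → cof m (coeffs n p (e.repr (c ∅) i) γ) = 0) :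
    ∃ y : Finset (Fin p) → M, koszulD n M y = c ∧ (∀ s, s.card ≠ j + 1 → y s = 0) ∧
      ∀ i d k, (∀ s, e.repr (c s) i ∈ FVD n p d k) →
        ∀ s, e.repr (y s) i ∈ FVD n p d (k + 1) := by
  have h := fun i => exists_koszulD_eq j (fun s => e.repr (c s) i)
    (by funext s; rw [← repr_koszulD, hc]; simp) (fun s hs => by rw [hsupp s hs]; simp)
    (fun hj γ m hm => h0 hj i γ m hm)
  choose Q hQ1 hQ2 hQ3 using h
  have hy : ∀ s i, e.repr (∑ i, Q i s • e i) i = Q i s := fun s i => by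
    rw [e.repr_sum_self (fun i => Q i s)]
  refine ⟨fun s => ∑ i, Q i s • e i, ?_, ?_, ?_⟩
  · funext s
    refine e.repr.injective (Finsupp.ext fun i => ?_)
    rw [repr_koszulD]
    simp only [hy]
    exact congrFun (hQ1 i) s
  · exact fun s hs => Finset.sum_eq_zero fun i _ => by rw [hQ2 i s hs, zero_smul]
  · intro i d k h s
    rw [hy]
    exact hQ3 i d k h s

theorem Bifiltration.IsFree.koszulExact {B : Bifiltration n p M} (hB : B.IsFree) :
    B.KoszulExact := by
  obtain ⟨r, e, a, b, h⟩ := hB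
  intro d k j c hF hsupp hc h0
  obtain ⟨y, hy1, hy2, hy3⟩ := exists_koszulD_eq_of_basis e j c hsupp hc
    (fun hj i γ m hm => cof_repr_of_mem_tIm e (h0 hj) i γ m hm)
  refine ⟨y, fun s => (repr_mem_of_generatedBy h).2 fun i => ?_, hy2, hy1⟩
  rw [add_sub_right_comm]
  exact hy3 i _ _ (fun s => (repr_mem_of_generatedBy h).1 (hF s) i) s

end Free

end

section

variable {n p : ℕ}

/-! ### The quotients `V_k(L) / ∑ t_j V_{k+1}(L)` of a bifiltered free module -/

theorem coeffs_mul_dPow (P : Dxt n p) (δ : DExp n p) :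
    coeffs n p (P * dPow δ) = (coeffs n p P).mapDomain (· + δ) := by
  obtain ⟨c, rfl⟩ := ofCoeffs_surjective P
  rw [coeffs_ofCoeffs]
  induction c using Finsupp.induction_linear with
  | zero => simp
  | add c d hc hd => rw [map_add, add_mul, map_add, hc, hd, Finsupp.mapDomain_add]
  | single γ a =>
    rw [ofCoeffs_single, mul_assoc, ← dPow_add, coeffs_fn_dPow, Finsupp.mapDomain_single]

theorem dPow_zero_left (ν : Fin p → ℕ) : (dPow (0, ν) : Dxt n p) = dtPow ν := by
  rw [dPow, dxPow_zero, one_mul]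

theorem coeffs_mul_dtPow {P : Dxt n p} (hP : P ∈ Dx n p) (ν : Fin p → ℕ) (γ : DExp n p) :
    coeffs n p (P * dtPow ν) γ = if γ.2 = ν then coeffs n p P (γ.1, 0) else 0 := by
  have hinj : Function.Injective fun x : DExp n p => x + (0, ν) :=
    add_left_injective ((0, ν) : DExp n p)
  rw [← dPow_zero_left, coeffs_mul_dPow]
  split_ifs with h
  · obtain ⟨β, μ⟩ := γ
    obtain rfl : μ = ν := h
    have h1 : ((β, μ) : DExp n p) = (β, 0) + (0, μ) := by simp
    exact (congrArg _ h1).trans (Finsupp.mapDomain_apply hinj (coeffs n p P) (β, 0))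
  · by_cases hr : γ ∈ Set.range fun x : DExp n p => x + (0, ν)
    · obtain ⟨δ, rfl⟩ := hr
      rw [Finsupp.mapDomain_apply hinj]
      refine (mem_Dx_iff.1 hP δ).1 fun h0 => h ?_
      simp [h0]
    · exact Finsupp.mapDomain_of_notMem_range _ _ hr

variable (n p) in
/-- The part of a power series that is free of `t`. -/
def noTPart : Module.End ℂ (Oxt n p) :=
  scale (fun e => if tdeg e = 0 then 1 else 0) fun e => by split_ifs <;> simp

theorem cof_noTPart (e : (Fin n ⊕ Fin p) →₀ ℕ) (a : Oxt n p) :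
    cof e (noTPart n p a) = (if tdeg e = 0 then 1 else 0) * cof e a := rfl

/-- The coefficient of `∂_t^ν`, restricted to `t = 0`, is an operator in `D`. These slices become
the coordinates on `V_k(L) / ∑ t_j V_{k+1}(L)`. -/
theorem exists_slice (P : Dxt n p) (ν : Fin p → ℕ) :
    ∃ Q : Dx n p, ∀ β, coeffs n p Q (β, 0) = noTPart n p (coeffs n p P (β, ν)) := by
  have h1 : Function.Injective fun β : Fin n → ℕ => (β, ν) := fun _ _ h => (Prod.ext_iff.1 h).1
  have h2 : Function.Injective fun β : Fin n → ℕ => (β, (0 : Fin p → ℕ)) :=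
    fun _ _ h => (Prod.ext_iff.1 h).1
  set c : DExp n p →₀ Oxt n p := Finsupp.mapDomain (fun β : Fin n → ℕ => (β, (0 : Fin p → ℕ)))
    (Finsupp.mapRange (noTPart n p) (map_zero _)
      ((coeffs n p P).comapDomain (fun β : Fin n → ℕ => (β, ν)) h1.injOn)) with hc
  have hc1 : ∀ β, c (β, 0) = noTPart n p (coeffs n p P (β, ν)) := fun β =>
    Finsupp.mapDomain_apply h2 _ β
  refine ⟨⟨ofCoeffs n p c, mem_Dx_iff.2 fun γ => ?_⟩, fun β => ?_⟩
  · rw [coeffs_ofCoeffs]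
    by_cases hγ : γ ∈ Set.range fun β : Fin n → ℕ => (β, (0 : Fin p → ℕ))
    · obtain ⟨β, rfl⟩ := hγ
      refine ⟨fun h => absurd rfl h, noT_iff.2 fun e he => ?_⟩
      rw [hc1, cof_noTPart, if_neg he, zero_mul]
    · have : c γ = 0 := Finsupp.mapDomain_of_notMem_range _ _ hγ
      rw [this]
      exact ⟨fun _ => rfl, noT_iff.2 fun e _ => map_zero _⟩
  · rw [coeffs_ofCoeffs, hc1]

theorem dtPow_mem_FVD (ν : Fin p → ℕ) :
    (dtPow ν : Dxt n p) ∈ FVD n p ((∑ j, ν j : ℕ) : ℤ) ((∑ j, ν j : ℕ) : ℤ) := by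
  rw [mem_FVD_iff]
  intro γ e he
  classical
  rw [← dPow_zero_left, ← one_mul (dPow _), ← fn_one, coeffs_fn_dPow, Finsupp.single_apply] at he
  split_ifs at he with h
  · subst h
    simp only [DExp.ord, DExp.tord, Pi.zero_apply, Finset.sum_const_zero, zero_add, le_refl, true_and]
    lia
  · exact absurd (map_zero _) he

section

variable {M : Type u} [AddCommGroup M] [Module (Dxt n p) M]

theorem Bifiltration.mono_k (B : Bifiltration n p M) (d : ℤ) {k l : ℤ} (h : k ≤ l) :
    B.F d k ≤ B.F d l := by
  obtain ⟨m, rfl⟩ := Int.le.dest h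
  induction m with
  | zero => simp
  | succ m ih =>
    refine (ih (by lia)).trans ?_
    have := B.mono_right d (k + m)
    rwa [add_assoc] at this

theorem koszulD_empty (y : Finset (Fin p) → M) :
    koszulD n M y ∅ = ∑ i, (tt i : Dxt n p) • y {i} := by
  rw [koszulD_apply, Finset.compl_empty]
  refine Finset.sum_congr rfl fun i _ => ?_
  simp [ksign]

theorem koszulD_empty_mem_tV {B : Bifiltration n p M} {k : ℤ} {y : Finset (Fin p) → M}
    (hy : ∀ i, y {i} ∈ B.V (k + 1)) : koszulD n M y ∅ ∈ tV B k := by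
  rw [koszulD_empty]
  exact sum_mem fun i _ => Submodule.mem_iSup_of_mem i ⟨y {i}, hy i, rfl⟩

/-- Exactness at degree `0` with filtrations: an element of `V_k` that is divisible by the `t_j` in
any way is divisible with quotients in `V_{k+1}`. Relations in the quotient can therefore be tested
modulo `∑ t_j M`. -/
theorem Bifiltration.KoszulExact.mem_tV {B : Bifiltration n p M} (hB : B.KoszulExact) {d k : ℤ}
    {x : M} (hx : x ∈ B.F d k) (hx' : x ∈ tIm n p M) : x ∈ tV B k := by
  have hsupp : ∀ s : Finset (Fin p), s.card ≠ 0 → (Pi.single ∅ x : Finset (Fin p) → M) s = 0 :=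
    fun s hs => Pi.single_eq_of_ne (fun h => hs (by rw [h, Finset.card_empty])) _
  obtain ⟨y, hy1, -, hy3⟩ := hB d k 0 (Pi.single ∅ x)
    (fun s => by
      by_cases hs : s = ∅
      · subst hs; rwa [Pi.single_eq_same]
      · rw [Pi.single_eq_of_ne hs]; exact zero_mem _)
    hsupp (koszulD_of_card_zero hsupp) (fun _ => by rwa [Pi.single_eq_same])
  have := congrFun hy3 ∅
  rw [Pi.single_eq_same] at this
  rw [← this]
  exact koszulD_empty_mem_tV fun _ => ⟨d, hy1 _⟩

/-- Converse to `cof_repr_of_mem_tIm`: series without `t`-free monomials lie in the ideal of the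
`t_j`, and the Koszul primitive in degree `0` supplies the cofactors. -/
theorem mem_tIm_of_cof {r : ℕ} (e : Module.Basis (Fin r) (Dxt n p) M) {x : M}
    (hx : ∀ i γ m, tdeg m = 0 → cof m (coeffs n p (e.repr x i) γ) = 0) : x ∈ tIm n p M := by
  have hsupp : ∀ s : Finset (Fin p), s.card ≠ 0 → (Pi.single ∅ x : Finset (Fin p) → M) s = 0 :=
    fun s hs => Pi.single_eq_of_ne (fun h => hs (by rw [h, Finset.card_empty])) _
  obtain ⟨y, hy, -⟩ := exists_koszulD_eq_of_basis e 0 (Pi.single ∅ x) hsupp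
    (koszulD_of_card_zero hsupp) (fun _ => by rwa [Pi.single_eq_same])
  have := congrFun hy ∅
  rw [Pi.single_eq_same, koszulD_empty] at this
  rw [← this]
  exact sum_mem fun i _ => Submodule.mem_iSup_of_mem i ⟨y {i}, rfl⟩

/-- The index set of the basis of `V_k(L) / ∑ t_j V_{k+1}(L)`. -/
abbrev QuotIdx (p : ℕ) {r : ℕ} (b : Fin r → ℤ) (k : ℤ) : Type :=
  Σ i : Fin r, {ν : Fin p → ℕ // ((∑ j, ν j : ℕ) : ℤ) ≤ k - b i}

instance {r : ℕ} (b : Fin r → ℤ) (k : ℤ) (i : Fin r) :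
    Finite {ν : Fin p → ℕ // ((∑ j, ν j : ℕ) : ℤ) ≤ k - b i} := by
  refine Set.Finite.to_subtype (s := {ν : Fin p → ℕ | ((∑ j, ν j : ℕ) : ℤ) ≤ k - b i}) ?_
  refine (Set.finite_Iic (fun _ : Fin p => (k - b i).toNat)).subset fun ν hν j => ?_
  have h1 : ν j ≤ ∑ j, ν j := Finset.single_le_sum (fun _ _ => Nat.zero_le _) (Finset.mem_univ j)
  have h2 : ((∑ j, ν j : ℕ) : ℤ) ≤ k - b i := hν
  lia

instance {r : ℕ} (b : Fin r → ℤ) (k : ℤ) (i : Fin r) :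
    Fintype {ν : Fin p → ℕ // ((∑ j, ν j : ℕ) : ℤ) ≤ k - b i} := Fintype.ofFinite _

theorem coeffs_sum_slices {S : Type*} [Fintype S] (ν : S → Fin p → ℕ) (hν : Function.Injective ν)
    (P : S → Dx n p) (γ : DExp n p) :
    (∀ s, γ.2 = ν s → coeffs n p (∑ s, (P s : Dxt n p) * dtPow (ν s)) γ = coeffs n p (P s) (γ.1, 0)) ∧
    ((∀ s, γ.2 ≠ ν s) → coeffs n p (∑ s, (P s : Dxt n p) * dtPow (ν s)) γ = 0) := by
  constructor
  · intro s hs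
    rw [map_sum, Finsupp.finsetSum_apply, Finset.sum_eq_single s]
    · rw [coeffs_mul_dtPow (P s).2, if_pos hs]
    · intro s' _ hs'
      rw [coeffs_mul_dtPow (P s').2, if_neg]
      exact fun h => hs' (hν (h.symm.trans hs))
    · exact fun h => absurd (Finset.mem_univ s) h
  · intro h
    rw [map_sum, Finsupp.finsetSum_apply]
    exact Finset.sum_eq_zero fun s _ => by rw [coeffs_mul_dtPow (P s).2, if_neg (h s)]

theorem repr_sum_slices {r : ℕ} (e : Module.Basis (Fin r) (Dxt n p) M) (b : Fin r → ℤ) (k : ℤ)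
    (P : QuotIdx p b k → Dx n p) (i : Fin r) :
    e.repr (∑ j, P j • (dtPow j.2.1 : Dxt n p) • e j.1) i =
      ∑ ν, (P ⟨i, ν⟩ : Dxt n p) * dtPow ν.1 := by
  have h : (∑ j, P j • (dtPow j.2.1 : Dxt n p) • e j.1) =
      ∑ i, (∑ ν, (P ⟨i, ν⟩ : Dxt n p) * dtPow ν.1) • e i := by
    rw [Fintype.sum_sigma]
    refine Finset.sum_congr rfl fun i _ => ?_
    rw [Finset.sum_smul]
    exact Finset.sum_congr rfl fun ν _ => (mul_smul _ _ _).symm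
  rw [h, e.repr_sum_self]

/-- The basis consists of the classes of `∂_t^ν e_i` with `|ν| ≤ k - b_i`, placed in order `a_i +
|ν|`. They are independent because the `t`-free parts of the coefficients of an element of `∑ t_j L`
vanish. They generate because subtracting the slices of an element leaves coefficients that vanish
at `t = 0`. -/
theorem quotX_isFree {B : Bifiltration n p M} (hB : B.IsFree) (k : ℤ) : (quotX B k).IsFree := by
  have hK := hB.koszulExact
  obtain ⟨r, e, a, b, h⟩ := hB
  have hvF : ∀ j : QuotIdx p b k, (dtPow j.2.1 : Dxt n p) • e j.1 ∈
      B.F (a j.1 + ((∑ l, j.2.1 l : ℕ) : ℤ)) k := fun j => by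
    have h1 : e j.1 ∈ B.F (a j.1) (b j.1) := by
      rw [repr_mem_of_generatedBy h]
      intro i
      classical
      rw [e.repr_self, Finsupp.single_apply]
      split_ifs with hi
      · subst hi
        simpa using FDx_le (one_mem_FDx (n := n) (p := p))
      · exact zero_mem _
    have h2 := B.smul_mem (dtPow_mem_FVD j.2.1) h1
    rw [add_comm] at h2
    exact B.mono_k _ (by have := j.2.2; lia) h2
  let v : QuotIdx p b k → B.V k := fun j => ⟨(dtPow j.2.1 : Dxt n p) • e j.1, _, hvF j⟩
  let π := ((tV B k).submoduleOf (B.V k)).mkQ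
  have hsum : ∀ P : QuotIdx p b k → Dx n p,
      ((∑ j, P j • v j : B.V k) : M) = ∑ j, P j • (dtPow j.2.1 : Dxt n p) • e j.1 := fun P => by
    rw [AddSubmonoidClass.coe_finsetSum]
    rfl
  have hνinj : ∀ i, Function.Injective
      fun ν : {ν : Fin p → ℕ // ((∑ j, ν j : ℕ) : ℤ) ≤ k - b i} => ν.1 :=
    fun i => Subtype.val_injective
  have hli : LinearIndependent (Dx n p) fun j => π (v j) := by
    rw [Fintype.linearIndependent_iff]
    rintro P hP ⟨i, ν⟩
    have h1 : (∑ j, P j • v j) ∈ (tV B k).submoduleOf (B.V k) := by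
      have h0 : π (∑ j, P j • v j) = 0 := by
        rw [map_sum]
        simpa only [map_smul] using hP
      exact (Submodule.Quotient.mk_eq_zero _).1 h0
    have h2 : ((∑ j, P j • v j : B.V k) : M) ∈ tIm n p M := tV_le_tIm B k h1
    rw [hsum] at h2
    have h3 : coeffs n p (P ⟨i, ν⟩) = 0 := by
      ext1 γ
      rw [Finsupp.zero_apply]
      by_cases hγ : γ.2 = 0
      · refine cof_ext fun m => ?_
        rw [map_zero]
        by_cases hm : tdeg m = 0
        · have h4 := cof_repr_of_mem_tIm e h2 i (γ.1, ν.1) m hm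
          rw [repr_sum_slices, (coeffs_sum_slices _ (hνinj i) (fun ν => P ⟨i, ν⟩) _).1 ν rfl] at h4
          rwa [show γ = (γ.1, 0) from Prod.ext rfl hγ]
        · exact noT_iff.1 (mem_Dx_iff.1 (P ⟨i, ν⟩).2 γ).2 m hm
      · exact (mem_Dx_iff.1 (P ⟨i, ν⟩).2 γ).1 hγ
    exact Subtype.ext ((coeffs n p).map_eq_zero_iff.1 h3)
  -- The expansion with control of orders; it gives both the spanning property and the description
  -- of the filtration.
  have hnf : ∀ d, ∀ x : B.V k, (x : M) ∈ B.F d k → ∃ P : QuotIdx p b k → Dx n p,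
      (∀ j, P j ∈ FDx n p (d - (a j.1 + ((∑ l, j.2.1 l : ℕ) : ℤ)))) ∧
      π x = ∑ j, P j • π (v j) := by
    intro d x hx
    have hx' := (repr_mem_of_generatedBy h).1 hx
    choose P hP using fun j : QuotIdx p b k => exists_slice (e.repr (x : M) j.1) j.2.1
    have hPF : ∀ j, P j ∈ FDx n p (d - (a j.1 + ((∑ l, j.2.1 l : ℕ) : ℤ))) := fun j => by
      rw [mem_FDx_iff]
      intro γ hγ
      have hγ2 : γ.2 = 0 := by
        by_contra h0
        exact hγ ((mem_Dx_iff.1 (P j).2 γ).1 h0)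
      rw [show γ = (γ.1, 0) from Prod.ext rfl hγ2, hP j γ.1] at hγ
      have h1 : coeffs n p (e.repr (x : M) j.1) (γ.1, j.2.1) ≠ 0 :=
        fun h0 => hγ (by rw [h0, map_zero])
      have h2 := mem_FD_iff.1 (hx' j.1).1 _ h1
      simp only [DExp.ord, hγ2, Pi.zero_apply, Finset.sum_const_zero, add_zero] at h2 ⊢
      push_cast at h2 ⊢
      lia
    refine ⟨P, hPF, ?_⟩
    have hmem : (∑ j, P j • (dtPow j.2.1 : Dxt n p) • e j.1) ∈ B.F d k :=
      sum_mem fun j _ => by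
        have := B.smul_mem (FDx_le (hPF j)) (hvF j)
        rwa [sub_add_cancel, zero_add] at this
    have h1 : (x : M) - ∑ j, P j • (dtPow j.2.1 : Dxt n p) • e j.1 ∈ tIm n p M := by
      refine mem_tIm_of_cof e fun i γ m hm => ?_
      rw [map_sub, Finsupp.sub_apply, map_sub, Finsupp.sub_apply, map_sub, repr_sum_slices,
        sub_eq_zero]
      have h2 := coeffs_sum_slices _ (hνinj i) (fun ν => P ⟨i, ν⟩) γ
      by_cases hν : ∃ ν : {ν : Fin p → ℕ // ((∑ j, ν j : ℕ) : ℤ) ≤ k - b i}, γ.2 = ν.1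
      · obtain ⟨ν, hν⟩ := hν
        rw [h2.1 ν hν, hP, cof_noTPart, if_pos hm, one_mul, ← hν]
      · push Not at hν
        rw [h2.2 hν, map_zero]
        -- A `t`-free monomial in front of `∂_t^ν` has `V`-index exactly `|ν|`, so membership in
        -- `V_k` puts `ν` in the index set.
        by_contra hne
        have h3 := (mem_FVD_iff.1 (hx' i) γ m hne).2
        rw [hm] at h3
        exact hν ⟨γ.2, by simpa [DExp.tord] using h3⟩ rfl
    have h2 : x - ∑ j, P j • v j ∈ (tV B k).submoduleOf (B.V k) := by
      change ((x - ∑ j, P j • v j : B.V k) : M) ∈ tV B k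
      rw [AddSubgroupClass.coe_sub, hsum]
      exact hK.mem_tV (sub_mem hx hmem) h1
    have h3 : π x - π (∑ j, P j • v j) = 0 := by
      rw [← map_sub]
      exact (Submodule.Quotient.mk_eq_zero _).2 h2
    rw [sub_eq_zero.1 h3, map_sum]
    simp
  have hspan : ⊤ ≤ Submodule.span (Dx n p) (Set.range fun j => π (v j)) := by
    rintro y -
    obtain ⟨x, rfl⟩ := Submodule.mkQ_surjective _ y
    obtain ⟨d, hd⟩ := x.2
    obtain ⟨P, -, hP⟩ := hnf d x hd
    change π x ∈ _
    rw [hP]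
    exact sum_mem fun j _ => Submodule.smul_mem _ _ (Submodule.subset_span ⟨j, rfl⟩)
  let bas := Module.Basis.mk hli hspan
  have hbas : ∀ j, bas j = π (v j) := fun j => Module.Basis.mk_apply hli hspan j
  let φ := Fintype.equivFin (QuotIdx p b k)
  have hbas' : ∀ i, bas.reindex φ i = π (v (φ.symm i)) := fun i => by
    rw [Module.Basis.reindex_apply, hbas]
  refine ⟨_, bas.reindex φ, fun i => a (φ.symm i).1 + ((∑ l, (φ.symm i).2.1 l : ℕ) : ℤ),
    fun d x => ⟨?_, ?_⟩⟩
  · rintro ⟨y, hy, rfl⟩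
    obtain ⟨P, hP1, hP2⟩ := hnf d y hy
    refine ⟨fun i => P (φ.symm i), fun i => hP1 _, ?_⟩
    refine hP2.trans ?_
    rw [← φ.symm.sum_comp]
    exact Finset.sum_congr rfl fun i _ => congrArg (P (φ.symm i) • ·) (hbas' i).symm
  · rintro ⟨P, hP, rfl⟩
    refine sum_mem fun i _ => ?_
    have h1 := (quotX B k).smul_mem (hP i) ⟨v (φ.symm i), hvF _, (hbas' i).symm⟩
    rwa [sub_add_cancel] at h1

end

end

section

/-! ### Elementwise criteria for quasi-isomorphisms -/

section QuasiIso

theorem ab_quasiIso_of_elements {S₁ S₂ : ShortComplex AddCommGrpCat.{u}} (φ : S₁ ⟶ S₂)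
    (hinj : ∀ x : S₁.X₂, S₁.g x = 0 → ∀ y : S₂.X₁, φ.τ₂ x = S₂.f y → ∃ z : S₁.X₁, S₁.f z = x)
    (hsurj : ∀ y : S₂.X₂, S₂.g y = 0 → ∃ x : S₁.X₂, S₁.g x = 0 ∧
      ∃ z : S₂.X₁, y - φ.τ₂ x = S₂.f z) :
    ShortComplex.QuasiIso φ := by
  let γ : ShortComplex.LeftHomologyMapData φ S₁.abLeftHomologyData S₂.abLeftHomologyData := default
  have hK : ∀ c : S₁.abLeftHomologyData.K, (γ.φK c).1 = φ.τ₂ c.1 := fun c =>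
    ConcreteCategory.congr_hom γ.commi c
  have hH : ∀ c : S₁.abLeftHomologyData.K, γ.φH (S₁.abLeftHomologyData.π c) =
      S₂.abLeftHomologyData.π (γ.φK c) := fun c => ConcreteCategory.congr_hom γ.commπ c
  rw [γ.quasiIso_iff, ConcreteCategory.isIso_iff_bijective]
  constructor
  · refine (injective_iff_map_eq_zero γ.φH.hom).2 fun h hh => ?_
    obtain ⟨c, rfl⟩ := QuotientAddGroup.mk_surjective h
    have h1 : S₂.abLeftHomologyData.π (γ.φK c) = 0 := (hH c).symm.trans hh
    obtain ⟨y, hy⟩ := (QuotientAddGroup.eq_zero_iff (N := S₂.abToCycles.range) _).1 h1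
    obtain ⟨z, hz⟩ := hinj c.1 c.2 y ((hK c).symm.trans (congrArg Subtype.val hy).symm)
    exact (QuotientAddGroup.eq_zero_iff (N := S₁.abToCycles.range) _).2 ⟨z, Subtype.ext hz⟩
  · intro h
    obtain ⟨y, rfl⟩ := QuotientAddGroup.mk_surjective h
    obtain ⟨x, hx, z, hz⟩ := hsurj y.1 y.2
    refine ⟨S₁.abLeftHomologyData.π ⟨x, hx⟩, (hH ⟨x, hx⟩).trans ?_⟩
    refine (QuotientAddGroup.eq (s := S₂.abToCycles.range)).2 ⟨z, Subtype.ext ?_⟩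
    refine hz.symm.trans ?_
    refine Eq.trans ?_ (congrArg (fun t => - t + y.1) (hK ⟨x, hx⟩).symm)
    exact sub_eq_neg_add _ _

/-- A cycle is an element killed by all `K.d j i`, which needs no separate case for degree `0`,
where no non-zero differential leaves. -/
theorem ab_chain_quasiIso_of_elements {K L : ChainComplex AddCommGrpCat.{u} ℕ} (f : K ⟶ L)
    (hinj : ∀ j, ∀ x : K.X j, (∀ i, K.d j i x = 0) → ∀ y : L.X (j + 1), f.f j x = L.d (j + 1) j y →
      ∃ z : K.X (j + 1), K.d (j + 1) j z = x)
    (hsurj : ∀ j, ∀ y : L.X j, (∀ i, L.d j i y = 0) → ∃ x : K.X j, (∀ i, K.d j i x = 0) ∧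
      ∃ z : L.X (j + 1), y - f.f j x = L.d (j + 1) j z) :
    QuasiIso f := by
  have hd : ∀ (C : ChainComplex AddCommGrpCat.{u} ℕ) (j : ℕ) (x : C.X j),
      C.d j ((ComplexShape.down ℕ).next j) x = 0 → ∀ i, C.d j i x = 0 := fun C j x hx i => by
    by_cases h : (ComplexShape.down ℕ).Rel j i
    · rwa [← (ComplexShape.down ℕ).next_eq' h]
    · rw [C.shape _ _ h]
      rfl
  refine ⟨fun j => ?_⟩
  rw [quasiIsoAt_iff' f (j + 1) j _ (by simp) rfl]
  refine ab_quasiIso_of_elements _ (fun x hx y hy => hinj j x (hd K j x hx) y hy) fun y hy => ?_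
  obtain ⟨x, hx, z, hz⟩ := hsurj j y (hd L j y hy)
  exact ⟨x, hx _, z, hz⟩

theorem module_chain_quasiIso_of_elements {A : Type} [Ring A]
    {K L : ChainComplex (ModuleCat.{u} A) ℕ} (f : K ⟶ L)
    (hinj : ∀ j, ∀ x : K.X j, (∀ i, K.d j i x = 0) → ∀ y : L.X (j + 1), f.f j x = L.d (j + 1) j y →
      ∃ z : K.X (j + 1), K.d (j + 1) j z = x)
    (hsurj : ∀ j, ∀ y : L.X j, (∀ i, L.d j i y = 0) → ∃ x : K.X j, (∀ i, K.d j i x = 0) ∧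
      ∃ z : L.X (j + 1), y - f.f j x = L.d (j + 1) j z) :
    QuasiIso f := by
  have h : QuasiIso (((forget₂ (ModuleCat.{u} A) AddCommGrpCat.{u}).mapHomologicalComplex
      (ComplexShape.down ℕ)).map f) := ab_chain_quasiIso_of_elements _ hinj hsurj
  refine ⟨fun j => ?_⟩
  rw [← HomologicalComplex.quasiIsoAt_map_iff_of_preservesHomology f (forget₂ (ModuleCat.{u} A) AddCommGrpCat.{u})]
  exact h.quasiIsoAt j

end QuasiIso

/-! ### Functors and the extension of chain complexes -/

section Extend

variable {C D : Type*} [Category* C] [Category* D] [Preadditive C] [Preadditive D]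
  [HasZeroObject C] [HasZeroObject D] (F : C ⥤ D) [F.Additive]
  {ι ι' : Type*} {c : ComplexShape ι} {c' : ComplexShape ι'} (e : c.Embedding c')

/-- The terms of the extension of a complex are compatible with functors. -/
def mapExtendXIso (K : HomologicalComplex C c) : ∀ o : Option ι,
    F.obj (HomologicalComplex.extend.X K o) ≅
      HomologicalComplex.extend.X ((F.mapHomologicalComplex c).obj K) o
  | some _ => Iso.refl _
  | none => F.mapZeroObject

/-- The extension of complexes is compatible with functors. -/
def mapExtendIso (K : HomologicalComplex C c) :
    (F.mapHomologicalComplex c').obj (K.extend e) ≅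
      ((F.mapHomologicalComplex c).obj K).extend e :=
  HomologicalComplex.Hom.isoOfComponents (fun i => mapExtendXIso F K (e.r i)) (by
    intro i j _
    change (mapExtendXIso F K (e.r i)).hom ≫
      HomologicalComplex.extend.d ((F.mapHomologicalComplex c).obj K) (e.r i) (e.r j) =
        F.map (HomologicalComplex.extend.d K (e.r i) (e.r j)) ≫ (mapExtendXIso F K (e.r j)).hom
    -- An index outside the image of the embedding corresponds to `none` and carries a zero object,
    -- so the squares that involve it commute trivially.
    generalize e.r i = a
    generalize e.r j = b
    rcases a with _ | a
    · exact (F.map_isZero (isZero_zero C)).eq_of_src _ _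
    · rcases b with _ | b
      · exact (isZero_zero D).eq_of_tgt _ _
      · exact (Category.id_comp _).trans (Category.comp_id _).symm)

theorem mapExtendIso_naturality {K L : HomologicalComplex C c} (f : K ⟶ L) :
    (F.mapHomologicalComplex c').map (HomologicalComplex.extendMap f e) ≫
        (mapExtendIso F e L).hom =
      (mapExtendIso F e K).hom ≫
        HomologicalComplex.extendMap ((F.mapHomologicalComplex c).map f) e := by
  ext i
  change F.map (HomologicalComplex.extend.mapX f (e.r i)) ≫ (mapExtendXIso F L (e.r i)).hom =
    (mapExtendXIso F K (e.r i)).hom ≫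
      HomologicalComplex.extend.mapX ((F.mapHomologicalComplex c).map f) (e.r i)
  generalize e.r i = a
  rcases a with _ | a
  · exact (F.map_isZero (isZero_zero C)).eq_of_src _ _
  · exact (Category.comp_id _).trans (Category.id_comp _).symm

theorem quasiIso_map_extendMap [CategoryWithHomology D] {K L : HomologicalComplex C c} (f : K ⟶ L)
    (h : QuasiIso ((F.mapHomologicalComplex c).map f)) :
    QuasiIso ((F.mapHomologicalComplex c').map (HomologicalComplex.extendMap f e)) := by
  refine quasiIso_of_arrow_mk_iso
    (HomologicalComplex.extendMap ((F.mapHomologicalComplex c).map f) e) _ ?_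
  exact (Arrow.isoMk (mapExtendIso F e K) (mapExtendIso F e L)
    (mapExtendIso_naturality F e f).symm).symm

end Extend

/-! ### Isomorphisms in the filtered derived category -/

variable {n p : ℕ}

theorem isoDF_of_map {S : ObjectProperty (CochainComplex (FiltMod.{u} n p) ℤ)}
    {K L : CochainComplex (FiltMod.{u} n p) ℤ} (hK : S K) (hL : S L) (f : K ⟶ L)
    (hf : ∀ d, QuasiIso (((FiltMod.gr.{u} n p d).mapHomologicalComplex (ComplexShape.up ℤ)).map f)) :
    IsoDF S K L := by
  let W := (filtQuasiIso.{u} n p).inverseImage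
    (S.strictMap (HomotopyCategory.quotient (FiltMod.{u} n p) (ComplexShape.up ℤ))).ι
  let X : KFOf S := ⟨(HomotopyCategory.quotient _ (ComplexShape.up ℤ)).obj K, ⟨K, hK⟩⟩
  let Y : KFOf S := ⟨(HomotopyCategory.quotient _ (ComplexShape.up ℤ)).obj L, ⟨L, hL⟩⟩
  let g : X ⟶ Y := ObjectProperty.homMk ((HomotopyCategory.quotient _ (ComplexShape.up ℤ)).map f)
  have hg : W g := fun d => by
    have h1 : HomotopyCategory.quasiIso AddCommGrpCat.{u} (ComplexShape.up ℤ)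
        ((HomotopyCategory.quotient _ (ComplexShape.up ℤ)).map
          (((FiltMod.gr.{u} n p d).mapHomologicalComplex (ComplexShape.up ℤ)).map f)) := by
      rw [HomotopyCategory.quotient_map_mem_quasiIso_iff, HomologicalComplex.mem_quasiIso_iff]
      exact hf d
    exact h1
  exact ⟨hK, hL, ⟨Localization.isoOfHom W.Q W g hg⟩⟩

theorem IsoDF.symm {S : ObjectProperty (CochainComplex (FiltMod.{u} n p) ℤ)}
    {K L : CochainComplex (FiltMod.{u} n p) ℤ} (h : IsoDF S K L) : IsoDF S L K := by
  obtain ⟨hK, hL, ⟨i⟩⟩ := h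
  exact ⟨hL, hK, ⟨i.symm⟩⟩

theorem IsoDF.trans {S : ObjectProperty (CochainComplex (FiltMod.{u} n p) ℤ)}
    {K L N : CochainComplex (FiltMod.{u} n p) ℤ} (h : IsoDF S K L) (h' : IsoDF S L N) :
    IsoDF S K N := by
  obtain ⟨hK, hL, ⟨i⟩⟩ := h
  obtain ⟨_, hN, ⟨j⟩⟩ := h'
  exact ⟨hK, hN, ⟨i ≪≫ j⟩⟩

theorem FiltMod.isZero_of_subsingleton (X : FiltMod.{u} n p) [Subsingleton X.carrier] :
    IsZero X where
  unique_to Y := ⟨⟨⟨0⟩, fun f => FiltMod.hom_ext fun m => by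
    rw [Subsingleton.elim m 0, map_zero, map_zero]⟩⟩
  unique_from Y := ⟨⟨⟨0⟩, fun f => FiltMod.hom_ext fun m => Subsingleton.elim _ _⟩⟩

theorem boundedRight_toCochain (K : ChainComplex (FiltMod.{u} n p) ℕ) :
    boundedRight n p (toCochain K) := ⟨0, inferInstance⟩

theorem bounded_toCochain (K : ChainComplex (FiltMod.{u} n p) ℕ) (l : ℕ)
    (h : ∀ j, l < j → Subsingleton (K.X j).carrier) : bounded n p (toCochain K) := by
  refine ⟨-l, 0, ?_, inferInstance⟩
  rw [CochainComplex.isStrictlyGE_iff]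
  intro i hi
  obtain ⟨j, hj⟩ := Int.eq_ofNat_of_zero_le (a := -i) (by lia)
  have := h j (by lia)
  exact (FiltMod.isZero_of_subsingleton (K.X j)).of_iso
    (K.extendXIso ComplexShape.embeddingDownNat (by simp; lia))

/-! ### Filtered quasi-isomorphisms -/

/-- A map of filtered complexes that is strictly surjective with a strictly acyclic kernel. -/
structure StrictQuasiIso {K L : ChainComplex (FiltMod.{u} n p) ℕ} (f : K ⟶ L) : Prop where
  surj : ∀ d j, ∀ y ∈ (L.X j).F d, ∃ x ∈ (K.X j).F d, FiltMod.lin (f.f j) x = y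
  ker : ∀ d j, ∀ x ∈ (K.X j).F d, FiltMod.lin (f.f j) x = 0 →
    (∀ i, FiltMod.lin (K.d j i) x = 0) →
    ∃ z ∈ (K.X (j + 1)).F d, FiltMod.lin (f.f (j + 1)) z = 0 ∧ FiltMod.lin (K.d (j + 1) j) z = x

theorem FiltMod.lin_comp {X Y Z : FiltMod.{u} n p} (f : X ⟶ Y) (g : Y ⟶ Z) (m : X.carrier) :
    lin (f ≫ g) m = lin g (lin f m) := rfl

theorem FiltMod.lin_zero {X Y : FiltMod.{u} n p} (m : X.carrier) :
    lin (0 : X ⟶ Y) m = 0 := rfl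

theorem lin_comm {K L : ChainComplex (FiltMod.{u} n p) ℕ} (f : K ⟶ L) (i j : ℕ)
    (x : (K.X i).carrier) :
    FiltMod.lin (f.f j) (FiltMod.lin (K.d i j) x) = FiltMod.lin (L.d i j) (FiltMod.lin (f.f i) x) := by
  rw [← FiltMod.lin_comp, ← FiltMod.lin_comp, f.comm]

theorem lin_d_d (K : ChainComplex (FiltMod.{u} n p) ℕ) (i j k : ℕ) (x : (K.X i).carrier) :
    FiltMod.lin (K.d j k) (FiltMod.lin (K.d i j) x) = 0 := by
  rw [← FiltMod.lin_comp, K.d_comp_d, FiltMod.lin_zero]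

theorem lin_d_eq_zero (K : ChainComplex (FiltMod.{u} n p) ℕ) (i j : ℕ) (h : j + 1 ≠ i)
    (x : (K.X i).carrier) : FiltMod.lin (K.d i j) x = 0 := by
  rw [K.shape i j (by simpa using h), FiltMod.lin_zero]

/-- Acyclicity of the kernel allows to correct chains whose boundary lies in the kernel. -/
theorem StrictQuasiIso.exists_correction {K L : ChainComplex (FiltMod.{u} n p) ℕ} {f : K ⟶ L}
    (h : StrictQuasiIso f) {d : ℤ} {j : ℕ} (x : (K.X j).carrier)
    (hx : ∀ i, FiltMod.lin (K.d j i) x ∈ (K.X i).F d)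
    (hfx : ∀ i, FiltMod.lin (f.f i) (FiltMod.lin (K.d j i) x) = 0) :
    ∃ z ∈ (K.X j).F d, FiltMod.lin (f.f j) z = 0 ∧
      ∀ i, FiltMod.lin (K.d j i) (x - z) = 0 := by
  rcases j with _ | j
  · exact ⟨0, zero_mem _, map_zero _, fun i => lin_d_eq_zero K 0 i (by lia) _⟩
  · obtain ⟨z, hz, hfz, hdz⟩ := h.ker d j _ (hx j) (hfx j) fun i => lin_d_d K _ _ _ _
    refine ⟨z, hz, hfz, fun i => ?_⟩
    by_cases hi : i = j
    · subst hi
      rw [map_sub, hdz, sub_self]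
    · exact lin_d_eq_zero K _ _ (by lia) _

/-- The filtrations are exhaustive, so every element lies in some `F_d`; without the filtration the
map is still onto, with an acyclic kernel. -/
theorem StrictQuasiIso.quasiIso_unfilt {K L : ChainComplex (FiltMod.{u} n p) ℕ} {f : K ⟶ L}
    (h : StrictQuasiIso f) :
    QuasiIso (((FiltMod.forget n p).mapHomologicalComplex (ComplexShape.down ℕ)).map f) := by
  have hsurj : ∀ j (y : (L.X j).carrier), ∃ x, FiltMod.lin (f.f j) x = y := fun j y => by
    obtain ⟨d, hd⟩ := (L.X j).exhaustive y
    obtain ⟨x, -, hx⟩ := h.surj d j y hd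
    exact ⟨x, hx⟩
  refine module_chain_quasiIso_of_elements _ ?_ ?_
  · intro j (x : (K.X j).carrier) hx (y : (L.X (j + 1)).carrier) hy
    obtain ⟨y, rfl⟩ := hsurj _ y
    have hx' : ∀ i, FiltMod.lin (K.d j i) x = 0 := hx
    have hy' : FiltMod.lin (f.f j) x = FiltMod.lin (L.d (j + 1) j) (FiltMod.lin (f.f _) y) := hy
    obtain ⟨d, hd⟩ := (K.X j).exhaustive (x - FiltMod.lin (K.d (j + 1) j) y)
    obtain ⟨z, -, -, hz⟩ := h.ker d j _ hd (by rw [map_sub, lin_comm, hy', sub_self])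
      fun i => by rw [map_sub, hx', lin_d_d, sub_zero]
    exact ⟨y + z, (map_add (FiltMod.lin (K.d (j + 1) j)) y z).trans (by rw [hz]; abel)⟩
  · intro j (y : (L.X j).carrier) hy
    have hy' : ∀ i, FiltMod.lin (L.d j i) y = 0 := hy
    obtain ⟨x, rfl⟩ := hsurj _ y
    have hfx : ∀ i, FiltMod.lin (f.f i) (FiltMod.lin (K.d j i) x) = 0 :=
      fun i => by rw [lin_comm, hy']
    obtain ⟨d, hd⟩ : ∃ d, ∀ i, FiltMod.lin (K.d j i) x ∈ (K.X i).F d := by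
      obtain ⟨d, hd⟩ := (K.X j).exhaustive x
      exact ⟨d, fun i => FiltMod.lin_mem _ hd⟩
    obtain ⟨z, -, hfz, hz⟩ := h.exists_correction x hd hfx
    refine ⟨x - z, hz, 0, ?_⟩
    change FiltMod.lin (f.f j) x - FiltMod.lin (f.f j) (x - z) = FiltMod.lin (L.d (j + 1) j) 0
    rw [map_sub, hfz, sub_zero, sub_self, map_zero]

theorem FiltMod.gr_mk_eq_zero {X : FiltMod.{u} n p} {d : ℤ} {x : X.F d} :
    ((QuotientAddGroup.mk x : X.F d ⧸ (X.F (d - 1)).addSubgroupOf (X.F d)) = 0) ↔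
      (x : X.carrier) ∈ X.F (d - 1) := by
  rw [QuotientAddGroup.eq_zero_iff, AddSubgroup.mem_addSubgroupOf]

theorem FiltMod.gr_mk_eq_mk {X : FiltMod.{u} n p} {d : ℤ} {x y : X.F d} :
    ((QuotientAddGroup.mk x : X.F d ⧸ (X.F (d - 1)).addSubgroupOf (X.F d)) =
      QuotientAddGroup.mk y) ↔ (x : X.carrier) - y ∈ X.F (d - 1) := by
  rw [eq_comm, QuotientAddGroup.eq, AddSubgroup.mem_addSubgroupOf, sub_eq_neg_add (x : X.carrier)]
  rfl

/-- The kernel is acyclic in `F_d` and in `F_{d-1}`, hence on the graded piece. The chase lifts a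
cycle of `gr_d` to an element whose boundary lies in `F_{d-1}` and corrects it by elements of
`F_{d-1}`, which do not change its class. -/
theorem StrictQuasiIso.quasiIso_gr {K L : ChainComplex (FiltMod.{u} n p) ℕ} {f : K ⟶ L}
    (h : StrictQuasiIso f) (d : ℤ) :
    QuasiIso (((FiltMod.gr n p d).mapHomologicalComplex (ComplexShape.down ℕ)).map f) := by
  have hle : ∀ X : FiltMod.{u} n p, X.F (d - 1) ≤ X.F d := fun X => X.mono (by lia)
  refine ab_chain_quasiIso_of_elements _ ?_ ?_
  · intro j x hx y hy
    obtain ⟨x, rfl⟩ := QuotientAddGroup.mk_surjective x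
    obtain ⟨y, rfl⟩ := QuotientAddGroup.mk_surjective y
    obtain ⟨w, hw, hwy⟩ := h.surj d (j + 1) y.1 y.2
    have hx' : ∀ i, FiltMod.lin (K.d j i) x.1 ∈ (K.X i).F (d - 1) :=
      fun i => FiltMod.gr_mk_eq_zero.1 (hx i)
    have hy' : FiltMod.lin (f.f j) x.1 - FiltMod.lin (L.d (j + 1) j) y.1 ∈ (L.X j).F (d - 1) :=
      FiltMod.gr_mk_eq_mk (x := ⟨FiltMod.lin (f.f j) x.1, FiltMod.lin_mem _ x.2⟩)
        (y := ⟨FiltMod.lin (L.d (j + 1) j) y.1, FiltMod.lin_mem _ y.2⟩).1 hy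
    obtain ⟨v, hv, hvy⟩ := h.surj (d - 1) j _ hy'
    -- This representative lies in the kernel of `f` and has its boundary in `F_{d-1}`. Subtracting
    -- `z` from `F_{d-1}` makes it a cycle of the kernel, hence the boundary of some `u` in `F_d`.
    set x' := x.1 - FiltMod.lin (K.d (j + 1) j) w - v with hx'def
    have hfx' : FiltMod.lin (f.f j) x' = 0 := by
      rw [hx'def, map_sub, map_sub, lin_comm, hwy, hvy, sub_self]
    have hdx' : ∀ i, FiltMod.lin (K.d j i) x' ∈ (K.X i).F (d - 1) := fun i => by
      rw [hx'def, map_sub, map_sub, lin_d_d, sub_zero]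
      exact sub_mem (hx' i) (FiltMod.lin_mem _ hv)
    obtain ⟨z, hz, hfz, hdz⟩ := h.exists_correction x' hdx'
      fun i => by rw [lin_comm, hfx', map_zero]
    have hx'F : x' - z ∈ (K.X j).F d :=
      sub_mem (sub_mem (sub_mem x.2 (FiltMod.lin_mem _ hw)) (hle _ hv)) (hle _ hz)
    obtain ⟨u, hu, -, hdu⟩ := h.ker d j _ hx'F (by rw [map_sub, hfx', hfz, sub_zero]) hdz
    refine ⟨QuotientAddGroup.mk ⟨w + u, add_mem hw hu⟩, ?_⟩
    refine FiltMod.gr_mk_eq_mk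
      (x := ⟨FiltMod.lin (K.d (j + 1) j) (w + u), FiltMod.lin_mem _ (add_mem hw hu)⟩)
      (y := x).2 ?_
    change FiltMod.lin (K.d (j + 1) j) (w + u) - x.1 ∈ _
    have : FiltMod.lin (K.d (j + 1) j) (w + u) - x.1 = -(v + z) := by
      rw [map_add, hdu, hx'def]
      abel
    rw [this]
    exact neg_mem (add_mem hv hz)
  · intro j y hy
    obtain ⟨y, rfl⟩ := QuotientAddGroup.mk_surjective y
    have hy' : ∀ i, FiltMod.lin (L.d j i) y.1 ∈ (L.X i).F (d - 1) :=
      fun i => FiltMod.gr_mk_eq_zero.1 (hy i)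
    obtain ⟨x, hx, hxy⟩ := h.surj d j y.1 y.2
    -- A lift of `y` need not be a cycle modulo `F_{d-1}`. Its boundary minus elements `v` and `z`
    -- of `F_{d-1}` is a cycle of the kernel, thus the boundary of some `u` in the kernel, and `x -
    -- u` is the required lift.
    obtain ⟨x', hx', hdx', hfx'⟩ : ∃ x' ∈ (K.X j).F d,
        (∀ i, FiltMod.lin (K.d j i) x' ∈ (K.X i).F (d - 1)) ∧
          FiltMod.lin (f.f j) x' = y.1 := by
      rcases j with _ | j
      · exact ⟨x, hx, fun i => by rw [lin_d_eq_zero K _ _ (by lia)]; exact zero_mem _, hxy⟩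
      · obtain ⟨v, hv, hvy⟩ := h.surj (d - 1) j _ (hy' j)
        have hvd : ∀ i, FiltMod.lin (K.d j i) (FiltMod.lin (K.d (j + 1) j) x - v) ∈
            (K.X i).F (d - 1) := fun i => by
          rw [map_sub, lin_d_d, zero_sub]
          exact neg_mem (FiltMod.lin_mem _ hv)
        have hfv : FiltMod.lin (f.f j) (FiltMod.lin (K.d (j + 1) j) x - v) = 0 := by
          rw [map_sub, lin_comm, hxy, hvy, sub_self]
        obtain ⟨z, hz, hfz, hdz⟩ := h.exists_correction _ hvd
          fun i => by rw [lin_comm, hfv, map_zero]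
        obtain ⟨u, hu, hfu, hdu⟩ := h.ker d j _
          (sub_mem (sub_mem (FiltMod.lin_mem _ hx) (hle _ hv)) (hle _ hz))
          (by rw [map_sub, hfv, hfz, sub_zero]) hdz
        refine ⟨x - u, sub_mem hx hu, fun i => ?_, by rw [map_sub, hfu, sub_zero, hxy]⟩
        by_cases hi : i = j
        · subst hi
          rw [map_sub, hdu]
          have := add_mem hv hz
          rwa [show FiltMod.lin (K.d (i + 1) i) x - (FiltMod.lin (K.d (i + 1) i) x - v - z) = v + z
            by abel]
        · rw [lin_d_eq_zero K _ _ (by lia)]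
          exact zero_mem _
    refine ⟨QuotientAddGroup.mk ⟨x', hx'⟩, fun i => ?_, 0, ?_⟩
    · exact FiltMod.gr_mk_eq_zero (x := ⟨_, FiltMod.lin_mem _ hx'⟩).2 (hdx' i)
    · refine Eq.trans (b := (0 : (L.X j).F d ⧸ ((L.X j).F (d - 1)).addSubgroupOf ((L.X j).F d)))
        ?_ (map_zero _).symm
      exact sub_eq_zero.2 (congrArg QuotientAddGroup.mk (Subtype.ext hfx'.symm))

theorem StrictQuasiIso.isoDF {K L : ChainComplex (FiltMod.{u} n p) ℕ} {f : K ⟶ L}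
    (h : StrictQuasiIso f) {S : ObjectProperty (CochainComplex (FiltMod.{u} n p) ℤ)}
    (hK : S (toCochain K)) (hL : S (toCochain L)) : IsoDF S (toCochain K) (toCochain L) :=
  isoDF_of_map hK hL (HomologicalComplex.extendMap f ComplexShape.embeddingDownNat) fun d =>
    quasiIso_map_extendMap _ _ f (h.quasiIso_gr d)

/-- Quasi-isomorphic complexes of `D`-modules are isomorphic in the derived category. -/
theorem nonempty_iso_of_quasiIso {A : Type} [Ring A] [HasDerivedCategory.{w} (ModuleCat.{u} A)]
    {K L : ChainComplex (ModuleCat.{u} A) ℕ} (f : K ⟶ L) (hf : QuasiIso f) :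
    Nonempty (DerivedCategory.Q.obj (toCochain K) ≅ DerivedCategory.Q.obj (toCochain L)) := by
  have : QuasiIso (HomologicalComplex.extendMap f ComplexShape.embeddingDownNat) := inferInstance
  exact ⟨asIso (DerivedCategory.Q.map
    (HomologicalComplex.extendMap f ComplexShape.embeddingDownNat))⟩

end

section

variable {n p : ℕ}

/-! ### The total complex of the Koszul complexes of a resolution -/

section Total

variable {M : Type u} [AddCommGroup M] [Module (Dxt n p) M]

/-- A bifiltered resolution by modules with exact Koszul complexes. -/
structure KoszulResolution (B : Bifiltration n p M) where
  L : ℕ → Type u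
  [grp : ∀ i, AddCommGroup (L i)]
  [mod : ∀ i, Module (Dxt n p) (L i)]
  /-- the bifiltration of `L_i` -/
  filt : ∀ i, Bifiltration n p (L i)
  koszul : ∀ i, (filt i).KoszulExact
  /-- the differentials -/
  ψ : ∀ i, L (i + 1) →ₗ[Dxt n p] L i
  /-- the augmentation -/
  ε : L 0 →ₗ[Dxt n p] M
  ψ_mem : ∀ i d k, ∀ m ∈ (filt (i + 1)).F d k, ψ i m ∈ (filt i).F d k
  ε_mem : ∀ d k, ∀ m ∈ (filt 0).F d k, ε m ∈ B.F d k
  ψ_ψ : ∀ i m, ψ i (ψ (i + 1) m) = 0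
  ε_ψ : ∀ m, ε (ψ 0 m) = 0
  ψ_exact_F : ∀ i d k, ∀ m ∈ (filt (i + 1)).F d k, ψ i m = 0 →
    ∃ m' ∈ (filt (i + 2)).F d k, ψ (i + 1) m' = m
  ε_exact_F : ∀ d k, ∀ m ∈ (filt 0).F d k, ε m = 0 → ∃ m' ∈ (filt 1).F d k, ψ 0 m' = m
  ε_surj_F : ∀ d k, ∀ m ∈ B.F d k, ∃ m' ∈ (filt 0).F d k, ε m' = m

attribute [instance] KoszulResolution.grp KoszulResolution.mod

theorem koszulD_map {N : Type u} [AddCommGroup N] [Module (Dxt n p) N] (f : M →ₗ[Dxt n p] N)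
    (c : Finset (Fin p) → M) (s : Finset (Fin p)) :
    koszulD n N (fun s => f (c s)) s = f (koszulD n M c s) := by
  rw [koszulD_apply, koszulD_apply, map_sum]
  exact Finset.sum_congr rfl fun i _ => by rw [map_zsmul, map_smul]

namespace KoszulResolution

variable {B : Bifiltration n p M} (R : KoszulResolution B)

/-- The ambient module of the total complex. -/
abbrev TotFam : Type u := ∀ i, Finset (Fin p) → R.L i

/-- The differential of the total complex. -/
def totD : R.TotFam →ₗ[Dx n p] R.TotFam :=
  -- The maps `ψ` commute with the Koszul differentials; the sign `(-1)^i` turns this into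
  -- anticommutation.
  LinearMap.pi fun i => (resD (R.ψ i)).compLeft (Finset (Fin p)) ∘ₗ LinearMap.proj (i + 1) +
    ((-1 : ℤ) ^ i) • (koszulD n (R.L i) ∘ₗ LinearMap.proj i)

theorem totD_apply (c : R.TotFam) (i : ℕ) (s : Finset (Fin p)) :
    R.totD c i s = R.ψ i (c (i + 1) s) + ((-1 : ℤ) ^ i) • koszulD n (R.L i) (c i) s := rfl

theorem totD_totD (c : R.TotFam) : R.totD (R.totD c) = 0 := by
  funext i s
  have h1 : koszulD n (R.L i) (R.totD c i) =
      (koszulD n (R.L i) fun s => R.ψ i (c (i + 1) s)) +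
        ((-1 : ℤ) ^ i) • koszulD n (R.L i) (koszulD n (R.L i) (c i)) := by
    rw [← map_zsmul, ← map_add]
    rfl
  rw [totD_apply, totD_apply, map_add, R.ψ_ψ, map_zsmul, h1, koszulD_comp, smul_zero, add_zero,
    koszulD_map, zero_add, ← add_smul, pow_succ]
  simp

variable (k : ℤ)

/-- The terms of the total complex. -/
def totV (m : ℕ) : Submodule (Dx n p) R.TotFam where
  -- The support condition cuts the infinite product down to finitely many summands; the `V`-index
  -- depends on the Koszul degree `|s|` only.
  carrier := {c | ∀ i s, c i s ∈ (R.filt i).V (k + s.card) ∧ (i + s.card ≠ m → c i s = 0)}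
  zero_mem' i s := by
    change (0 : R.L i) ∈ _ ∧ (_ → (0 : R.L i) = 0)
    exact ⟨zero_mem _, fun _ => rfl⟩
  add_mem' {x y} hx hy i s := by
    change x i s + y i s ∈ _ ∧ (_ → x i s + y i s = 0)
    exact ⟨add_mem (hx i s).1 (hy i s).1, fun h => by rw [(hx i s).2 h, (hy i s).2 h, add_zero]⟩
  smul_mem' P x hx i s := by
    change P • x i s ∈ _ ∧ (_ → P • x i s = 0)
    exact ⟨((R.filt i).V (k + s.card)).smul_mem P (hx i s).1, fun h => by
      rw [(hx i s).2 h, smul_zero]⟩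

/-- A term of the total complex, with its filtration. -/
def totX (m : ℕ) : FiltMod.{u} n p where
  carrier := R.totV k m
  F d :=
    { carrier := {c | ∀ i s, c.1 i s ∈ (R.filt i).F d (k + s.card)}
      zero_mem' := fun _ _ => zero_mem _
      add_mem' := fun hx hy i s => add_mem (hx i s) (hy i s)
      neg_mem' := fun hx i s => neg_mem (hx i s) }
  exhaustive c := by
    choose d hd using fun i s => (c.2 i s).1
    -- Only columns `i ≤ m` can be non-zero in degree `m`, so a single order bounds all components.
    refine ⟨(Finset.range (m + 1) ×ˢ Finset.univ).sup' (by simp) fun x => d x.1 x.2,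
      fun i s => ?_⟩
    by_cases h : i + s.card = m
    · exact (R.filt i).mono_d (Finset.le_sup' (fun x : ℕ × Finset (Fin p) => d x.1 x.2)
        (b := (i, s)) (by simp; lia)) _ (hd i s)
    · rw [(c.2 i s).2 h]
      exact zero_mem _
  smul_mem hP hm i s := by
    have := (R.filt i).smul_mem (FDx_le hP) (hm i s)
    rwa [zero_add] at this

theorem koszulD_mem_F {N : Type u} [AddCommGroup N] [Module (Dxt n p) N] (C : Bifiltration n p N)
    {d : ℤ} {c : Finset (Fin p) → N} (hc : ∀ s, c s ∈ C.F d (k + s.card)) (s : Finset (Fin p)) :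
    koszulD n N c s ∈ C.F d (k + s.card) := by
  rw [koszulD_apply]
  refine sum_mem fun i hi => zsmul_mem (C.tt_smul_mem i ?_ (hc _)) _
  rw [Finset.card_insert_of_notMem (Finset.mem_compl.1 hi)]
  push_cast
  ring

theorem totD_mem_F {d : ℤ} {c : R.TotFam} (hc : ∀ i s, c i s ∈ (R.filt i).F d (k + s.card))
    (i : ℕ) (s : Finset (Fin p)) : R.totD c i s ∈ (R.filt i).F d (k + s.card) :=
  add_mem (R.ψ_mem i d _ _ (hc (i + 1) s)) (zsmul_mem (koszulD_mem_F k (R.filt i) (hc i) s) _)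

theorem koszulD_supp {N : Type u} [AddCommGroup N] [Module (Dxt n p) N]
    {c : Finset (Fin p) → N} {j : ℕ} (hc : ∀ s, s.card ≠ j + 1 → c s = 0) (s : Finset (Fin p))
    (hs : s.card ≠ j) : koszulD n N c s = 0 := by
  rw [koszulD_apply]
  refine Finset.sum_eq_zero fun i hi => ?_
  rw [hc (insert i s), smul_zero, smul_zero]
  rw [Finset.card_insert_of_notMem (Finset.mem_compl.1 hi)]
  exact fun h => hs (Nat.succ_injective h)

theorem totD_supp {c : R.TotFam} {m : ℕ} (hc : ∀ i s, i + s.card ≠ m + 1 → c i s = 0)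
    (i : ℕ) (s : Finset (Fin p)) (hs : i + s.card ≠ m) : R.totD c i s = 0 := by
  have h2 : koszulD n (R.L i) (c i) s = 0 := by
    rw [koszulD_apply]
    refine Finset.sum_eq_zero fun l hl => ?_
    rw [hc i (insert l s), smul_zero, smul_zero]
    rw [Finset.card_insert_of_notMem (Finset.mem_compl.1 hl)]
    lia
  rw [totD_apply, hc (i + 1) s (by lia), map_zero, zero_add, h2, smul_zero]

theorem totD_memV {m : ℕ} {c : R.TotFam} (hc : c ∈ R.totV k (m + 1)) : R.totD c ∈ R.totV k m := by
  obtain ⟨d, hd⟩ := (R.totX k (m + 1)).exhaustive ⟨c, hc⟩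
  exact fun i s => ⟨⟨d, R.totD_mem_F k hd i s⟩, R.totD_supp (fun i s => (hc i s).2) i s⟩

/-- The total complex of the Koszul complexes `V_{k+•}(L_i) ⊗ Λ^•`. -/
def totComplex : ChainComplex (FiltMod.{u} n p) ℕ :=
  ChainComplex.of (R.totX k)
    (fun _ => FiltMod.ofHom (R.totD.restrict fun _ hc => R.totD_memV k hc)
      (fun _ _ hc => R.totD_mem_F k hc))
    (fun _ => FiltMod.hom_ext fun c => Subtype.ext (R.totD_totD c.1))

theorem totComplex_d (m : ℕ) (c : R.totV k (m + 1)) :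
    (FiltMod.lin ((R.totComplex k).d (m + 1) m) c : R.totV k m).1 = R.totD c.1 := by
  have h : (R.totComplex k).d (m + 1) m = FiltMod.ofHom (X := R.totX k (m + 1)) (Y := R.totX k m)
      (R.totD.restrict fun _ hc => R.totD_memV k hc) (fun _ _ hc => R.totD_mem_F k hc) :=
    ChainComplex.of_d (R.totX k) (fun m => FiltMod.ofHom (X := R.totX k (m + 1)) (Y := R.totX k m)
      (R.totD.restrict fun _ hc => R.totD_memV k hc) (fun _ _ hc => R.totD_mem_F k hc)) m
  rw [h]
  rfl

theorem koszulComplex_d (m : ℕ) (c : koszulV B k (m + 1)) :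
    (FiltMod.lin ((koszulComplex B k).d (m + 1) m) c : koszulV B k m).1 = koszulD n M c.1 := by
  have h : (koszulComplex B k).d (m + 1) m =
      FiltMod.ofHom (X := koszulX B k (m + 1)) (Y := koszulX B k m)
        ((koszulD n M).restrict fun _ hc => koszulD_memV B k hc)
        (fun _ _ hc s => koszulD_mem B k hc s) :=
    ChainComplex.of_d (koszulX B k)
      (fun j => FiltMod.ofHom (X := koszulX B k (j + 1)) (Y := koszulX B k j)
        ((koszulD n M).restrict fun _ hc => koszulD_memV B k hc)
        (fun _ _ hc s => koszulD_mem B k hc s)) m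
  rw [h]
  rfl

/-- The augmentation of the total complex. -/
def toKoszulLin : R.TotFam →ₗ[Dx n p] (Finset (Fin p) → M) :=
  (resD R.ε).compLeft (Finset (Fin p)) ∘ₗ LinearMap.proj 0

theorem toKoszulLin_apply (c : R.TotFam) (s : Finset (Fin p)) :
    R.toKoszulLin c s = R.ε (c 0 s) := rfl

theorem toKoszulLin_mem_F {d : ℤ} {m : ℕ} {c : R.TotFam}
    (hc : ∀ i s, c i s ∈ (R.filt i).F d (k + s.card))
    (hc' : ∀ i s, i + s.card ≠ m → c i s = 0) (s : Finset (Fin p)) :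
    R.toKoszulLin c s ∈ B.F d (k + m) := by
  rw [toKoszulLin_apply]
  by_cases hs : s.card = m
  · rw [← hs]
    exact R.ε_mem _ _ _ (hc 0 s)
  · rw [hc' 0 s (by lia), map_zero]
    exact zero_mem _

theorem toKoszulLin_mem {m : ℕ} {c : R.TotFam} (hc : c ∈ R.totV k m) :
    R.toKoszulLin c ∈ koszulV B k m := by
  obtain ⟨d, hd⟩ := (R.totX k m).exhaustive ⟨c, hc⟩
  exact fun s => ⟨⟨d, R.toKoszulLin_mem_F k hd (fun i s => (hc i s).2) s⟩,
    fun hs => by rw [toKoszulLin_apply, (hc 0 s).2 (by lia), map_zero]⟩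

theorem toKoszulLin_totD (c : R.TotFam) :
    R.toKoszulLin (R.totD c) = koszulD n M (R.toKoszulLin c) := by
  funext s
  rw [toKoszulLin_apply, totD_apply, map_add, R.ε_ψ, zero_add, pow_zero, one_smul]
  exact (koszulD_map R.ε (c 0) s).symm

/-- The augmentation of the total complex, as a map of filtered complexes. -/
def toKoszul : R.totComplex k ⟶ koszulComplex B k :=
  ChainComplex.ofHom
    (fun m => FiltMod.ofHom (X := R.totX k m) (Y := koszulX B k m)
      (R.toKoszulLin.restrict fun _ hc => R.toKoszulLin_mem k hc)
      (fun _ c hc => R.toKoszulLin_mem_F k hc fun i s => (c.2 i s).2))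
    (fun m => FiltMod.hom_ext fun c => Subtype.ext
      ((koszulComplex_d k m ⟨R.toKoszulLin c.1, R.toKoszulLin_mem k c.2⟩).trans
        ((R.toKoszulLin_totD c.1).symm.trans
          (congrArg R.toKoszulLin (R.totComplex_d k m c).symm))))

theorem totD_update_of_lt (x : R.TotFam) (i : ℕ) (y : Finset (Fin p) → R.L i) {i' : ℕ}
    (h : i < i') : R.totD (Function.update x i y) i' = R.totD x i' := by
  funext s
  rw [totD_apply, totD_apply, Function.update_of_ne (by lia), Function.update_of_ne (by lia)]

theorem totD_update_of_succ_lt (x : R.TotFam) (i : ℕ) (y : Finset (Fin p) → R.L i) {i' : ℕ}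
    (h : i' + 1 < i) : R.totD (Function.update x i y) i' = R.totD x i' := by
  funext s
  rw [totD_apply, totD_apply, Function.update_of_ne (by lia), Function.update_of_ne (by lia)]

theorem totD_update_self (x : R.TotFam) (i : ℕ) (y : Finset (Fin p) → R.L i)
    (s : Finset (Fin p)) : R.totD (Function.update x i y) i s =
      R.ψ i (x (i + 1) s) + ((-1 : ℤ) ^ i) • koszulD n (R.L i) y s := by
  rw [totD_apply, Function.update_of_ne (by lia), Function.update_self]

theorem totD_update_succ (x : R.TotFam) (i : ℕ) (y : Finset (Fin p) → R.L (i + 1))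
    (s : Finset (Fin p)) : R.totD (Function.update x (i + 1) y) i s =
      R.ψ i (y s) + ((-1 : ℤ) ^ i) • koszulD n (R.L i) (x i) s := by
  rw [totD_apply, Function.update_self, Function.update_of_ne (by lia)]

/-- The kernel of the augmentation of the total complex is acyclic. -/
theorem exists_totD_eq_of_toKoszulLin {d : ℤ} {m : ℕ} (c : R.TotFam)
    (hcF : ∀ i s, c i s ∈ (R.filt i).F d (k + s.card)) (hcs : ∀ i s, i + s.card ≠ m → c i s = 0)
    (hc0 : R.toKoszulLin c = 0) (hc : R.totD c = 0) :
    ∃ x : R.TotFam, (∀ i s, x i s ∈ (R.filt i).F d (k + s.card)) ∧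
      (∀ i s, i + s.card ≠ m + 1 → x i s = 0) ∧ R.toKoszulLin x = 0 ∧ R.totD x = c := by
  -- The primitive is built along the resolution, upwards from `x 0 = 0`, the choice that places it
  -- in the kernel of the augmentation. After `l` steps the equation holds in the columns `i < l`.
  suffices h : ∀ l, ∃ x : R.TotFam, (∀ i s, x i s ∈ (R.filt i).F d (k + s.card)) ∧
      (∀ i s, i + s.card ≠ m + 1 → x i s = 0) ∧ x 0 = 0 ∧ ∀ i, i < l → R.totD x i = c i by
    obtain ⟨x, h1, h2, h3, h4⟩ := h (m + 1)
    refine ⟨x, h1, h2, ?_, funext fun i => ?_⟩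
    · funext s
      rw [toKoszulLin_apply, h3]
      exact map_zero _
    · by_cases hi : i < m + 1
      · exact h4 i hi
      · funext s
        rw [R.totD_supp h2 i s (by lia), hcs i s (by lia)]
  intro l
  induction l with
  | zero => exact ⟨0, fun _ _ => zero_mem _, fun _ _ _ => rfl, rfl, fun i hi => absurd hi (by lia)⟩
  | succ l ih =>
    obtain ⟨x, h1, h2, h3, h4⟩ := ih
    -- The equation in column `l`, to be solved for the next component by exactness of the
    -- resolution in `F_{d,k+|s|}`.
    have hw : ∀ s, ∃ y ∈ (R.filt (l + 1)).F d (k + s.card),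
        R.ψ l y = c l s - ((-1 : ℤ) ^ l) • koszulD n (R.L l) (x l) s := by
      intro s
      have hF : c l s - ((-1 : ℤ) ^ l) • koszulD n (R.L l) (x l) s ∈
          (R.filt l).F d (k + s.card) :=
        sub_mem (hcF l s) (zsmul_mem (koszulD_mem_F k (R.filt l) (h1 l) s) _)
      -- For `l = 0` the right-hand side is killed by `ε` because `c` lies in the kernel of the
      -- augmentation. For larger `l` it is killed by `ψ`, by `totD c = 0` and the equation already
      -- solved in the preceding column.
      rcases l with _ | l
      · refine R.ε_exact_F d _ _ hF ?_
        rw [h3, map_zero, Pi.zero_apply, smul_zero, sub_zero]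
        exact congrFun hc0 s
      · refine R.ψ_exact_F l d _ _ hF ?_
        have h5 : R.ψ l (c (l + 1) s) + ((-1 : ℤ) ^ l) • koszulD n (R.L l) (c l) s = 0 :=
          congrFun (congrFun hc l) s
        have h6 : (fun s => R.ψ l (x (l + 1) s)) =
            c l - ((-1 : ℤ) ^ l) • koszulD n (R.L l) (x l) := by
          funext s
          have := congrFun (h4 l (by lia)) s
          rw [totD_apply] at this
          rw [Pi.sub_apply, Pi.smul_apply, ← this, add_sub_cancel_right]
        rw [map_sub, map_zsmul, ← koszulD_map, h6, map_sub, map_zsmul, koszulD_comp, smul_zero,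
          sub_zero, ← h5, pow_succ]
        simp
    choose y hyF hy using hw
    -- The preimages chosen off the support need not be zero and are discarded; there both sides of
    -- the equation vanish anyway.
    refine ⟨Function.update x (l + 1) fun s => if l + 1 + s.card = m + 1 then y s else 0,
      fun i s => ?_, fun i s hs => ?_, ?_, fun i hi => ?_⟩
    · by_cases hi : i = l + 1
      · subst hi
        rw [Function.update_self]
        split_ifs
        · exact hyF s
        · exact zero_mem _
      · rw [Function.update_of_ne hi]
        exact h1 i s
    · by_cases hi : i = l + 1
      · subst hi
        rw [Function.update_self, if_neg hs]
      · rw [Function.update_of_ne hi]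
        exact h2 i s hs
    · rw [Function.update_of_ne (by lia), h3]
    · by_cases hil : i = l
      · subst hil
        funext s
        rw [totD_update_succ]
        split_ifs with hs
        · rw [hy, sub_add_cancel]
        · have h7 : koszulD n (R.L i) (x i) s = 0 := by
            have := R.totD_supp (m := m) h2 i s (by lia)
            rw [totD_apply, h2 (i + 1) s (by lia), map_zero, zero_add] at this
            have := congrArg (((-1 : ℤ) ^ i) • ·) this
            simpa [smul_smul, ← mul_pow] using this
          rw [map_zero, zero_add, h7, smul_zero, hcs i s (by lia)]
      · rw [R.totD_update_of_succ_lt _ _ _ (by lia)]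
        exact h4 i (by lia)

/-- Translates the cycle condition to the ambient differential. In degree `0` that condition is
empty, and `totD` vanishes for reasons of support. -/
theorem totD_eq_zero {j : ℕ} (c : R.totV k j)
    (hdc : ∀ i, FiltMod.lin ((R.totComplex k).d j i) c = 0) : R.totD c.1 = 0 := by
  rcases j with _ | j
  · funext i s
    by_cases hi : i = 0 ∧ s = ∅
    · obtain ⟨rfl, rfl⟩ := hi
      rw [totD_apply, (c.2 1 ∅).2 (by simp), map_zero, zero_add, koszulD_empty]
      rw [Finset.sum_eq_zero fun i _ => by rw [(c.2 0 {i}).2 (by simp), smul_zero], smul_zero]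
      rfl
    · rw [totD_apply, (c.2 (i + 1) s).2 (by lia), map_zero, zero_add, koszulD_apply]
      rw [Finset.sum_eq_zero fun l hl => by
        rw [(c.2 i (insert l s)).2
          (by rw [Finset.card_insert_of_notMem (Finset.mem_compl.1 hl)]; lia),
          smul_zero, smul_zero], smul_zero]
      rfl
  · rw [← R.totComplex_d k j c]
    exact congrArg Subtype.val (hdc j)

/-- The Koszul complex is quasi-isomorphic to the total complex. -/
theorem toKoszul_strictQuasiIso : StrictQuasiIso (R.toKoszul k) where
  surj d j y hy := by
    change koszulV B k j at y
    have hy' : ∀ s, y.1 s ∈ B.F d (k + j) := hy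
    choose x hxF hx using fun s => R.ε_surj_F d (k + j) (y.1 s) (hy' s)
    let c : R.TotFam := fun i => match i with
      | 0 => fun s => if s.card = j then x s else 0
      | _ + 1 => 0
    have hcF : ∀ i s, c i s ∈ (R.filt i).F d (k + s.card) := by
      rintro (_ | i) s
      · change (if s.card = j then x s else 0) ∈ _
        split_ifs with h
        · rw [h]; exact hxF s
        · exact zero_mem _
      · exact zero_mem _
    have hcs : ∀ i s, i + s.card ≠ j → c i s = 0 := by
      rintro (_ | i) s hs
      · exact if_neg (by lia)
      · rfl
    refine ⟨(⟨c, fun i s => ⟨⟨d, hcF i s⟩, hcs i s⟩⟩ : R.totV k j), hcF, ?_⟩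
    refine Subtype.ext (funext fun s => ?_)
    change R.ε (if s.card = j then x s else 0) = y.1 s
    split_ifs with h
    · exact hx s
    · rw [map_zero, (y.2 s).2 h]
  ker d j c hc hfc hdc := by
    change R.totV k j at c
    obtain ⟨x, hx1, hx2, hx3, hx4⟩ := R.exists_totD_eq_of_toKoszulLin k c.1 hc
      (fun i s => (c.2 i s).2) (congrArg Subtype.val hfc) (R.totD_eq_zero k c hdc)
    refine ⟨(⟨x, fun i s => ⟨⟨d, hx1 i s⟩, hx2 i s⟩⟩ : R.totV k (j + 1)), hx1,
      Subtype.ext hx3, Subtype.ext ?_⟩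
    exact (R.totComplex_d k j _).trans hx4

/-- The kernel of the map to the cokernels of the Koszul complexes is acyclic. -/
theorem exists_totD_eq_of_mem_tIm {d : ℤ} {m : ℕ} (c : R.TotFam)
    (hcF : ∀ i s, c i s ∈ (R.filt i).F d (k + s.card)) (hcs : ∀ i s, i + s.card ≠ m → c i s = 0)
    (hc0 : c m ∅ ∈ tIm n p (R.L m)) (hc : R.totD c = 0) :
    ∃ x : R.TotFam, (∀ i s, x i s ∈ (R.filt i).F d (k + s.card)) ∧
      (∀ i s, i + s.card ≠ m + 1 → x i s = 0) ∧ x (m + 1) ∅ = 0 ∧ R.totD x = c := by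
  -- Now the primitive is built in the opposite direction, down from `x (m + 1) = 0`, using the
  -- Koszul complexes. After `l` steps the equation holds in the columns `i > m - l`.
  suffices h : ∀ l, ∃ x : R.TotFam, (∀ i s, x i s ∈ (R.filt i).F d (k + s.card)) ∧
      (∀ i s, i + s.card ≠ m + 1 → x i s = 0) ∧ x (m + 1) = 0 ∧
        ∀ i, m < i + l → R.totD x i = c i by
    obtain ⟨x, h1, h2, h3, h4⟩ := h (m + 1)
    exact ⟨x, h1, h2, congrFun h3 ∅, funext fun i => h4 i (by lia)⟩
  intro l
  induction l with
  | zero =>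
    refine ⟨0, fun _ _ => zero_mem _, fun _ _ _ => rfl, rfl, fun i hi => ?_⟩
    funext s
    rw [map_zero, hcs i s (by lia)]
    rfl
  | succ l ih =>
    obtain ⟨x, h1, h2, h3, h4⟩ := ih
    by_cases hlm : m < l
    · exact ⟨x, h1, h2, h3, fun i hi => h4 i (by lia)⟩
    obtain ⟨i, rfl⟩ : ∃ i, m = i + l := ⟨m - l, by lia⟩
    -- Column `i = m - l` has Koszul degree `l`. The primitive lies in `V`-index `k + l + 1`, as
    -- required of a component with `|s| = l + 1`.
    have hz : ∃ y : Finset (Fin p) → R.L i, (∀ s, y s ∈ (R.filt i).F d (k + l + 1)) ∧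
        (∀ s, s.card ≠ l + 1 → y s = 0) ∧
        koszulD n (R.L i) y = ((-1 : ℤ) ^ i) • (c i - fun s => R.ψ i (x (i + 1) s)) := by
      have hsupp : ∀ s : Finset (Fin p), s.card ≠ l →
          (((-1 : ℤ) ^ i) • (c i - fun s => R.ψ i (x (i + 1) s))) s = 0 := fun s hs => by
        rw [Pi.smul_apply, Pi.sub_apply, hcs i s (by lia), h2 (i + 1) s (by lia), map_zero,
          sub_zero, smul_zero]
      refine R.koszul i d (k + l) l _ (fun s => ?_) hsupp ?_ ?_
      · by_cases hs : s.card = l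
        · refine zsmul_mem (sub_mem ?_ (R.ψ_mem i _ _ _ ?_)) _
          · have := hcF i s
            rwa [hs] at this
          · have := h1 (i + 1) s
            rwa [hs] at this
        · rw [hsupp s hs]
          exact zero_mem _
      · rcases l with _ | l
        · exact koszulD_of_card_zero hsupp
        · funext s
          have h5 : R.ψ i (c (i + 1) s) + ((-1 : ℤ) ^ i) • koszulD n (R.L i) (c i) s = 0 :=
            congrFun (congrFun hc i) s
          have h6 : R.ψ (i + 1) (x (i + 2) s) +
            ((-1 : ℤ) ^ i * (-1)) • koszulD n (R.L (i + 1)) (x (i + 1)) s = c (i + 1) s := by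
            rw [← pow_succ]
            exact congrFun (h4 (i + 1) (by lia)) s
          rw [← h6, map_add, map_zsmul] at h5
          have h7 := R.ψ_ψ i (x (i + 2) s)
          rw [h7, zero_add] at h5
          rw [map_zsmul, map_sub, Pi.smul_apply, Pi.sub_apply, koszulD_map, smul_sub, Pi.zero_apply,
            ← h5]
          simp [sub_eq_neg_add]
      · intro hl
        subst hl
        change ((-1 : ℤ) ^ i) • (c i ∅ - R.ψ i (x (i + 1) ∅)) ∈ _
        have : x (i + 1) ∅ = 0 := congrFun h3 ∅
        rw [this, map_zero, sub_zero]
        exact zsmul_mem hc0 _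
    obtain ⟨y, hyF, hys, hy⟩ := hz
    refine ⟨Function.update x i y, fun i' s => ?_, fun i' s hs => ?_, ?_, fun i' hi' => ?_⟩
    · by_cases hi : i' = i
      · subst hi
        rw [Function.update_self]
        by_cases hs : s.card = l + 1
        · rw [hs]
          have := hyF s
          push_cast
          rwa [← add_assoc]
        · rw [hys s hs]
          exact zero_mem _
      · rw [Function.update_of_ne hi]
        exact h1 i' s
    · by_cases hi : i' = i
      · subst hi
        rw [Function.update_self]
        exact hys s (by lia)
      · rw [Function.update_of_ne hi]
        exact h2 i' s hs
    · rw [Function.update_of_ne (by lia), h3]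
    · by_cases hi : i' = i
      · subst hi
        funext s
        rw [totD_update_self, hy, Pi.smul_apply, smul_smul, ← mul_pow]
        simp
      · rw [R.totD_update_of_lt _ _ _ (by lia)]
        exact h4 i' (by lia)

end KoszulResolution

end Total

end

section

variable {n p : ℕ}

/-! ### The quotients of a bifiltered free resolution -/

namespace BifilteredFreeResolution

variable {M : Type u} [AddCommGroup M] [Module (Dxt n p) M] {B : Bifiltration n p M}
  (R : BifilteredFreeResolution B) (k : ℤ)

/-- The Koszul complexes of a bifiltered free resolution are exact. -/
abbrev toKoszulResolution : KoszulResolution B where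
  L := R.L
  filt := R.filt
  koszul i := (R.free i).koszulExact
  ψ := R.ψ
  ε := R.ε
  ψ_mem := R.ψ_mem
  ε_mem := R.ε_mem
  ψ_ψ i := (R.ψ_exact i).apply_apply_eq_zero
  ε_ψ := R.ε_exact.apply_apply_eq_zero
  ψ_exact_F := R.ψ_exact_F
  ε_exact_F := R.ε_exact_F
  ε_surj_F := R.ε_surj_F

theorem memV_empty {m : ℕ} {c : R.toKoszulResolution.TotFam}
    (hc : c ∈ R.toKoszulResolution.totV k m) : c m ∅ ∈ (R.filt m).V k := by
  have := (hc m ∅).1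
  rwa [Finset.card_empty, Nat.cast_zero, add_zero] at this

/-- The projection of a term of the total complex to the cokernel of the Koszul complex. -/
def toQuotLin (m : ℕ) :
    R.toKoszulResolution.totV k m →ₗ[Dx n p]
      (R.filt m).V k ⧸ (tV (R.filt m) k).submoduleOf ((R.filt m).V k) :=
  Submodule.mkQ _ ∘ₗ LinearMap.codRestrict _
    (LinearMap.proj ∅ ∘ₗ LinearMap.proj m ∘ₗ (R.toKoszulResolution.totV k m).subtype)
    (fun c => R.memV_empty k c.2)

theorem quotComplex_d (m : ℕ) (x : (R.filt (m + 1)).V k) :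
    FiltMod.lin ((quotComplex R k).d (m + 1) m)
      (Submodule.mkQ ((tV (R.filt (m + 1)) k).submoduleOf ((R.filt (m + 1)).V k)) x) =
    Submodule.mkQ ((tV (R.filt m) k).submoduleOf ((R.filt m).V k))
      ⟨R.ψ m x.1, resD_memV (R.ψ_mem m) x.2⟩ := by
  have h : (quotComplex R k).d (m + 1) m = quotMap (R.ψ m) (R.ψ_mem m) k :=
    ChainComplex.of_d (fun i => quotX (R.filt i) k) (fun i => quotMap (R.ψ i) (R.ψ_mem i) k) m
  rw [h]
  rfl

/-- The projection of the total complex to the cokernels of the Koszul complexes. -/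
def toQuot : R.toKoszulResolution.totComplex k ⟶ quotComplex R k :=
  ChainComplex.ofHom
    (fun m => FiltMod.ofHom (X := R.toKoszulResolution.totX k m) (Y := quotX (R.filt m) k)
      (R.toQuotLin k m) (fun d c hc => by
        refine ⟨⟨c.1 m ∅, R.memV_empty k c.2⟩, ?_, rfl⟩
        have := hc m ∅
        rwa [Finset.card_empty, Nat.cast_zero, add_zero] at this))
    (fun m => FiltMod.hom_ext fun c => by
      change R.toKoszulResolution.totV k (m + 1) at c
      refine (R.quotComplex_d k m ⟨c.1 (m + 1) ∅, R.memV_empty k c.2⟩).trans ?_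
      refine (Submodule.Quotient.eq _).2 ?_
      change R.ψ m (c.1 (m + 1) ∅) -
        (FiltMod.lin ((R.toKoszulResolution.totComplex k).d (m + 1) m) c :
          R.toKoszulResolution.totV k m).1 m ∅ ∈ tV (R.filt m) k
      rw [R.toKoszulResolution.totComplex_d k m c, KoszulResolution.totD_apply]
      change R.ψ m (c.1 (m + 1) ∅) - (R.ψ m (c.1 (m + 1) ∅) + _) ∈ _
      -- What remains is the Koszul part of the differential, which dies in the cokernel.
      rw [sub_add_cancel_left]
      refine neg_mem (zsmul_mem (koszulD_empty_mem_tV fun i => ?_) _)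
      exact (c.2 m {i}).1)

/-- The complex of the cokernels is quasi-isomorphic to the total complex. -/
theorem toQuot_strictQuasiIso : StrictQuasiIso (R.toQuot k) where
  surj d j y hy := by
    obtain ⟨x, hx, rfl⟩ := hy
    let c : R.toKoszulResolution.TotFam := Function.update 0 j (Pi.single ∅ x.1)
    have hcj : c j = Pi.single ∅ x.1 := Function.update_self _ _ _
    have hcF : ∀ i s, c i s ∈ (R.filt i).F d (k + s.card) := by
      intro i s
      by_cases hi : i = j
      · subst hi
        rw [hcj]
        by_cases hs : s = ∅
        · subst hs
          rw [Pi.single_eq_same, Finset.card_empty, Nat.cast_zero, add_zero]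
          exact hx
        · rw [Pi.single_eq_of_ne hs]
          exact zero_mem _
      · rw [show c i = 0 from Function.update_of_ne hi _ _]
        exact zero_mem _
    have hcs : ∀ i s, i + s.card ≠ j → c i s = 0 := by
      intro i s hs
      by_cases hi : i = j
      · subst hi
        rw [hcj, Pi.single_eq_of_ne]
        rintro rfl
        exact hs (by simp)
      · rw [show c i = 0 from Function.update_of_ne hi _ _]
        rfl
    refine ⟨(⟨c, fun i s => ⟨⟨d, hcF i s⟩, hcs i s⟩⟩ : R.toKoszulResolution.totV k j), hcF, ?_⟩
    refine congrArg (Submodule.mkQ _) (Subtype.ext ?_)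
    change c j ∅ = x.1
    rw [hcj, Pi.single_eq_same]
  ker d j c hc hfc hdc := by
    change R.toKoszulResolution.totV k j at c
    have h0 : c.1 j ∅ ∈ tV (R.filt j) k := by
      have h1 : R.toQuotLin k j c = 0 := hfc
      exact (Submodule.Quotient.mk_eq_zero ((tV (R.filt j) k).submoduleOf ((R.filt j).V k))).1 h1
    obtain ⟨x, hx1, hx2, hx3, hx4⟩ := R.toKoszulResolution.exists_totD_eq_of_mem_tIm k c.1 hc
      (fun i s => (c.2 i s).2) (tV_le_tIm _ _ h0) (R.toKoszulResolution.totD_eq_zero k c hdc)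
    refine ⟨(⟨x, fun i s => ⟨⟨d, hx1 i s⟩, hx2 i s⟩⟩ : R.toKoszulResolution.totV k (j + 1)), hx1,
      ?_, Subtype.ext ?_⟩
    · refine (Submodule.Quotient.mk_eq_zero _).2 ?_
      change x (j + 1) ∅ ∈ tV (R.filt (j + 1)) k
      rw [hx3]
      exact zero_mem _
    · exact (R.toKoszulResolution.totComplex_d k j _).trans hx4

/-- The total complex is the roof over the two complexes; it must have the property `S` as well. -/
theorem isoDF {S : ObjectProperty (CochainComplex (FiltMod.{u} n p) ℤ)}
    (hK : S (toCochain (koszulComplex B k)))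
    (hT : S (toCochain (R.toKoszulResolution.totComplex k)))
    (hQ : S (toCochain (quotComplex R k))) :
    IsoDF S (toCochain (koszulComplex B k)) (toCochain (quotComplex R k)) :=
  ((R.toKoszulResolution.toKoszul_strictQuasiIso k).isoDF hT hK).symm.trans
    ((R.toQuot_strictQuasiIso k).isoDF hT hQ)

/-- If `L_i = 0` for `i > l`, the total complex vanishes above degree `l + p`, so the roof stays
among bounded complexes. -/
theorem isoDF_bounded (h : ∃ l : ℕ, ∀ i, l < i → Subsingleton (R.L i)) :
    IsoDF (bounded n p) (toCochain (koszulComplex B k)) (toCochain (quotComplex R k)) := by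
  obtain ⟨l, hl⟩ := h
  have hcard : ∀ s : Finset (Fin p), s.card ≤ p := fun s => by
    simpa using s.card_le_univ
  refine R.isoDF k (bounded_toCochain _ p fun j hj => ?_) (bounded_toCochain _ (l + p) fun j hj => ?_)
    (bounded_toCochain _ l fun j hj => ?_)
  · have h0 : ∀ c : koszulV B k j, c = 0 := fun c => Subtype.ext (funext fun s =>
      (c.2 s).2 (by have := hcard s; lia))
    exact ⟨fun a b => (h0 a).trans (h0 b).symm⟩
  · have h0 : ∀ c : R.toKoszulResolution.totV k j, c = 0 := fun c =>
      Subtype.ext (funext fun i => funext fun s => by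
        by_cases hi : l < i
        · have := hl i hi
          exact Subsingleton.elim (α := R.L i) _ _
        · exact (c.2 i s).2 (by have := hcard s; lia))
    exact ⟨fun a b => (h0 a).trans (h0 b).symm⟩
  · have := hl j hj
    have h0 : ∀ c : (R.filt j).V k ⧸ (tV (R.filt j) k).submoduleOf ((R.filt j).V k), c = 0 := by
      intro c
      obtain ⟨x, rfl⟩ := Submodule.mkQ_surjective _ c
      rw [show x = 0 from Subtype.ext (Subsingleton.elim (α := R.L j) _ _), map_zero]
    exact ⟨fun a b => (h0 a).trans (h0 b).symm⟩

end BifilteredFreeResolution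

end

section

/-! ### The restriction, computed by total complexes -/

theorem module_chain_quasiIso_of_surjective {A : Type} [Ring A]
    {K L : ChainComplex (ModuleCat.{u} A) ℕ} (f : K ⟶ L)
    (hsurj : ∀ j, Function.Surjective (f.f j))
    (hker : ∀ j, ∀ x : K.X j, f.f j x = 0 → (∀ i, K.d j i x = 0) →
      ∃ z : K.X (j + 1), f.f (j + 1) z = 0 ∧ K.d (j + 1) j z = x) : QuasiIso f := by
  have hcomm : ∀ i j (x : K.X i), f.f j (K.d i j x) = L.d i j (f.f i x) := fun i j x =>
    (ConcreteCategory.congr_hom (f.comm i j) x).symm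
  have hdd : ∀ i j k (x : K.X i), K.d j k (K.d i j x) = 0 := fun i j k x =>
    ConcreteCategory.congr_hom (K.d_comp_d i j k) x
  refine module_chain_quasiIso_of_elements f (fun j x hx y hy => ?_) fun j y hy => ?_
  · obtain ⟨y, rfl⟩ := hsurj _ y
    obtain ⟨z, -, hz⟩ := hker j (x - K.d (j + 1) j y)
      (by rw [map_sub, hcomm, hy, sub_self])
      fun i => by rw [map_sub, hx, hdd, sub_zero]
    exact ⟨y + z, by rw [map_add, hz]; abel⟩
  · obtain ⟨x, rfl⟩ := hsurj _ y
    rcases j with _ | j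
    · refine ⟨x, fun i => ?_, 0, by rw [sub_self, map_zero]⟩
      rw [K.shape 0 i (by simp)]
      rfl
    · obtain ⟨z, hfz, hz⟩ := hker j (K.d (j + 1) j x) (by rw [hcomm, hy]) fun i => hdd _ _ _ _
      refine ⟨x - z, fun i => ?_, 0, by rw [map_sub, hfz, sub_zero, sub_self, map_zero]⟩
      by_cases hi : i = j
      · subst hi
        rw [map_sub, hz, sub_self]
      · rw [K.shape (j + 1) i (by simpa using fun h => hi h)]
        rfl

variable {n p : ℕ}

section

variable (M : Type u) [AddCommGroup M] [Module (Dxt n p) M]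

/-- The trivial bifiltration. -/
def topBifiltration : Bifiltration n p M where
  F _ _ := ⊤
  exhaustive _ := ⟨0, 0, trivial⟩
  mono_left _ _ := le_rfl
  mono_right _ _ := le_rfl
  smul_mem _ _ := trivial

variable {M}

theorem Bifiltration.exists_mem_of_finite (B : Bifiltration n p M) {ι : Type*} [Finite ι]
    (c : ι → M) : ∃ d k, ∀ s, c s ∈ B.F d k := by
  cases nonempty_fintype ι
  choose d k h using fun s => B.exhaustive (c s)
  rcases isEmpty_or_nonempty ι with hι | hι
  · exact ⟨0, 0, fun s => isEmptyElim s⟩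
  · exact ⟨Finset.univ.sup' Finset.univ_nonempty d, Finset.univ.sup' Finset.univ_nonempty k,
      fun s => B.mono_d (Finset.le_sup' d (Finset.mem_univ s)) _
        (B.mono_k _ (Finset.le_sup' k (Finset.mem_univ s)) (h s))⟩

/-- A Koszul chain has finitely many components, which lie in a common `F_{d,k}`; exactness there
gives exactness without filtrations. -/
theorem Bifiltration.KoszulExact.top {B : Bifiltration n p M} (hB : B.KoszulExact) :
    (topBifiltration (n := n) (p := p) M).KoszulExact := by
  intro _ _ j c _ hsupp hc h0
  obtain ⟨d, k, h⟩ := B.exists_mem_of_finite c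
  obtain ⟨y, -, hy⟩ := hB d k j c h hsupp hc h0
  exact ⟨y, fun _ => trivial, hy⟩

/-! ### The tensor product with `D_{x,t} / ∑ t_j D_{x,t}` as the quotient `M / ∑ t_j M` -/

variable (M) in
/-- The map `m ↦ 1 ⊗ m`. -/
def toRestr : M →ₗ[Dx n p] Restr n p M where
  toFun m := Restr.mk M (Transfer.mk 1) m
  map_add' x y := congrArg (balance (n := n) (p := p) M).mkQ (TensorProduct.tmul_add _ x y)
  map_smul' P m := by
    refine Eq.symm ((Submodule.Quotient.eq (balance (n := n) (p := p) M)).2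
      (Submodule.subset_span ⟨1, (P : Dxt n p), m, ?_⟩))
    refine congrArg₂ (· - ·) ?_ rfl
    rw [one_mul]
    change (P • Transfer.mk (1 : Dxt n p)) ⊗ₜ[ℤ] m = _
    rw [← map_smul]
    refine congrArg (fun a : Dxt n p => Transfer.mk a ⊗ₜ[ℤ] m) ?_
    exact mul_one (P : Dxt n p)

theorem Restr.mk_mk (a : Dxt n p) (m : M) :
    Restr.mk M (Transfer.mk a) m = toRestr (n := n) (p := p) M (a • m) :=
  (Submodule.Quotient.eq (balance (n := n) (p := p) M)).2
    (Submodule.subset_span ⟨1, a, m, by rw [one_mul]⟩)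

theorem toRestr_surjective : Function.Surjective (toRestr (n := n) (p := p) M) := by
  intro z
  obtain ⟨z, rfl⟩ := Submodule.mkQ_surjective (balance (n := n) (p := p) M) z
  induction z using TensorProduct.induction_on with
  | zero => exact ⟨0, (map_zero _).trans (map_zero _).symm⟩
  | tmul a m =>
    obtain ⟨a, rfl⟩ := Submodule.mkQ_surjective (tIdeal n p) a
    exact ⟨a • m, (Restr.mk_mk a m).symm⟩
  | add x y hx hy =>
    obtain ⟨x', hx⟩ := hx
    obtain ⟨y', hy⟩ := hy
    exact ⟨x' + y', (map_add _ _ _).trans ((congrArg₂ _ hx hy).trans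
      (map_add ((balance (n := n) (p := p) M).mkQ) x y).symm)⟩

theorem toRestr_tt_smul (j : Fin p) (m : M) :
    toRestr (n := n) (p := p) M ((tt j : Dxt n p) • m) = 0 := by
  rw [← Restr.mk_mk]
  have h : Transfer.mk (tt j : Dxt n p) = 0 :=
    (Submodule.Quotient.mk_eq_zero (tIdeal n p)).2
      (Submodule.mem_iSup_of_mem j ⟨1, mul_one (tt j : Dxt n p)⟩)
  rw [h]
  exact (congrArg (balance (n := n) (p := p) M).mkQ (TensorProduct.zero_tmul _ m)).trans (map_zero _)

/-- The action of an operator on an element, as a linear map of the operator. -/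
def evalLin (m : M) : Dxt n p →ₗ[Dx n p] M where
  toFun a := a • m
  map_add' a b := add_smul a b m
  map_smul' P a := mul_smul (P : Dxt n p) a m

/-- The action of the transfer module. -/
def transferEval (m : M) : Transfer n p →ₗ[Dx n p] M ⧸ tIm n p M :=
  Submodule.mapQ (tIdeal n p) (tIm n p M) (evalLin m) (by
    refine iSup_le fun j => ?_
    rintro _ ⟨a, rfl⟩
    exact Submodule.mem_iSup_of_mem j ⟨a • m, (mul_smul (tt j : Dxt n p) a m).symm⟩)

theorem transferEval_mk (a : Dxt n p) (m : M) :
    transferEval m (Transfer.mk a) = (tIm n p M).mkQ (a • m) := rfl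

variable (M) in
/-- The action of the transfer module, as a linear map. -/
def transferAct : Transfer n p →ₗ[Dx n p] M →ₗ[ℤ] M ⧸ tIm n p M where
  toFun a := AddMonoidHom.toIntLinearMap
    { toFun := fun m => transferEval m a
      map_zero' := by
        obtain ⟨a, rfl⟩ := Submodule.mkQ_surjective (tIdeal n p) a
        exact (transferEval_mk a (0 : M)).trans (by rw [smul_zero, map_zero])
      map_add' := fun x y => by
        obtain ⟨a, rfl⟩ := Submodule.mkQ_surjective (tIdeal n p) a
        exact (transferEval_mk a (x + y)).trans (by rw [smul_add, map_add]; rfl) }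
  map_add' a b := LinearMap.ext fun m => map_add (transferEval m) a b
  map_smul' P a := LinearMap.ext fun m => map_smul (transferEval m) P a

/-- The balanced map `a ⊗ m ↦ [a m]` to `M / ∑ t_j M` sends `1 ⊗ m` to the class of `m`. With
`toRestr_surjective` and `toRestr_tt_smul` it identifies the tensor product with `M / ∑ t_j M`. -/
theorem mem_tIm_of_toRestr {m : M} (h : toRestr (n := n) (p := p) M m = 0) : m ∈ tIm n p M := by
  let φ : Transfer n p ⊗[ℤ] M →ₗ[Dx n p] M ⧸ tIm n p M :=
    TensorProduct.AlgebraTensorModule.lift (transferAct M)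
  have hφ : balance (n := n) (p := p) M ≤ LinearMap.ker φ := by
    refine Submodule.span_le.2 ?_
    rintro _ ⟨a, r, m, rfl⟩
    change φ _ = 0
    rw [map_sub]
    refine sub_eq_zero.2 ?_
    change (tIm n p M).mkQ ((a * r) • m) = (tIm n p M).mkQ (a • r • m)
    rw [mul_smul]
  have h1 : Transfer.mk (1 : Dxt n p) ⊗ₜ[ℤ] m ∈ balance (n := n) (p := p) M :=
    (Submodule.Quotient.mk_eq_zero _).1 h
  have h2 : (tIm n p M).mkQ ((1 : Dxt n p) • m) = 0 := hφ h1
  rw [one_smul] at h2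
  exact (Submodule.Quotient.mk_eq_zero _).1 h2

end

namespace BifilteredFreeResolution

variable {M : Type u} [AddCommGroup M] [Module (Dxt n p) M] {B : Bifiltration n p M}
  (R : BifilteredFreeResolution B)

/-- The resolution with the trivial bifiltrations. -/
abbrev topResolution : KoszulResolution (topBifiltration (n := n) (p := p) M) where
  L := R.L
  filt i := topBifiltration (R.L i)
  koszul i := (R.free i).koszulExact.top
  ψ := R.ψ
  ε := R.ε
  ψ_mem _ _ _ _ _ := trivial
  ε_mem _ _ _ _ := trivial
  ψ_ψ i := (R.ψ_exact i).apply_apply_eq_zero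
  ε_ψ := R.ε_exact.apply_apply_eq_zero
  ψ_exact_F i _ _ m _ hm := ((R.ψ_exact i m).1 hm).imp fun _ h => ⟨trivial, h⟩
  ε_exact_F _ _ m _ hm := ((R.ε_exact m).1 hm).imp fun _ h => ⟨trivial, h⟩
  ε_surj_F _ _ m _ := (R.ε_surj m).imp fun _ h => ⟨trivial, h⟩

/-- The complex of `D_{x,t}`-modules underlying a resolution. -/
def toComplex : ChainComplex (ModuleCat.{u} (Dxt n p)) ℕ :=
  ChainComplex.of (fun i => ModuleCat.of _ (R.L i)) (fun i => ModuleCat.ofHom (R.ψ i))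
    (fun i => ModuleCat.hom_ext (LinearMap.ext (R.ψ_exact i).apply_apply_eq_zero))

theorem toComplex_d (i : ℕ) : R.toComplex.d (i + 1) i = ModuleCat.ofHom (R.ψ i) :=
  ChainComplex.of_d (fun i => ModuleCat.of (Dxt n p) (R.L i)) (fun i => ModuleCat.ofHom (R.ψ i)) i

/-- The augmentation of the complex underlying a resolution. -/
def toComplexπ : R.toComplex ⟶ (ChainComplex.single₀ _).obj (ModuleCat.of (Dxt n p) M) :=
  (ChainComplex.toSingle₀Equiv R.toComplex (ModuleCat.of (Dxt n p) M)).symm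
    ⟨ModuleCat.ofHom R.ε, by
      rw [R.toComplex_d]
      exact ModuleCat.hom_ext (LinearMap.ext R.ε_exact.apply_apply_eq_zero)⟩

theorem toComplexπ_f_zero : R.toComplexπ.f 0 = ModuleCat.ofHom R.ε :=
  ChainComplex.toSingle₀Equiv_symm_apply_f_zero _ _

theorem quasiIso_toComplexπ : QuasiIso R.toComplexπ := by
  have hz : ∀ j, Subsingleton (((ChainComplex.single₀ _).obj (ModuleCat.of (Dxt n p) M)).X (j + 1)) :=
    fun j => ModuleCat.subsingleton_of_isZero
      (HomologicalComplex.isZero_single_obj_X (ComplexShape.down ℕ) 0 _ (j + 1) (by simp))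
  refine module_chain_quasiIso_of_elements _ (fun j x hx y hy => ?_) fun j y hy => ?_
  · have := hz j
    rw [Subsingleton.elim y 0, map_zero] at hy
    rw [R.toComplex_d]
    rcases j with _ | j
    · rw [toComplexπ_f_zero] at hy
      exact (R.ε_exact x).1 hy
    · have hx' := hx j
      rw [R.toComplex_d] at hx'
      exact (R.ψ_exact j x).1 hx'
  · rcases j with _ | j
    · obtain ⟨x, hx⟩ := R.ε_surj y
      refine ⟨x, fun i => ?_, 0, ?_⟩
      · rw [R.toComplex.shape 0 i (by simp)]
        rfl
      · rw [toComplexπ_f_zero, map_zero]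
        exact sub_eq_zero.2 hx.symm
    · have := hz j
      exact ⟨0, fun i => map_zero _, 0, Subsingleton.elim _ _⟩

/-- The projective resolution given by a bifiltered free resolution. -/
def toProjectiveResolution : ProjectiveResolution (ModuleCat.of (Dxt n p) M) where
  complex := R.toComplex
  projective i := by
    obtain ⟨r, e, -⟩ := R.free i
    exact ModuleCat.projective_of_free (M := ModuleCat.of (Dxt n p) (R.L i)) e
  π := R.toComplexπ
  quasiIso := R.quasiIso_toComplexπ

theorem restriction_d (i : ℕ) (x : R.L (i + 1)) :
    (restriction R.toProjectiveResolution).d (i + 1) i (toRestr (R.L (i + 1)) x) =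
      toRestr (n := n) (p := p) (R.L i) (R.ψ i x) := by
  change (restrFunctor n p).map (R.toComplex.d (i + 1) i) (toRestr (R.L (i + 1)) x) = _
  rw [R.toComplex_d]
  rfl

/-- The projection of the total complex to the restriction. -/
def toRestriction (k : ℤ) :
    unfilt (R.topResolution.totComplex k) ⟶ restriction R.toProjectiveResolution :=
  ChainComplex.ofHom
    (fun m => ModuleCat.ofHom (X := R.topResolution.totV k m) (Y := Restr n p (R.L m))
      (toRestr (R.L m) ∘ₗ LinearMap.proj ∅ ∘ₗ LinearMap.proj m ∘ₗ
        (R.topResolution.totV k m).subtype))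
    (fun m => ModuleCat.hom_ext (LinearMap.ext fun c => by
      change R.topResolution.totV k (m + 1) at c
      refine (R.restriction_d m (c.1 (m + 1) ∅)).trans ?_
      change _ = toRestr (R.L m)
        ((FiltMod.lin ((R.topResolution.totComplex k).d (m + 1) m) c :
          R.topResolution.totV k m).1 m ∅)
      rw [R.topResolution.totComplex_d k m c, KoszulResolution.totD_apply]
      change _ = toRestr (R.L m) (R.ψ m (c.1 (m + 1) ∅) + _)
      rw [map_add, map_zsmul, koszulD_empty, map_sum,
        Finset.sum_eq_zero fun i _ => toRestr_tt_smul i _, smul_zero, add_zero]))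

/-- The argument of `toQuot_strictQuasiIso` for trivial bifiltrations: the cokernel of the Koszul
complex of `L_i` is `L_i / ∑ t_j L_i`, the term of the restriction. -/
theorem quasiIso_toRestriction (k : ℤ) : QuasiIso (R.toRestriction k) := by
  refine module_chain_quasiIso_of_surjective _ (fun j y => ?_) fun j c hfc hdc => ?_
  · obtain ⟨x, hx⟩ := toRestr_surjective (M := R.L j) y
    let c : R.topResolution.TotFam := Function.update 0 j (Pi.single ∅ x)
    have hcj : c j = Pi.single ∅ x := Function.update_self _ _ _
    have hcs : ∀ i s, i + s.card ≠ j → c i s = 0 := by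
      intro i s hs
      by_cases hi : i = j
      · subst hi
        rw [hcj, Pi.single_eq_of_ne]
        rintro rfl
        exact hs (by simp)
      · rw [show c i = 0 from Function.update_of_ne hi _ _]
        rfl
    refine ⟨(⟨c, fun i s => ⟨⟨0, trivial⟩, hcs i s⟩⟩ : R.topResolution.totV k j), ?_⟩
    change toRestr (R.L j) (c j ∅) = y
    rw [hcj, Pi.single_eq_same, hx]
  · change R.topResolution.totV k j at c
    have h0 : c.1 j ∅ ∈ tIm n p (R.L j) := mem_tIm_of_toRestr hfc
    obtain ⟨x, hx1, hx2, hx3, hx4⟩ := R.topResolution.exists_totD_eq_of_mem_tIm k (d := 0) c.1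
      (fun _ _ => trivial) (fun i s => (c.2 i s).2) h0 (R.topResolution.totD_eq_zero k c hdc)
    refine ⟨(⟨x, fun i s => ⟨⟨0, hx1 i s⟩, hx2 i s⟩⟩ : R.topResolution.totV k (j + 1)), ?_,
      Subtype.ext ?_⟩
    · change toRestr (R.L (j + 1)) (x (j + 1) ∅) = 0
      rw [hx3, map_zero]
    · exact (R.topResolution.totComplex_d k j _).trans hx4

/-- The restriction is represented by the Koszul complex. -/
theorem nonempty_iso_restriction [HasDerivedCategory.{w} (ModuleCat.{u} (Dx n p))]
    (R : BifilteredFreeResolution B) (k : ℤ)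
    (P : ProjectiveResolution (ModuleCat.of (Dxt n p) M)) :
    Nonempty (DerivedCategory.Q.obj
        (toCochain (unfilt (koszulComplex (topBifiltration (n := n) (p := p) M) k))) ≅
      DerivedCategory.Q.obj (toCochain (restriction P))) := by
  obtain ⟨i₁⟩ := nonempty_iso_of_quasiIso _
    (R.topResolution.toKoszul_strictQuasiIso k).quasiIso_unfilt
  obtain ⟨i₂⟩ := nonempty_iso_of_quasiIso _ (R.quasiIso_toRestriction k)
  -- The free resolution and `P` are homotopy equivalent, and additive functors preserve homotopy
  -- equivalences.
  obtain ⟨i₃⟩ := nonempty_iso_of_quasiIso _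
    ((restrFunctor n p).mapHomotopyEquiv
      (ProjectiveResolution.homotopyEquiv R.toProjectiveResolution P)).quasiIso_hom
  exact ⟨i₁.symm ≪≫ i₂ ≪≫ i₃⟩

end BifilteredFreeResolution

end

section

/-! ### Polynomials in the Euler operator -/

section Aeval

variable {A : Type*} [Ring A] [Algebra ℂ A]

theorem aeval_mul_of_semiconj {T T' x : A} (h : T * x = x * T') (q : Polynomial ℂ) :
    Polynomial.aeval T q * x = x * Polynomial.aeval T' q := by
  induction q using Polynomial.induction_on with
  | C a => rw [Polynomial.aeval_C, Polynomial.aeval_C, Algebra.commutes]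
  | add q r hq hr => rw [map_add, map_add, add_mul, mul_add, hq, hr]
  | monomial m a ih =>
    rw [pow_succ, ← mul_assoc, map_mul, map_mul _ _ Polynomial.X, Polynomial.aeval_X,
      Polynomial.aeval_X, mul_assoc, h, ← mul_assoc, ih, mul_assoc]

/-- Division by `X - c`. It is applied with `T - c` equal to `θ + |s|`, which Cartan's formula
controls, or to `θ + p = ∑ ∂_{t_j} t_j`. -/
theorem aeval_eq_eval_add (T : A) (c : ℤ) (q : Polynomial ℂ) :
    Polynomial.aeval T q = algebraMap ℂ A (q.eval (c : ℂ)) +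
      (T - (c : A)) * Polynomial.aeval T (q /ₘ (Polynomial.X - Polynomial.C (c : ℂ))) := by
  conv_lhs => rw [← Polynomial.modByMonic_add_div q (Polynomial.X - Polynomial.C (c : ℂ)),
    Polynomial.modByMonic_X_sub_C_eq_C_eval]
  rw [map_add, map_mul, map_sub, Polynomial.aeval_C, Polynomial.aeval_X, Polynomial.aeval_C,
    map_intCast]

theorem aeval_smul_mem {M : Type*} [AddCommGroup M] [Module A M] {S : AddSubgroup M} {T : A}
    (hc : ∀ c : ℂ, ∀ u ∈ S, algebraMap ℂ A c • u ∈ S) (hT : ∀ u ∈ S, T • u ∈ S)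
    (q : Polynomial ℂ) : ∀ u ∈ S, Polynomial.aeval T q • u ∈ S := by
  induction q using Polynomial.induction_on with
  | C a => rw [Polynomial.aeval_C]; exact hc a
  | add q r hq hr =>
    intro u hu
    rw [map_add, add_smul]
    exact add_mem (hq u hu) (hr u hu)
  | monomial m a ih =>
    intro u hu
    rw [pow_succ, ← mul_assoc, map_mul, Polynomial.aeval_X, mul_smul]
    exact ih _ (hT u hu)

end Aeval

variable {n p : ℕ}

theorem algebraMap_eq_fn (c : ℂ) : algebraMap ℂ (Dxt n p) c = fn (algebraMap ℂ (Oxt n p) c) :=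
  Subtype.ext ((Algebra.lmul ℂ (ConvSeries (Fin n ⊕ Fin p))).commutes c).symm

theorem aeval_theta_tt (q : Polynomial ℂ) (c : ℤ) (j : Fin p) :
    Polynomial.aeval (theta n p + (c : Dxt n p)) q * tt j =
      tt j * Polynomial.aeval (theta n p + ((c + 1 : ℤ) : Dxt n p)) q := by
  refine aeval_mul_of_semiconj ?_ q
  rw [add_mul, theta_tt, Int.cast_comm, ← mul_add]
  push_cast
  congr 1
  abel

theorem aeval_theta_dd (q : Polynomial ℂ) (c : ℤ) (j : Fin p) :
    Polynomial.aeval (theta n p + ((c + 1 : ℤ) : Dxt n p)) q * dd (Sum.inr j) =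
      dd (Sum.inr j) * Polynomial.aeval (theta n p + (c : Dxt n p)) q := by
  refine aeval_mul_of_semiconj ?_ q
  rw [add_mul, theta_dd_inr, Int.cast_comm, ← mul_add]
  push_cast
  congr 1
  abel

/-- With the `t_j` acting first, `θ + p` visibly maps `V_{k+1}` into `∑ ∂_{t_j} V_k`. -/
theorem theta_add_natCast : theta n p + (p : Dxt n p) = ∑ j, dd (Sum.inr j) * tt j := by
  rw [Finset.sum_congr rfl fun j _ => dd_tt_self j, Finset.sum_add_distrib, theta]
  simp

theorem dd_inr_mem_FVD (j : Fin p) : (dd (Sum.inr j) : Dxt n p) ∈ FVD n p 1 1 := by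
  rw [mem_FVD_iff]
  intro γ e he
  classical
  rw [← dPow_single, ← one_mul (dPow _), ← fn_one, coeffs_fn_dPow, Finsupp.single_apply] at he
  split_ifs at he with h
  · subst h
    simp only [DExp.ord, DExp.tord, DExp.single, Pi.zero_apply, Finset.sum_const_zero, zero_add,
      Finset.sum_pi_single', Finset.mem_univ, if_true]
    lia
  · exact absurd (map_zero _) he

theorem fn_mem_FVD_zero (a : Oxt n p) : fn a ∈ FVD n p 0 0 := by
  rw [mem_FVD_iff]
  intro γ e he
  classical
  rw [← mul_one (fn a), ← dPow_zero, coeffs_fn_dPow, Finsupp.single_apply] at he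
  split_ifs at he with h
  · subst h
    simp [DExp.ord, DExp.tord]
  · exact absurd (map_zero _) he

/-! ### Stable subgroups and Bernstein polynomials for the `V`-filtration -/

section

variable {M : Type u} [AddCommGroup M] [Module (Dxt n p) M]

namespace Bifiltration

variable (B : Bifiltration n p M)

theorem V_mono {k l : ℤ} (h : k ≤ l) : B.V k ≤ B.V l :=
  fun _ ⟨d, hd⟩ => ⟨d, B.mono_k d h hd⟩

variable {B}

theorem smul_mem_V {d k k' l : ℤ} {P : Dxt n p} (hP : P ∈ FVD n p d k) {u : M} (hu : u ∈ B.V k')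
    (h : k + k' = l) : P • u ∈ B.V l := by
  obtain ⟨d', hd⟩ := hu
  subst h
  exact ⟨_, B.smul_mem hP hd⟩

theorem dd_smul_mem_V (j : Fin p) {k l : ℤ} {u : M} (hu : u ∈ B.V k) (h : k + 1 = l) :
    (dd (Sum.inr j) : Dxt n p) • u ∈ B.V l :=
  smul_mem_V (dd_inr_mem_FVD j) hu (by lia)

theorem tt_smul_mem_V (j : Fin p) {k l : ℤ} {u : M} (hu : u ∈ B.V k) (h : k = l + 1) :
    (tt j : Dxt n p) • u ∈ B.V l :=
  smul_mem_V (tt_mem_FVD j) hu (by lia)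

end Bifiltration

/-- The subgroups that are stable under functions, derivations along `x` and the Euler operator. -/
structure IsStable (S : AddSubgroup M) : Prop where
  fn_smul_mem : ∀ (a : Oxt n p), ∀ u ∈ S, fn a • u ∈ S
  dd_smul_mem : ∀ (i : Fin n), ∀ u ∈ S, (dd (Sum.inl i) : Dxt n p) • u ∈ S
  theta_smul_mem : ∀ u ∈ S, theta n p • u ∈ S

theorem IsStable.aeval_smul_mem {S : AddSubgroup M} (hS : IsStable (n := n) (p := p) S)
    (q : Polynomial ℂ) (c : ℤ) : ∀ u ∈ S,
      Polynomial.aeval (theta n p + (c : Dxt n p)) q • u ∈ S := by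
  refine DMod.aeval_smul_mem (fun c u hu => ?_) (fun u hu => ?_) q
  · rw [algebraMap_eq_fn]
    exact hS.fn_smul_mem _ u hu
  · rw [add_smul, Int.cast_smul_eq_zsmul]
    exact add_mem (hS.theta_smul_mem u hu) (zsmul_mem hu c)

theorem IsStable.mem_of_algebraMap_smul_mem {S : AddSubgroup M}
    (hS : IsStable (n := n) (p := p) S) {c : ℂ} (hc : c ≠ 0) {u : M}
    (h : algebraMap ℂ (Dxt n p) c • u ∈ S) : u ∈ S := by
  have := hS.fn_smul_mem (algebraMap ℂ _ c⁻¹) _ h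
  rwa [← algebraMap_eq_fn, ← mul_smul, ← map_mul, inv_mul_cancel₀ hc, map_one, one_smul] at this

theorem Bifiltration.isStable_V (B : Bifiltration n p M) (k : ℤ) :
    IsStable (n := n) (p := p) (B.V k).toAddSubgroup where
  fn_smul_mem a _ hu := Bifiltration.smul_mem_V (fn_mem_FVD_zero a) hu (zero_add k)
  dd_smul_mem i _ hu := Bifiltration.smul_mem_V (dd_mem_FVD i) hu (zero_add k)
  theta_smul_mem u hu := by
    rw [theta, Finset.sum_smul]
    refine sum_mem fun j _ => ?_
    rw [mul_smul]
    exact tt_smul_mem_V j (dd_smul_mem_V j hu rfl) rfl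

/-- The subgroup `S + ∑_j ∂_{t_j} S`. -/
def spread (n p : ℕ) [Module (Dxt n p) M] (S : AddSubgroup M) : AddSubgroup M :=
  S ⊔ ⨆ j : Fin p, S.map (DistribSMul.toAddMonoidHom M (dd (Sum.inr j) : Dxt n p))

theorem le_spread (S : AddSubgroup M) : S ≤ spread n p S := le_sup_left

theorem dd_smul_mem_spread {S : AddSubgroup M} (j : Fin p) {u : M} (hu : u ∈ S) :
    (dd (Sum.inr j) : Dxt n p) • u ∈ spread n p S :=
  (le_iSup (fun j : Fin p => S.map (DistribSMul.toAddMonoidHom M (dd (Sum.inr j) : Dxt n p))) j).trans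
    le_sup_right ⟨u, hu, rfl⟩

theorem spread_smul_mem {S T : AddSubgroup M} (P : Dxt n p) (h : ∀ u ∈ S, P • u ∈ T)
    (hd : ∀ j, ∀ u ∈ S, P • (dd (Sum.inr j) : Dxt n p) • u ∈ T) : ∀ u ∈ spread n p S, P • u ∈ T := by
  suffices h : spread n p S ≤ T.comap (DistribSMul.toAddMonoidHom M P) from fun u hu => h hu
  refine sup_le h (iSup_le fun j => ?_)
  rintro _ ⟨u, hu, rfl⟩
  exact hd j u hu

theorem IsStable.spread {S : AddSubgroup M} (hS : IsStable (n := n) (p := p) S) :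
    IsStable (n := n) (p := p) (spread n p S) where
  fn_smul_mem a := spread_smul_mem _ (fun u hu => le_spread S (hS.fn_smul_mem a u hu))
    fun j u hu => by
      have h : fn a * dd (Sum.inr j) = dd (Sum.inr j) * fn a - fn (pd (Sum.inr j) a) := by
        rw [dd_fn, add_sub_cancel_right]
      rw [← mul_smul, h, sub_smul, mul_smul]
      exact sub_mem (dd_smul_mem_spread j (hS.fn_smul_mem a u hu))
        (le_spread S (hS.fn_smul_mem _ u hu))
  dd_smul_mem i := spread_smul_mem _ (fun u hu => le_spread S (hS.dd_smul_mem i u hu))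
    fun j u hu => by
      rw [← mul_smul, dd_comm, mul_smul]
      exact dd_smul_mem_spread j (hS.dd_smul_mem i u hu)
  theta_smul_mem := spread_smul_mem _ (fun u hu => le_spread S (hS.theta_smul_mem u hu))
    fun j u hu => by
      rw [← mul_smul, theta_dd_inr, mul_smul, sub_smul, one_smul]
      exact dd_smul_mem_spread j (sub_mem (hS.theta_smul_mem u hu) hu)

/-- Since `q(θ + c + 1) ∂_{t_j} = ∂_{t_j} q(θ + c)`, a Bernstein relation for `S` passes to `S + ∑
∂_{t_j} S` with the shift increased by one. -/
theorem aeval_smul_mem_of_mem_spread {S S' : AddSubgroup M}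
    (hS : IsStable (n := n) (p := p) S) (hd : ∀ j, ∀ u ∈ S', (dd (Sum.inr j) : Dxt n p) • u ∈ S)
    {q : Polynomial ℂ} {c : ℤ}
    (h : ∀ u ∈ S, Polynomial.aeval (theta n p + (c : Dxt n p)) q • u ∈ S') :
    ∀ u ∈ spread n p S, Polynomial.aeval (theta n p + ((c + 1 : ℤ) : Dxt n p)) q • u ∈ S :=
  spread_smul_mem _ (hS.aeval_smul_mem q (c + 1)) fun j u hu => by
    rw [← mul_smul, aeval_theta_dd, mul_smul]
    exact hd j _ (h u hu)

variable {B : Bifiltration n p M}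

/-- The union of the iterates contains the generating set `V_k` and is stable under functions and
all derivations, hence it is everything. -/
theorem mem_iterate_spread {k : ℤ} (hgen : Submodule.span (Dxt n p) (B.V k : Set M) = ⊤) (x : M) :
    ∃ r, x ∈ (spread n p)^[r] (B.V k).toAddSubgroup := by
  have hmono : Monotone fun r => (spread n p)^[r] (B.V k).toAddSubgroup :=
    monotone_nat_of_le_succ fun r => by
      rw [Function.iterate_succ_apply']
      exact le_spread _
  have hst : ∀ r, IsStable (n := n) (p := p) ((spread n p)^[r] (B.V k).toAddSubgroup) := fun r => by
    induction r with
    | zero => exact B.isStable_V k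
    | succ r ih =>
      rw [Function.iterate_succ_apply']
      exact ih.spread
  have hx : x ∈ Submodule.span (Dxt n p) (B.V k : Set M) := hgen ▸ Submodule.mem_top
  induction hx using Submodule.span_induction with
  | mem x hx => exact ⟨0, hx⟩
  | zero => exact ⟨0, zero_mem _⟩
  | add x y _ _ hx hy =>
    obtain ⟨r, hx⟩ := hx
    obtain ⟨s, hy⟩ := hy
    exact ⟨max r s, add_mem (hmono (le_max_left r s) hx) (hmono (le_max_right r s) hy)⟩
  | smul P x _ hx =>
    induction P using Dxt.induction with
    | h1 => rwa [one_smul]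
    | hadd P Q hP hQ =>
      obtain ⟨r, hx⟩ := hP
      obtain ⟨s, hy⟩ := hQ
      rw [add_smul]
      exact ⟨max r s, add_mem (hmono (le_max_left r s) hx) (hmono (le_max_right r s) hy)⟩
    | hfn a P hP =>
      obtain ⟨r, hP⟩ := hP
      rw [mul_smul]
      exact ⟨r, (hst r).fn_smul_mem a _ hP⟩
    | hdd i P hP =>
      obtain ⟨r, hP⟩ := hP
      rw [mul_smul]
      rcases i with i | j
      · exact ⟨r, (hst r).dd_smul_mem i _ hP⟩
      · refine ⟨r + 1, ?_⟩
        rw [Function.iterate_succ_apply']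
        exact dd_smul_mem_spread j hP

/-- A Bernstein polynomial for `V_k` gives one for `V_{k+1}`. -/
theorem exists_bernstein_succ {k k₁ : ℤ}
    (hgen : Submodule.span (Dxt n p) (B.V k : Set M) = ⊤) {q : Polynomial ℂ}
    (hq : ∀ l : ℤ, k₁ < l → q.eval (l : ℂ) ≠ 0)
    (hqV : ∀ u ∈ B.V k, Polynomial.aeval (theta n p + (k : Dxt n p)) q • u ∈ B.V (k - 1)) :
    ∃ q' : Polynomial ℂ, (∀ l : ℤ, k₁ < l → q'.eval (l : ℂ) ≠ 0) ∧
      ∀ u ∈ B.V (k + 1),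
        Polynomial.aeval (theta n p + ((k + 1 : ℤ) : Dxt n p)) q' • u ∈ B.V k := by
  -- The subgroups `A r` form the filtration above `V_k` generated by the `∂_{t_j}`. The relation
  -- for `V_k` propagates along it (`hbA`), even though `A 1` may be smaller than `V_{k+1}`.
  set A : ℕ → AddSubgroup M := fun r => (spread n p)^[r] (B.V k).toAddSubgroup with hA
  have hsucc : ∀ r, A (r + 1) = spread n p (A r) := fun r => Function.iterate_succ_apply' _ _ _
  have hst : ∀ r, IsStable (n := n) (p := p) (A r) := fun r => by
    induction r with
    | zero => exact B.isStable_V k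
    | succ r ih => rw [hsucc]; exact ih.spread
  have hmono : Monotone A := monotone_nat_of_le_succ fun r => by rw [hsucc]; exact le_spread _
  have hdA : ∀ r j, ∀ u ∈ A r, (dd (Sum.inr j) : Dxt n p) • u ∈ A (r + 1) := fun r j u hu => by
    rw [hsucc]
    exact dd_smul_mem_spread j hu
  have hbA : ∀ r, ∀ u ∈ A (r + 1),
      Polynomial.aeval (theta n p + ((k + (r + 1 : ℕ) : ℤ) : Dxt n p)) q • u ∈ A r := fun r => by
    induction r with
    | zero =>
      rw [hsucc]
      exact aeval_smul_mem_of_mem_spread (S' := (B.V (k - 1)).toAddSubgroup) (hst 0)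
        (fun j u hu => Bifiltration.dd_smul_mem_V j hu (by lia)) hqV
    | succ r ih =>
      rw [hsucc (r + 1)]
      have := aeval_smul_mem_of_mem_spread (hst (r + 1)) (hdA r) ih
      rwa [show k + ((r + 1 : ℕ) : ℤ) + 1 = k + ((r + 1 + 1 : ℕ) : ℤ) by push_cast; ring] at this
  have hθ : ∀ u ∈ B.V (k + 1), (theta n p + (p : Dxt n p)) • u ∈ A 1 := fun u hu => by
    rw [theta_add_natCast, Finset.sum_smul]
    refine sum_mem fun j _ => ?_
    rw [mul_smul]
    exact hdA 0 j _ (Bifiltration.tt_smul_mem_V j hu rfl)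
  -- In this case the factor `X - (k + 1 - p)` is harmless. At `θ + k + 1` it becomes `θ + p`, which
  -- maps `V_{k+1}` to `A 1`, and `q` leads on to `V_k`.
  by_cases hk : k + 1 - p ≤ k₁
  · refine ⟨q * (Polynomial.X - Polynomial.C ((k + 1 - p : ℤ) : ℂ)), fun l hl => ?_, fun u hu => ?_⟩
    · rw [Polynomial.eval_mul, Polynomial.eval_sub, Polynomial.eval_X, Polynomial.eval_C]
      refine mul_ne_zero (hq l hl) (sub_ne_zero.2 ?_)
      exact_mod_cast (by lia : l ≠ k + 1 - p)
    · have h := hbA 0 _ (hθ u hu)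
      rw [map_mul, mul_smul, map_sub, Polynomial.aeval_X, Polynomial.aeval_C, map_intCast]
      rw [zero_add, Nat.cast_one] at h
      rwa [show theta n p + ((k + 1 : ℤ) : Dxt n p) - ((k + 1 - p : ℤ) : Dxt n p) =
        theta n p + (p : Dxt n p) by push_cast; abel]
  -- Otherwise `V_{k+1}` is contained in `A 1` and `q` itself works. An element of `A (r + 2)`
  -- descends to `A (r + 1)`: there `q(θ + k + r + 2)` is the non-zero constant `q(k + r + 2 - p)`
  -- plus a multiple of `θ + p`, whose value lies in `A 1`.
  · refine ⟨q, hq, fun u hu => hbA 0 u ?_⟩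
    obtain ⟨r, hr⟩ : ∃ r, u ∈ A r := mem_iterate_spread hgen u
    induction r with
    | zero => exact hmono zero_le_one hr
    | succ r ih =>
      rcases r with _ | r
      · exact hr
      · refine ih ((hst (r + 1)).mem_of_algebraMap_smul_mem
          (hq (k + (r + 1 + 1 : ℕ) - p) (by push_cast; lia)) ?_)
        have h := hbA (r + 1) u hr
        have hcomm : (theta n p + (p : Dxt n p)) * Polynomial.aeval
            (theta n p + ((k + (r + 1 + 1 : ℕ) : ℤ) : Dxt n p))
              (q /ₘ (Polynomial.X - Polynomial.C ((k + (r + 1 + 1 : ℕ) - p : ℤ) : ℂ))) =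
            Polynomial.aeval (theta n p + ((k + (r + 1 + 1 : ℕ) : ℤ) : Dxt n p))
              (q /ₘ (Polynomial.X - Polynomial.C ((k + (r + 1 + 1 : ℕ) - p : ℤ) : ℂ))) *
                (theta n p + (p : Dxt n p)) := by
          refine (aeval_mul_of_semiconj ?_ _).symm
          exact ((Commute.refl (theta n p)).add_right (Nat.commute_cast _ _)).add_left
            (Int.cast_commute _ _)
        rw [aeval_eq_eval_add _ (k + (r + 1 + 1 : ℕ) - p)] at h
        rw [show theta n p + ((k + (r + 1 + 1 : ℕ) : ℤ) : Dxt n p) -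
          ((k + (r + 1 + 1 : ℕ) - p : ℤ) : Dxt n p) = theta n p + (p : Dxt n p) by
            push_cast; abel, hcomm, add_smul, mul_smul] at h
        exact (add_mem_cancel_right ((hst (r + 1)).aeval_smul_mem _ _ _
          (hmono (by lia) (hθ u hu)))).1 h

/-- Below `0` the polynomial `b` works by assumption, at `0` by the main hypothesis; from there the
induction climbs, adding only factors with roots at most `k₁`. -/
theorem exists_bernstein (hgen : Submodule.span (Dxt n p) (B.V 0 : Set M) = ⊤)
    {b : Polynomial ℂ} (hbV : ∀ m ∈ B.V 0, Polynomial.aeval (theta n p) b • m ∈ B.V (-1))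
    {k₁ : ℤ} (hk₁ : ∀ k : ℤ, k₁ < k → b.eval (k : ℂ) ≠ 0)
    (h : ∀ k : ℤ, k₁ < k → k < 0 → ∀ m ∈ B.V k,
      Polynomial.aeval (theta n p + (k : Dxt n p)) b • m ∈ B.V (k - 1)) (k : ℤ) (hk : k₁ < k) :
    ∃ q : Polynomial ℂ, (∀ l : ℤ, k₁ < l → q.eval (l : ℂ) ≠ 0) ∧
      ∀ u ∈ B.V k, Polynomial.aeval (theta n p + (k : Dxt n p)) q • u ∈ B.V (k - 1) := by
  rcases lt_or_ge k 0 with hk0 | hk0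
  · exact ⟨b, hk₁, h k hk hk0⟩
  · obtain ⟨m, rfl⟩ := Int.eq_ofNat_of_zero_le hk0
    clear hk hk0
    induction m with
    | zero =>
      refine ⟨b, hk₁, fun u hu => ?_⟩
      rw [Nat.cast_zero, Int.cast_zero, add_zero]
      exact hbV u hu
    | succ m ih =>
      obtain ⟨q, hq, hqV⟩ := ih
      have hgen' : Submodule.span (Dxt n p) (B.V m : Set M) = ⊤ :=
        top_le_iff.1 (hgen.symm.trans_le (Submodule.span_mono (B.V_mono (by lia))))
      obtain ⟨q', hq', hqV'⟩ := exists_bernstein_succ hgen' hq hqV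
      refine ⟨q', hq', fun u hu => ?_⟩
      rw [Nat.cast_succ, add_sub_cancel_right]
      exact hqV' u hu

/-- Koszul chains in `V_{k+j}` with small boundary can be moved to `V_{k+j-1}`. -/
theorem exists_sub_koszulD_mem {k : ℤ} {j : ℕ} {q : Polynomial ℂ} (hq : q.eval (k : ℂ) ≠ 0)
    (hqV : ∀ u ∈ B.V (k + j), Polynomial.aeval (theta n p + ((k + j : ℤ) : Dxt n p)) q • u ∈
      B.V (k + j - 1)) {c : Finset (Fin p) → M} (hc : ∀ s, c s ∈ B.V (k + j))
    (hcs : ∀ s, s.card ≠ j → c s = 0) (hdc : ∀ s, koszulD n M c s ∈ B.V (k + j - 2)) :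
    ∃ w : Finset (Fin p) → M, (∀ s, s.card ≠ j + 1 → w s = 0) ∧
      ∀ s, c s - koszulD n M w s ∈ B.V (k + j - 1) := by
  -- `q(θ + k + j) = q(k) + (θ + j) r(θ + k + j)`, and Cartan's formula is applied to the chain `c'
  -- = r(θ + k + j) c`.
  set r := q /ₘ (Polynomial.X - Polynomial.C (k : ℂ)) with hr
  set a : ℂ := q.eval (k : ℂ) with ha
  let E (l : ℤ) : Dxt n p := Polynomial.aeval (theta n p + (l : Dxt n p)) r
  let c' : Finset (Fin p) → M := fun s => E (k + j) • c s
  have hdc' : ∀ s, koszulD n M c' s = E (k + j - 1) • koszulD n M c s := fun s => by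
    rw [koszulD_apply, koszulD_apply, Finset.smul_sum]
    refine Finset.sum_congr rfl fun i _ => ?_
    rw [dxt_zsmul_comm, ← mul_smul, ← mul_smul, aeval_theta_tt, sub_add_cancel]
  -- The boundary of `c` lies two steps down, polynomials in `θ` preserve `V`, and `∂_t` climbs back
  -- one step.
  have hhop : ∀ s, hop n (koszulD n M c') s ∈ B.V (k + j - 1) := fun s => by
    refine sum_mem fun i _ => zsmul_mem ?_ _
    refine Bifiltration.dd_smul_mem_V (k := k + j - 2) i ?_ (by lia)
    rw [hdc']
    exact (B.isStable_V _).aeval_smul_mem _ _ _ (hdc _)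
  -- Chosen so that `q(k) (c - δ w) = q(k) c + δ h c' = q(θ + k + j) c - h δ c'`, where both terms
  -- on the right lie in `V_{k+j-1}`.
  let w : Finset (Fin p) → M := fun s => -(algebraMap ℂ (Dxt n p) a⁻¹ • hop n c' s)
  have hws : ∀ s, s.card ≠ j + 1 → w s = 0 := fun s hs => by
    have : hop n c' s = 0 := Finset.sum_eq_zero fun i hi => by
      change _ • (_ • (E (k + j) • c (s.erase i))) = 0
      rw [hcs (s.erase i), smul_zero, smul_zero, smul_zero]
      have := Finset.card_erase_add_one hi
      lia
    change -(_ • _) = (0 : M)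
    rw [this, smul_zero, neg_zero]
  refine ⟨w, hws, fun s => ?_⟩
  by_cases hs : s.card = j
  · refine (B.isStable_V (k + j - 1)).mem_of_algebraMap_smul_mem hq ?_
    have h1 : algebraMap ℂ (Dxt n p) a • koszulD n M w s = -koszulD n M (hop n c') s := by
      rw [koszulD_apply, koszulD_apply, Finset.smul_sum, ← Finset.sum_neg_distrib]
      refine Finset.sum_congr rfl fun i _ => ?_
      change _ • _ • _ • -(_ • _) = _
      rw [smul_neg, smul_neg, smul_neg, dxt_zsmul_comm (algebraMap ℂ (Dxt n p) a), ← mul_smul, ← mul_smul,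
        ← Algebra.commutes a⁻¹ (algebraMap ℂ (Dxt n p) a * tt i), ← mul_assoc, ← map_mul,
        inv_mul_cancel₀ hq, map_one, one_mul]
    have h2 := hqV _ (hc s)
    rw [aeval_eq_eval_add _ k, add_smul, mul_smul, show theta n p + ((k + j : ℤ) : Dxt n p) -
      (k : Dxt n p) = theta n p + (s.card : Dxt n p) by rw [hs]; push_cast; abel] at h2
    have h3 := koszul_homotopy (n := n) c' s
    rw [smul_sub, h1, sub_neg_eq_add]
    change _ + (theta n p + (s.card : Dxt n p)) • c' s ∈ _ at h2
    rw [← h3, ← add_assoc] at h2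
    exact (add_mem_cancel_right (hhop s)).1 h2
  · have h1 : koszulD n M w s = 0 := by
      rw [koszulD_apply]
      refine Finset.sum_eq_zero fun i hi => ?_
      rw [hws (insert i s), smul_zero, smul_zero]
      rw [Finset.card_insert_of_notMem (Finset.mem_compl.1 hi)]
      lia
    rw [hcs s hs, h1, sub_zero]
    exact zero_mem _

end

end

section

variable {n p : ℕ} {M : Type u} [AddCommGroup M] [Module (Dxt n p) M] {B : Bifiltration n p M}

/-! ### Truncation of the Koszul complex -/

theorem koszulV_le_top (B : Bifiltration n p M) (k : ℤ) (j : ℕ) :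
    koszulV B k j ≤ koszulV (topBifiltration M) k j :=
  fun _ hc s => ⟨⟨0, trivial⟩, (hc s).2⟩

/-- The inclusion of the truncated Koszul complex in the Koszul complex. -/
def koszulIncl (B : Bifiltration n p M) (k : ℤ) :
    koszulComplex B k ⟶ koszulComplex (topBifiltration M) k :=
  ChainComplex.ofHom
    (fun m => FiltMod.ofHom (X := koszulX B k m) (Y := koszulX (topBifiltration M) k m)
      (Submodule.inclusion (koszulV_le_top B k m)) (fun _ _ _ _ => trivial))
    (fun m => FiltMod.hom_ext fun c => by
      change koszulV B k (m + 1) at c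
      apply Subtype.ext
      have h1 := KoszulResolution.koszulComplex_d (B := topBifiltration M) k m
        (Submodule.inclusion (koszulV_le_top B k (m + 1)) c)
      have h2 := KoszulResolution.koszulComplex_d k m c
      exact h1.trans h2.symm)

theorem koszulD_eq_zero {k : ℤ} {j : ℕ} (c : koszulV B k j)
    (h : ∀ i, FiltMod.lin ((koszulComplex B k).d j i) c = 0) : koszulD n M c.1 = 0 := by
  rcases j with _ | j
  · exact koszulD_of_card_zero fun s hs => (c.2 s).2 hs
  · rw [← KoszulResolution.koszulComplex_d k j c]
    exact congrArg Subtype.val (h j)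

theorem lin_koszulComplex_d_eq_zero {k : ℤ} {j : ℕ} (c : koszulV B k j)
    (h : koszulD n M c.1 = 0) (i : ℕ) : FiltMod.lin ((koszulComplex B k).d j i) c = 0 := by
  by_cases hi : i + 1 = j
  · subst hi
    exact Subtype.ext ((KoszulResolution.koszulComplex_d k i c).trans h)
  · exact lin_d_eq_zero _ _ _ hi _

/-- A chain lies in `V_{k₁+r+j}` for some `r`, and `exists_sub_koszulD_mem` lowers `r` one step at a
time. Subtracting boundaries leaves `δ c` unchanged, so the bound on it persists; the values `q(k₁ +
r + 1)` used on the way are non-zero. -/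
theorem exists_sub_koszulD_mem_of_bernstein {k₁ : ℤ}
    (hb : ∀ k, k₁ < k → ∃ q : Polynomial ℂ, (∀ l : ℤ, k₁ < l → q.eval (l : ℂ) ≠ 0) ∧
      ∀ u ∈ B.V k, Polynomial.aeval (theta n p + (k : Dxt n p)) q • u ∈ B.V (k - 1))
    {j : ℕ} {c : Finset (Fin p) → M} (hcs : ∀ s, s.card ≠ j → c s = 0)
    (hdc : ∀ s, koszulD n M c s ∈ B.V (k₁ + j - 1)) :
    ∃ w : Finset (Fin p) → M, (∀ s, s.card ≠ j + 1 → w s = 0) ∧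
      ∀ s, c s - koszulD n M w s ∈ B.V (k₁ + j) := by
  obtain ⟨d, k, hc⟩ := B.exists_mem_of_finite c
  obtain ⟨r, hr⟩ : ∃ r : ℕ, ∀ s, c s ∈ B.V (k₁ + r + j) := by
    refine ⟨(k - k₁ - j).toNat, fun s => B.V_mono ?_ ⟨d, hc s⟩⟩
    lia
  clear hc
  induction r generalizing c with
  | zero =>
    refine ⟨0, fun _ _ => rfl, fun s => ?_⟩
    rw [map_zero, Pi.zero_apply, sub_zero]
    have := hr s
    rwa [Nat.cast_zero, add_zero] at this
  | succ r ih =>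
    obtain ⟨q, hq, hqV⟩ := hb (k₁ + (r + 1 : ℕ) + j) (by lia)
    obtain ⟨w, hws, hw⟩ := exists_sub_koszulD_mem (hq (k₁ + (r + 1 : ℕ)) (by lia)) hqV hr hcs
      fun s => B.V_mono (by lia) (hdc s)
    obtain ⟨w', hws', hw'⟩ := ih (c := c - koszulD n M w)
      (fun s hs => by
        rw [Pi.sub_apply, hcs s hs, KoszulResolution.koszulD_supp hws s hs, sub_zero])
      (fun s => by
        rw [map_sub, koszulD_comp, sub_zero]
        exact hdc s)
      (fun s => by
        have := hw s
        rwa [show k₁ + ((r + 1 : ℕ) : ℤ) + j - 1 = k₁ + r + j by push_cast; ring] at this)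
    refine ⟨w + w', fun s hs => ?_, fun s => ?_⟩
    · rw [Pi.add_apply, hws s hs, hws' s hs, add_zero]
    · rw [map_add, Pi.add_apply, ← sub_sub]
      exact hw' s

/-- The truncated Koszul complex computes the homology of the Koszul complex. -/
theorem quasiIso_koszulIncl {k₁ : ℤ}
    (hb : ∀ k, k₁ < k → ∃ q : Polynomial ℂ, (∀ l : ℤ, k₁ < l → q.eval (l : ℂ) ≠ 0) ∧
      ∀ u ∈ B.V k, Polynomial.aeval (theta n p + (k : Dxt n p)) q • u ∈ B.V (k - 1)) :
    QuasiIso (((FiltMod.forget n p).mapHomologicalComplex (ComplexShape.down ℕ)).map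
      (koszulIncl B k₁)) := by
  refine module_chain_quasiIso_of_elements _ (fun j x hx y hy => ?_) fun j y hy => ?_
  · change koszulV B k₁ j at x
    change koszulV (topBifiltration M) k₁ (j + 1) at y
    have hxy : koszulD n M y.1 = x.1 :=
      (KoszulResolution.koszulComplex_d k₁ j y).symm.trans (congrArg Subtype.val hy).symm
    -- Injectivity on homology: `y` bounds `x` in the full complex, and the boundary `x` is small
    -- enough for `y` to be moved into the truncation without changing its boundary.
    obtain ⟨w, hws, hw⟩ := exists_sub_koszulD_mem_of_bernstein hb (c := y.1)
      (fun s => (y.2 s).2) fun s => by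
        rw [hxy]
        have := (x.2 s).1
        rwa [show k₁ + ((j + 1 : ℕ) : ℤ) - 1 = k₁ + j by push_cast; ring]
    let z : koszulV B k₁ (j + 1) := ⟨y.1 - koszulD n M w, fun s => ⟨hw s, fun hs => by
      rw [Pi.sub_apply, (y.2 s).2 hs, KoszulResolution.koszulD_supp hws s hs, sub_zero]⟩⟩
    refine ⟨z, Subtype.ext ((KoszulResolution.koszulComplex_d k₁ j z).trans ?_)⟩
    change koszulD n M (y.1 - koszulD n M w) = x.1
    rw [map_sub, koszulD_comp, sub_zero, hxy]
  · change koszulV (topBifiltration M) k₁ j at y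
    have hy0 : koszulD n M y.1 = 0 := koszulD_eq_zero y hy
    -- Surjectivity on homology: the cycle `y` is homologous to one in the truncation.
    obtain ⟨w, hws, hw⟩ := exists_sub_koszulD_mem_of_bernstein hb (c := y.1)
      (fun s => (y.2 s).2) fun s => by rw [hy0]; exact zero_mem _
    let x : koszulV B k₁ j := ⟨y.1 - koszulD n M w, fun s => ⟨hw s, fun hs => by
      rw [Pi.sub_apply, (y.2 s).2 hs, KoszulResolution.koszulD_supp hws s hs, sub_zero]⟩⟩
    have hx0 : koszulD n M x.1 = 0 := by
      change koszulD n M (y.1 - koszulD n M w) = 0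
      rw [map_sub, koszulD_comp, sub_zero, hy0]
    refine ⟨x, lin_koszulComplex_d_eq_zero x hx0,
      (⟨w, fun s => ⟨⟨0, trivial⟩, hws s⟩⟩ : koszulV (topBifiltration M) k₁ (j + 1)),
      Subtype.ext ?_⟩
    refine Eq.trans ?_ (KoszulResolution.koszulComplex_d k₁ j _).symm
    change y.1 - (y.1 - koszulD n M w) = koszulD n M w
    rw [sub_sub_cancel]

namespace BifilteredFreeResolution

theorem nonempty_iso_unfilt [HasDerivedCategory.{w} (ModuleCat.{u} (Dx n p))]
    (R : BifilteredFreeResolution B) (k : ℤ) :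
    Nonempty (DerivedCategory.Q.obj (toCochain (unfilt (quotComplex R k))) ≅
      DerivedCategory.Q.obj (toCochain (unfilt (koszulComplex B k)))) := by
  obtain ⟨i₁⟩ := nonempty_iso_of_quasiIso _
    (R.toKoszulResolution.toKoszul_strictQuasiIso k).quasiIso_unfilt
  obtain ⟨i₂⟩ := nonempty_iso_of_quasiIso _ (R.toQuot_strictQuasiIso k).quasiIso_unfilt
  exact ⟨i₂.symm ≪≫ i₁⟩

end BifilteredFreeResolution

end

end DMod

end

theorem proposition9 {n p : ℕ} {M : Type u} [AddCommGroup M] [Module (DMod.Dxt n p) M]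
    [HasDerivedCategory.{w} (ModuleCat.{u} (DMod.Dx n p))]
    (B : DMod.Bifiltration n p M) (hgood : B.IsGood)
    (hgen : Submodule.span (DMod.Dxt n p) (B.V 0 : Set M) = ⊤)
    (b : Polynomial ℂ) (hb : b ≠ 0)
    (hbV : ∀ m ∈ B.V 0, Polynomial.aeval (DMod.theta n p) b • m ∈ B.V (-1))
    (k₁ : ℤ) (hk₁ : ∀ k : ℤ, k₁ < k → b.eval (k : ℂ) ≠ 0)
    (R : DMod.BifilteredFreeResolution B) :
    -- the two filtered complexes are isomorphic in the filtered derived category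
    DMod.IsoDF (DMod.boundedRight n p)
      (DMod.toCochain (DMod.koszulComplex B k₁)) (DMod.toCochain (DMod.quotComplex R k₁)) ∧
    -- when the resolution is bounded, already in the one of bounded complexes
    ((∃ l : ℕ, ∀ i, l < i → Subsingleton (R.L i)) →
      DMod.IsoDF (DMod.bounded n p)
        (DMod.toCochain (DMod.koszulComplex B k₁)) (DMod.toCochain (DMod.quotComplex R k₁))) ∧
    -- the terms of the second complex are filtered free modules of finite rank
    (∀ i, ((DMod.quotComplex R k₁).X i).IsFree) ∧
    -- both complexes represent the restriction in the derived category of `D`-modules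
    ((∀ k : ℤ, k₁ < k → k < 0 → ∀ m ∈ B.V k,
        Polynomial.aeval (DMod.theta n p + (k : DMod.Dxt n p)) b • m ∈ B.V (k - 1)) →
      ∀ P : ProjectiveResolution (ModuleCat.of (DMod.Dxt n p) M),
        Nonempty (DerivedCategory.Q.obj (DMod.toCochain (DMod.unfilt (DMod.koszulComplex B k₁))) ≅
          DerivedCategory.Q.obj (DMod.toCochain (DMod.restriction P))) ∧
        Nonempty (DerivedCategory.Q.obj (DMod.toCochain (DMod.unfilt (DMod.quotComplex R k₁))) ≅
          DerivedCategory.Q.obj (DMod.toCochain (DMod.restriction P)))) := by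
  refine ⟨R.isoDF k₁ (DMod.boundedRight_toCochain _) (DMod.boundedRight_toCochain _)
    (DMod.boundedRight_toCochain _), R.isoDF_bounded k₁,
    fun i => DMod.quotX_isFree (R.free i) k₁, fun h P => ?_⟩
  -- The truncated Koszul complex is compared with the full one, which represents `i^*M`; the
  -- quotient complex follows through the roof.
  obtain ⟨i₁⟩ := DMod.nonempty_iso_of_quasiIso _
    (DMod.quasiIso_koszulIncl (DMod.exists_bernstein hgen hbV hk₁ h))
  obtain ⟨i₂⟩ := R.nonempty_iso_restriction k₁ P
  obtain ⟨i₃⟩ := R.nonempty_iso_unfilt k₁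
  exact ⟨⟨i₁ ≪≫ i₂⟩, ⟨i₃ ≪≫ i₁ ≪≫ i₂⟩⟩
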